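/- **Setting.** Let $N,n,m,p,q\ge 1$ be integers. Consider followers $i=1,\dots,N$ with $x_i(t)\in\mathbb R^n$, $u_i(t)\in\mathbb R^m$, $y_i(t)\in\mathbb R^p$ and a leader (node $0$) with $v(t)\in\mathbb R^q$: $$x_i(t+1)=(A+\delta_iA)x_i(t)+(B+\delta_iB)u_i(t-r_{con})+(E+\delta_iE)v(t),\quad y_i(t)=(C+\delta_iC)x_i(t),$$ $$v(t+1)=Sv(t),\quad y_0(t)=-Fv(t),\quad e_i(t)=y_i(t)-y_0(t),\qquad t=0,1,2,\dots,$$ where $A,B,E,C,F,S$ are real matrices and $w=(\delta_iA,\delta_iB,\delta_iE,\delta_iC)_{i=1}^N$ is the vector of unknown parameters. Let $r_{con},r_{com}\in\{0,1,2,\dots\}$ be the input and communication delays, and $r=r_{con}+r_{com}$. Let $\bar{\mathcal G}$ be a digraph on $\{0,1,\dots,N\}$ with weighted adjacency matrix $(a_{ij})$: $a_{ii}=0$, $a_{ij}\ge 0$, $a_{ij}>0$ if and only if there is an edge from $j$ to $i$, and $a_{ij}=a_{ji}$ if there are edges in both directions. Put $e_{vi}(t)=\sum_{j=0}^N a_{ij}(y_i(t)-y_j(t))$.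 A pair $(G_1,G_2)$ is a *minimal $p$-copy internal model* of $S$ if $G_1=I_p\otimes\beta$, $G_2=I_p\otimes\sigma$, where $\beta$ is a real square matrix whose characteristic polynomial is the minimal polynomial of $S$ and $\sigma$ is a column vector such that $(\beta,\sigma)$ is controllable. Let $n_z$ be the size of $G_1$. For matrices $K_1\in\mathbb R^{m\times n_z}$, $K_2\in\mathbb R^{m\times n}$, $L\in\mathbb R^{n\times p}$ the *distributed dynamic output feedback law* is, for $i=1,\dots,N$, $$u_i(t)=K_1\bar z_i(t-r_{com})+K_2\bar\eta_i(t-r_{com}),\qquad \bar z_i(t+1)=G_1\bar z_i(t)+G_2e_{vi}(t),$$ $$\bar\xi_i(t+1)=A\bar\xi_i(t)+Bu_i(t-r_{con})-LC\bar\eta_i(t)+Le_{vi}(t),$$ where $\bar\eta_i(t)=\sum_{j=0}^N a_{ij}(\bar\xi_i(t)-\bar\xi_j(t))$ and $\bar\xi_0=0$. The closed-loop equations hold for $t\ge 0$, with arbitrary initial values of $(x_i,\bar z_i,\bar\xi_i)$ at the times $-r,\dots,0$ and arbitrary $v(0)$ (the formula for $u_i(t)$ is used for $t\ge -r_{con}$).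 The law *solves the cooperative robust output regulation problem* if 1. the nominal closed-loop system ($w=0$) with $v=0$ is exponentially stable, and 2. there is an open neighborhood $W$ of $w=0$ such that for every $w\in W$ and all initial conditions, $\lim_{t\to\infty}e_i(t)=0$ for $i=1,\dots,N$. **Theorem 4.2.** Assume that - $(A,B)$ is stabilizable and $(C,A)$ is detectable; - $\operatorname{rank}\begin{pmatrix}A-\lambda I_n&B\\ C&0\end{pmatrix}=n+p$ for every eigenvalue $\lambda\in\mathbb C$ of $S$; - all eigenvalues of $S$ have modulus $1$; - $A$ has no eigenvalue of modulus greater than $1$. Let $(G_1,G_2)$ be a minimal $p$-copy internal model of $S$. Then there exist $K_1\in\mathbb R^{m\times n_z}$, $K_2\in\mathbb R^{m\times n}$, $L\in\mathbb R^{n\times p}$ such that the distributed dynamic output feedback law above solves the cooperative robust output regulation problem if and only if $\bar{\mathcal G}$ contains a directed spanning tree with root $0$. -/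

import Mathlib

open scoped Matrix Kronecker Topology

noncomputable section

namespace CoopReg

/-! ### Matrix notions -/

/-- The complex eigenvalues of a real square matrix. -/
def eigs {n : ℕ} (A : Matrix (Fin n) (Fin n) ℝ) : Set ℂ :=
  spectrum ℂ (A.map (algebraMap ℝ ℂ))

/-- A real square matrix is Schur if all its eigenvalues have modulus smaller than one. -/
def IsSchur {n : ℕ} (A : Matrix (Fin n) (Fin n) ℝ) : Prop :=
  ∀ μ ∈ eigs A, ‖μ‖ < 1

/-- `(A, B)` is stabilizable (in discrete time). -/
def Stabilizable {n m : ℕ} (A : Matrix (Fin n) (Fin n) ℝ) (B : Matrix (Fin n) (Fin m) ℝ) : Prop :=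
  ∃ K : Matrix (Fin m) (Fin n) ℝ, IsSchur (A + B * K)

/-- `(C, A)` is detectable (in discrete time). -/
def Detectable {n p : ℕ} (C : Matrix (Fin p) (Fin n) ℝ) (A : Matrix (Fin n) (Fin n) ℝ) : Prop :=
  ∃ L : Matrix (Fin n) (Fin p) ℝ, IsSchur (A - L * C)

/-- The controllability matrix `[B, A B, …, A ^ (n - 1) B]`; its column `(k, j)` is the
`j`-th column of `A ^ k B`. -/
def controllabilityMatrix {n m : ℕ} (A : Matrix (Fin n) (Fin n) ℝ) (B : Matrix (Fin n) (Fin m) ℝ) :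
    Matrix (Fin n) (Fin n × Fin m) ℝ :=
  Matrix.of fun i kj => (A ^ (kj.1 : ℕ) * B) i kj.2

/-- `(A, B)` is controllable. -/
def Controllable {n m : ℕ} (A : Matrix (Fin n) (Fin n) ℝ) (B : Matrix (Fin n) (Fin m) ℝ) : Prop :=
  (controllabilityMatrix A B).rank = n

/-- `rank [A - μ I, B; C, 0] = n + p` for every eigenvalue `μ` of `S`. -/
def TransmissionZeroCondition {n m p q : ℕ} (A : Matrix (Fin n) (Fin n) ℝ)
    (B : Matrix (Fin n) (Fin m) ℝ) (C : Matrix (Fin p) (Fin n) ℝ)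
    (S : Matrix (Fin q) (Fin q) ℝ) : Prop :=
  ∀ μ ∈ eigs S,
    (Matrix.fromBlocks (A.map (algebraMap ℝ ℂ) - μ • (1 : Matrix (Fin n) (Fin n) ℂ))
      (B.map (algebraMap ℝ ℂ)) (C.map (algebraMap ℝ ℂ)) 0).rank = n + p

/-- `(G₁, G₂) = (I_p ⊗ β, I_p ⊗ σ)` is a minimal `p`-copy internal model of `S`: the
characteristic polynomial of `β` is the minimal polynomial of `S`, and `(β, σ)` is controllable,
`σ` being a single column. The state space of the internal model has dimension `n_z = p * d` and
is indexed by `Fin p × Fin d`; the column index `(k, 0)` of `I_p ⊗ σ` is identified with `k`. -/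
def IsMinimalPCopyInternalModel {p q d : ℕ} (S : Matrix (Fin q) (Fin q) ℝ)
    (G₁ : Matrix (Fin p × Fin d) (Fin p × Fin d) ℝ) (G₂ : Matrix (Fin p × Fin d) (Fin p) ℝ) :
    Prop :=
  ∃ (β : Matrix (Fin d) (Fin d) ℝ) (σ : Matrix (Fin d) (Fin 1) ℝ),
    β.charpoly = minpoly ℝ S ∧ Controllable β σ ∧
    G₁ = (1 : Matrix (Fin p) (Fin p) ℝ) ⊗ₖ β ∧
    G₂ = ((1 : Matrix (Fin p) (Fin p) ℝ) ⊗ₖ σ).submatrix id (fun k => (k, 0))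

/-! ### The communication digraph; `G.Adj j i` is the edge from `j` to `i` -/

/-- `T` is a directed spanning tree of `G` with root `root`: a subgraph containing all nodes, in
which the root has no parent, every other node has exactly one parent, and every node is reachable
from the root. -/
structure IsDirectedSpanningTree {V : Type*} (G T : Digraph V) (root : V) : Prop where
  sub : ∀ i j, T.Adj i j → G.Adj i j
  root_no_parent : ∀ j, ¬ T.Adj j root
  unique_parent : ∀ i, i ≠ root → ∃! j, T.Adj j i
  reachable : ∀ i, Relation.ReflTransGen T.Adj root i

/-- `G` contains a directed spanning tree with root `root`. -/
def HasDirectedSpanningTree {V : Type*} (G : Digraph V) (root : V) : Prop :=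
  ∃ T : Digraph V, IsDirectedSpanningTree G T root

/-- `a` is a weighted adjacency matrix of `G`: `a i j` is the weight of the edge from `j` to `i`,
and the two weights of an undirected edge agree. -/
structure IsWeightedAdjacency {V : Type*} (G : Digraph V) (a : Matrix V V ℝ) : Prop where
  diag : ∀ i, a i i = 0
  nonneg : ∀ i j, 0 ≤ a i j
  pos_iff : ∀ i j, 0 < a i j ↔ G.Adj j i
  undirected : ∀ i j, G.Adj i j → G.Adj j i → a i j = a j i

/-- For a family `s` of vectors attached to the nodes `0, 1, …, N`, the quantity
`∑ j, a i j • (s i - s j)` at the follower `i`. Followers are numbered by `Fin N`, follower `i`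
being the node `i.succ`. Nodes `j` that are not neighbours of `i` do not contribute, as `a i j = 0`
for them. -/
def relSum {N k : ℕ} (a : Matrix (Fin (N + 1)) (Fin (N + 1)) ℝ) (s : Fin (N + 1) → Fin k → ℝ)
    (i : Fin N) : Fin k → ℝ :=
  ∑ j : Fin (N + 1), a i.succ j • (s i.succ - s j)

/-! ### Plant, uncertainty, control law, closed loop -/

/-- The nominal data of the followers, the exosystem matrix `S`, the matrix `F` of the reference
output `y₀ = - F v`, the input delay and the communication delay. -/
structure Plant (n m p q : ℕ) where
  A : Matrix (Fin n) (Fin n) ℝ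
  B : Matrix (Fin n) (Fin m) ℝ
  E : Matrix (Fin n) (Fin q) ℝ
  C : Matrix (Fin p) (Fin n) ℝ
  F : Matrix (Fin p) (Fin q) ℝ
  S : Matrix (Fin q) (Fin q) ℝ
  rcon : ℕ
  rcom : ℕ

/-- The uncertain parameters `w = (δ_i A, δ_i B, δ_i E, δ_i C)`, `i` ranging over the followers,
a finite-dimensional real vector space with its usual topology. -/
abbrev Uncertainty (N n m p q : ℕ) : Type :=
  (Fin N → Matrix (Fin n) (Fin n) ℝ) × (Fin N → Matrix (Fin n) (Fin m) ℝ) ×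
    (Fin N → Matrix (Fin n) (Fin q) ℝ) × (Fin N → Matrix (Fin p) (Fin n) ℝ)

section

variable {N n m p q d : ℕ}

/-- `A + δ_i A` -/
def Abar (P : Plant n m p q) (w : Uncertainty N n m p q) (i : Fin N) :
    Matrix (Fin n) (Fin n) ℝ := P.A + w.1 i

/-- `B + δ_i B` -/
def Bbar (P : Plant n m p q) (w : Uncertainty N n m p q) (i : Fin N) :
    Matrix (Fin n) (Fin m) ℝ := P.B + w.2.1 i

/-- `E + δ_i E` -/
def Ebar (P : Plant n m p q) (w : Uncertainty N n m p q) (i : Fin N) :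
    Matrix (Fin n) (Fin q) ℝ := P.E + w.2.2.1 i

/-- `C + δ_i C` -/
def Cbar (P : Plant n m p q) (w : Uncertainty N n m p q) (i : Fin N) :
    Matrix (Fin p) (Fin n) ℝ := P.C + w.2.2.2 i

/-- The outputs of all nodes: `y₀ = - F v` for the leader, `y_i = (C + δ_i C) x_i` for the
followers. -/
def nodeOutput (P : Plant n m p q) (w : Uncertainty N n m p q) (v : Fin q → ℝ)
    (x : Fin N → Fin n → ℝ) : Fin (N + 1) → Fin p → ℝ :=
  Fin.cons (-(P.F *ᵥ v)) (fun i => Cbar P w i *ᵥ x i)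

/-- The regulated output `e_i = y_i - y₀`. -/
def regulatedOutput (P : Plant n m p q) (w : Uncertainty N n m p q) (v : Fin q → ℝ)
    (x : Fin N → Fin n → ℝ) (i : Fin N) : Fin p → ℝ :=
  nodeOutput P w v x i.succ - nodeOutput P w v x 0

/-- The virtual regulated output `e_vi = ∑ j, a i j (y_i - y_j)`. -/
def virtualOutput (P : Plant n m p q) (a : Matrix (Fin (N + 1)) (Fin (N + 1)) ℝ)
    (w : Uncertainty N n m p q) (v : Fin q → ℝ) (x : Fin N → Fin n → ℝ) (i : Fin N) : Fin p → ℝ :=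
  relSum a (nodeOutput P w v x) i

/-- `η_i = ∑ j, a i j (ξ_i - ξ_j)`, where `ξ₀ = 0`. -/
def relObserver (a : Matrix (Fin (N + 1)) (Fin (N + 1)) ℝ) (ξ : Fin N → Fin n → ℝ) (i : Fin N) :
    Fin n → ℝ :=
  relSum a (Fin.cons 0 ξ) i

/-- The parameters of a distributed dynamic output feedback law: the internal model `(G₁, G₂)` and
the gains `K₁`, `K₂`, `L`. -/
structure Controller (n m p d : ℕ) where
  G₁ : Matrix (Fin p × Fin d) (Fin p × Fin d) ℝ
  G₂ : Matrix (Fin p × Fin d) (Fin p) ℝ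
  K₁ : Matrix (Fin m) (Fin p × Fin d) ℝ
  K₂ : Matrix (Fin m) (Fin n) ℝ
  L : Matrix (Fin n) (Fin p) ℝ

/-- The control `u_i(t) = K₁ z_i(t - r_com) + K₂ η_i(t - r_com)`. -/
def control (P : Plant n m p q) (a : Matrix (Fin (N + 1)) (Fin (N + 1)) ℝ)
    (κ : Controller n m p d) (z : ℤ → Fin N → Fin p × Fin d → ℝ) (ξ : ℤ → Fin N → Fin n → ℝ)
    (t : ℤ) (i : Fin N) : Fin m → ℝ :=
  κ.K₁ *ᵥ z (t - P.rcom) i + κ.K₂ *ᵥ relObserver a (ξ (t - P.rcom)) i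

/-- `(v, x, z, ξ)` is a trajectory of the closed-loop system with uncertainty `w`. The equations
hold for `t ≥ 0`. The values at the times `-r, …, 0`, where `r = r_con + r_com`, are the (free)
initial condition; values at earlier times never enter. -/
structure IsTrajectory (P : Plant n m p q) (a : Matrix (Fin (N + 1)) (Fin (N + 1)) ℝ)
    (κ : Controller n m p d) (w : Uncertainty N n m p q) (v : ℤ → Fin q → ℝ)
    (x : ℤ → Fin N → Fin n → ℝ) (z : ℤ → Fin N → Fin p × Fin d → ℝ)
    (ξ : ℤ → Fin N → Fin n → ℝ) : Prop where
  exosystem : ∀ t : ℤ, 0 ≤ t → v (t + 1) = P.S *ᵥ v t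
  plant : ∀ t : ℤ, 0 ≤ t → ∀ i, x (t + 1) i =
    Abar P w i *ᵥ x t i + Bbar P w i *ᵥ control P a κ z ξ (t - P.rcon) i + Ebar P w i *ᵥ v t
  internalModel : ∀ t : ℤ, 0 ≤ t → ∀ i, z (t + 1) i =
    κ.G₁ *ᵥ z t i + κ.G₂ *ᵥ virtualOutput P a w (v t) (x t) i
  observer : ∀ t : ℤ, 0 ≤ t → ∀ i, ξ (t + 1) i =
    P.A *ᵥ ξ t i + P.B *ᵥ control P a κ z ξ (t - P.rcon) i
      - (κ.L * P.C) *ᵥ relObserver a (ξ t) i + κ.L *ᵥ virtualOutput P a w (v t) (x t) i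

/-- The nominal closed-loop system (`w = 0`) with `v = 0` is exponentially stable: all trajectories
decay like `c ρ ^ t` times the size of the initial condition, with uniform `c` and `ρ < 1`. -/
def NominalExponentiallyStable (P : Plant n m p q) (a : Matrix (Fin (N + 1)) (Fin (N + 1)) ℝ)
    (κ : Controller n m p d) : Prop :=
  ∃ c ρ : ℝ, 0 < c ∧ 0 < ρ ∧ ρ < 1 ∧
    ∀ (x : ℤ → Fin N → Fin n → ℝ) (z : ℤ → Fin N → Fin p × Fin d → ℝ)
      (ξ : ℤ → Fin N → Fin n → ℝ), IsTrajectory P a κ 0 (fun _ => 0) x z ξ →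
    ∀ M : ℝ, (∀ s : ℤ, -((P.rcon : ℤ) + P.rcom) ≤ s → s ≤ 0 →
        ‖x s‖ ≤ M ∧ ‖z s‖ ≤ M ∧ ‖ξ s‖ ≤ M) →
    ∀ t : ℕ, ‖x t‖ ≤ c * ρ ^ t * M ∧ ‖z t‖ ≤ c * ρ ^ t * M ∧ ‖ξ t‖ ≤ c * ρ ^ t * M

/-- For all uncertainties in some open neighbourhood of `0` and all initial conditions, the
regulated outputs of all followers tend to zero. -/
def RobustRegulation (P : Plant n m p q) (a : Matrix (Fin (N + 1)) (Fin (N + 1)) ℝ)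
    (κ : Controller n m p d) : Prop :=
  ∃ W : Set (Uncertainty N n m p q), IsOpen W ∧ 0 ∈ W ∧ ∀ w ∈ W,
    ∀ (v : ℤ → Fin q → ℝ) (x : ℤ → Fin N → Fin n → ℝ) (z : ℤ → Fin N → Fin p × Fin d → ℝ)
      (ξ : ℤ → Fin N → Fin n → ℝ), IsTrajectory P a κ w v x z ξ →
    ∀ i : Fin N, Filter.Tendsto (fun t : ℕ => regulatedOutput P w (v t) (x t) i)
      Filter.atTop (𝓝 0)

/-- The controller solves the cooperative robust output regulation problem. -/
def SolvesCORP (P : Plant n m p q) (a : Matrix (Fin (N + 1)) (Fin (N + 1)) ℝ)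
    (κ : Controller n m p d) : Prop :=
  NominalExponentiallyStable P a κ ∧ RobustRegulation P a κ

end

end CoopReg

end

/-! Let H be the graph Laplacian with the row and column of the leader removed (`followerLap a`).
Since the leader supplies the reference, the virtual outputs are H applied to the regulated outputs,
and the relative observer states are H applied to the observer states; the network enters only
through H. If every node is reachable from the leader, a maximum-modulus argument puts the spectrum
of H in the open right half-plane; otherwise H has a left null vector.

Necessity. If l is a left null vector of H, the combination of the internal models with weights l
receives no input and evolves by `G₁` alone. The modes of `G₁` have modulus one, so nominal
stability fails.

Sufficiency, nominal stability (`loopStable_of_gains`). The difference between observer and plant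
states is autonomous, and its modes split over the eigenvalues μ of H into those of A - μLC. Once it
vanishes, the plant states mixed by H, together with the internal models, form copies of the
augmented plant whose delayed input gain is μK. Both L and K come from one low-gain result,
`exists_lowGain`, which treats all μ with real part at least a and modulus at most b at once. The
gain is a Riccati feedback of a small matrix P applied to the state predicted by Aʳ; the errors
caused by the delay are proportional to the size of P and are dominated by a fixed margin a².

Small P. Take P = W⁻¹ with W above ε⁻¹ and W + BBᵀ - AWAᵀ positive definite. If no such W existed,
Hahn-Banach would give positive semidefinite X, Y with AᵀXA = X + Y and tr(BᵀXB) bounded by a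
multiple of tr Y. Since A has no eigenvalue outside the closed disk, comparing determinants gives Y
= 0 and makes A isometric for the form X; stabilizability then forces X = 0
(`eq_zero_of_expansion`).

Robust regulation. Stability on histories is an open condition. For a perturbed stable loop, the
minimal polynomial of S in the forward shift kills the exogenous signal, so the filtered trajectory
decays. Because this polynomial is the characteristic polynomial of β and (β, σ) is controllable,
the filtered internal model determines the virtual output (`Controllable.tendsto_zero`), which
therefore tends to zero; inverting H gives the regulated outputs. -/

noncomputable section

namespace CoopReg

/-! ### Linear difference equations with one delay -/

section Delay

variable {E : Type*} [NormedAddCommGroup E] [NormedSpace ℂ E]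

/-- A continuous endomorphism has no eigenvector whose eigenvalue has modulus at least one. -/
def NoUnstableEigenvector (T : E →L[ℂ] E) : Prop :=
  ∀ μ : ℂ, 1 ≤ ‖μ‖ → ∀ s, T s = μ • s → s = 0

/-- In finite dimension injectivity of `μ - T` gives invertibility, so the spectral radius is below
one. Gelfand's formula yields the geometric bound for large exponents; the constant absorbs the
finitely many others. -/
theorem NoUnstableEigenvector.exists_norm_pow_le [FiniteDimensional ℂ E] {T : E →L[ℂ] E}
    (h : NoUnstableEigenvector T) :
    ∃ c ρ : ℝ, 0 < c ∧ 0 < ρ ∧ ρ < 1 ∧ ∀ k : ℕ, ‖T ^ k‖ ≤ c * ρ ^ k := by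
  rcases subsingleton_or_nontrivial E with hE | hE
  · refine ⟨1, 1 / 2, one_pos, by norm_num, by norm_num, fun k => ?_⟩
    have : T ^ k = 0 := ContinuousLinearMap.ext fun x => Subsingleton.elim _ _
    rw [this, norm_zero]; positivity
  · have : CompleteSpace E := FiniteDimensional.complete ℂ E
    have hlt : spectralRadius ℂ T < (1 : NNReal) := by
      refine spectrum.spectralRadius_lt_of_forall_lt T fun μ hμ => ?_
      by_contra hcon
      have h1 : 1 ≤ ‖μ‖ := by
        have := not_lt.1 hcon
        exact_mod_cast this
      refine hμ (ContinuousLinearMap.isUnit_iff_bijective.2 ?_)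
      have hinj : Function.Injective ((algebraMap ℂ (E →L[ℂ] E) μ - T : E →L[ℂ] E) : E →ₗ[ℂ] E) := by
        refine (injective_iff_map_eq_zero _).2 fun s hs => h μ h1 s ?_
        have : μ • s - T s = 0 := by simpa [Algebra.algebraMap_eq_smul_one] using hs
        exact (sub_eq_zero.1 this).symm
      exact ⟨hinj, LinearMap.injective_iff_surjective.1 hinj⟩
    obtain ⟨ρ, hρ1, hρ2⟩ := ENNReal.lt_iff_exists_nnreal_btwn.1 hlt
    have hρlt : (ρ : ℝ) < 1 := by exact_mod_cast hρ2
    have hρpos : (0 : ℝ) < ρ := by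
      have : (0 : ENNReal) < ρ := lt_of_le_of_lt zero_le hρ1
      exact_mod_cast this
    have hev := (spectrum.pow_nnnorm_pow_one_div_tendsto_nhds_spectralRadius T).eventually
      (gt_mem_nhds hρ1)
    obtain ⟨k₀, hk₀⟩ := Filter.eventually_atTop.1 hev
    have hbig : ∀ k ≥ k₀ + 1, ‖T ^ k‖ ≤ (ρ : ℝ) ^ k := by
      intro k hk
      have h2 := hk₀ k (by omega)
      have hk0 : (k : ℝ) ≠ 0 := by
        have : k ≠ 0 := by omega
        exact_mod_cast this
      have h3 := ENNReal.rpow_le_rpow h2.le (Nat.cast_nonneg k : (0 : ℝ) ≤ k)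
      rw [← ENNReal.rpow_mul, one_div_mul_cancel hk0, ENNReal.rpow_one, ENNReal.rpow_natCast] at h3
      exact_mod_cast h3
    refine ⟨1 + ∑ k ∈ Finset.range (k₀ + 1), ‖T ^ k‖ / (ρ : ℝ) ^ k, ρ, ?_, hρpos, hρlt,
      fun k => ?_⟩
    · have : 0 ≤ ∑ k ∈ Finset.range (k₀ + 1), ‖T ^ k‖ / (ρ : ℝ) ^ k :=
        Finset.sum_nonneg fun _ _ => by positivity
      linarith
    · have hpos : 0 ≤ ∑ k ∈ Finset.range (k₀ + 1), ‖T ^ k‖ / (ρ : ℝ) ^ k :=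
        Finset.sum_nonneg fun _ _ => by positivity
      have hpk : 0 < (ρ : ℝ) ^ k := by positivity
      by_cases hk : k₀ + 1 ≤ k
      · refine (hbig k hk).trans ?_
        nlinarith
      · have h4 : ‖T ^ k‖ / (ρ : ℝ) ^ k ≤ ∑ k ∈ Finset.range (k₀ + 1), ‖T ^ k‖ / (ρ : ℝ) ^ k :=
          Finset.single_le_sum (f := fun k => ‖T ^ k‖ / (ρ : ℝ) ^ k)
            (fun _ _ => by positivity) (Finset.mem_range.2 (by omega))
        rw [← div_le_iff₀ hpk]
        linarith

theorem NoUnstableEigenvector.of_norm_pow_lt_one {T : E →L[ℂ] E} {k : ℕ} (hk : ‖T ^ k‖ < 1) :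
    NoUnstableEigenvector T := by
  intro μ hμ s hs
  have hpow : ∀ j : ℕ, (T ^ j) s = μ ^ j • s := by
    intro j
    induction j with
    | zero => simp
    | succ j ih => rw [pow_succ', mul_apply_eq_comp, ih, map_smul, hs, smul_smul, pow_succ]
  by_contra h0
  have h1 := (T ^ k).le_opNorm s
  rw [hpow, norm_smul, norm_pow] at h1
  have h2 : 1 ≤ ‖μ‖ ^ k := one_le_pow₀ hμ
  have h3 : 0 < ‖s‖ := norm_pos_iff.2 h0
  nlinarith

/-- Stability is certified by one inequality `‖T ^ k‖ < 1`, which survives small changes of `T`.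
This is the source of robustness in the uncertainty. -/
theorem NoUnstableEigenvector.eventually [FiniteDimensional ℂ E] {T : E →L[ℂ] E}
    (h : NoUnstableEigenvector T) : ∀ᶠ T' in 𝓝 T, NoUnstableEigenvector T' := by
  obtain ⟨c, ρ, hc, hρ, hρ1, hb⟩ := h.exists_norm_pow_le
  obtain ⟨k, hk⟩ := exists_pow_lt_of_lt_one (inv_pos.2 hc) hρ1
  have hk1 : ‖T ^ k‖ < 1 := by
    refine (hb k).trans_lt ?_
    calc c * ρ ^ k < c * c⁻¹ := by gcongr
      _ = 1 := mul_inv_cancel₀ hc.ne'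
  have hcont : Continuous fun T' : E →L[ℂ] E => ‖T' ^ k‖ := by fun_prop
  filter_upwards [hcont.continuousAt.eventually (gt_mem_nhds hk1)] with T' hT'
  exact .of_norm_pow_lt_one hT'

/-- The characteristic equation of `s (t + 1) = M₀ s t + M₁ s (t - r)` has no root of modulus at
least one. -/
def DelayStable (r : ℕ) (M₀ M₁ : E →L[ℂ] E) : Prop :=
  ∀ μ : ℂ, 1 ≤ ‖μ‖ → ∀ y, μ ^ (r + 1) • y = μ ^ r • M₀ y + M₁ y → y = 0

/-- The one-step map on histories `(s t, s (t - 1), …, s (t - r))`. -/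
def historyMap (r : ℕ) (M₀ M₁ : E →L[ℂ] E) : (Fin (r + 1) → E) →L[ℂ] (Fin (r + 1) → E) :=
  ContinuousLinearMap.pi (Fin.cases
    (M₀.comp (ContinuousLinearMap.proj 0) + M₁.comp (ContinuousLinearMap.proj (Fin.last r)))
    (fun i => ContinuousLinearMap.proj i.castSucc))

theorem historyMap_zero (r : ℕ) (M₀ M₁ : E →L[ℂ] E) (s : Fin (r + 1) → E) :
    historyMap r M₀ M₁ s 0 = M₀ (s 0) + M₁ (s (Fin.last r)) := by
  simp [historyMap]

theorem historyMap_succ (r : ℕ) (M₀ M₁ : E →L[ℂ] E) (s : Fin (r + 1) → E) (i : Fin r) :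
    historyMap r M₀ M₁ s i.succ = s i.castSucc := by
  simp [historyMap]

/-- An eigenvector of the history map is a geometric history `μ ^ (r - i) • y`, with `y` its oldest
entry; the eigenvalue equation in component `0` is then the characteristic equation. -/
theorem delayStable_iff (r : ℕ) (M₀ M₁ : E →L[ℂ] E) :
    DelayStable r M₀ M₁ ↔ NoUnstableEigenvector (historyMap r M₀ M₁) := by
  constructor
  · intro h μ hμ s hs
    have hstep : ∀ i : Fin r, s i.castSucc = μ • s i.succ := fun i => by
      rw [← historyMap_succ r M₀ M₁ s i, hs]; rfl
    have hall : ∀ j : ℕ, ∀ hj : j ≤ r, s ⟨r - j, by omega⟩ = μ ^ j • s (Fin.last r) := by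
      intro j
      induction j with
      | zero => intro _; simp [Fin.last]
      | succ j ih =>
        intro hj
        have h1 := hstep ⟨r - (j + 1), by omega⟩
        have h2 : (⟨r - (j + 1), by omega⟩ : Fin r).succ = ⟨r - j, by omega⟩ := by
          ext; simp; omega
        rw [h2, ih (by omega), smul_smul, ← pow_succ'] at h1
        exact h1
    have h0 : s 0 = μ ^ r • s (Fin.last r) := by
      rw [← hall r le_rfl]; congr; simp
    have hlast : s (Fin.last r) = 0 := by
      refine h μ hμ _ ?_
      have h1 := congrFun hs 0
      rw [historyMap_zero, Pi.smul_apply, h0, map_smul, smul_smul, ← pow_succ'] at h1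
      exact h1.symm
    funext i
    have h1 := hall (r - i) (by omega)
    rw [hlast, smul_zero] at h1
    rw [Pi.zero_apply, ← h1]
    congr; ext; simp; omega
  · intro h μ hμ y hy
    have h1 := h μ hμ (fun i => μ ^ (r - i) • y) ?_
    · simpa using congrFun h1 (Fin.last r)
    · funext i
      refine Fin.cases ?_ (fun i => ?_) i
      · simp only [historyMap_zero, Pi.smul_apply, map_smul]
        simp [smul_smul, ← pow_succ', hy]
      · simp only [historyMap_succ, Pi.smul_apply, smul_smul, ← pow_succ']
        congr 2; simp; omega

theorem DelayStable.eventually [FiniteDimensional ℂ E] {X : Type*} [TopologicalSpace X] {r : ℕ}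
    {M₀ M₁ : X → E →L[ℂ] E} {x₀ : X} (h₀ : Continuous M₀) (h₁ : Continuous M₁)
    (h : DelayStable r (M₀ x₀) (M₁ x₀)) : ∀ᶠ x in 𝓝 x₀, DelayStable r (M₀ x) (M₁ x) := by
  simp only [delayStable_iff] at h ⊢
  have hc : Continuous fun x => historyMap r (M₀ x) (M₁ x) := by
    refine continuous_clm_apply.2 fun s => continuous_pi fun i => ?_
    refine Fin.cases ?_ (fun i => ?_) i
    · simp only [historyMap_zero]
      exact (h₀.clm_apply continuous_const).add (h₁.clm_apply continuous_const)
    · simp only [historyMap_succ]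
      exact continuous_const
  exact hc.continuousAt.eventually h.eventually

theorem DelayStable.exists_decay [FiniteDimensional ℂ E] {r : ℕ} {M₀ M₁ : E →L[ℂ] E}
    (h : DelayStable r M₀ M₁) :
    ∃ c ρ : ℝ, 0 < c ∧ 0 < ρ ∧ ρ < 1 ∧ ∀ s : ℤ → E,
      (∀ t : ℤ, 0 ≤ t → s (t + 1) = M₀ (s t) + M₁ (s (t - r))) →
      ∀ M : ℝ, (∀ t : ℤ, -(r : ℤ) ≤ t → t ≤ 0 → ‖s t‖ ≤ M) →
      ∀ t : ℕ, ‖s t‖ ≤ c * ρ ^ t * M := by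
  obtain ⟨c, ρ, hc, hρ, hρ1, hb⟩ := ((delayStable_iff r M₀ M₁).1 h).exists_norm_pow_le
  refine ⟨c, ρ, hc, hρ, hρ1, fun s hs M hM t => ?_⟩
  have hhist : ∀ t : ℕ, (fun i : Fin (r + 1) => s (t - (i : ℕ))) =
      (historyMap r M₀ M₁ ^ t) (fun i : Fin (r + 1) => s (-((i : ℕ) : ℤ))) := by
    intro t
    induction t with
    | zero => simp
    | succ t ih =>
      rw [pow_succ', mul_apply_eq_comp, ← ih]
      funext i
      refine Fin.cases ?_ (fun i => ?_) i
      · rw [historyMap_zero]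
        simpa using hs t (by positivity)
      · rw [historyMap_succ]
        congr 1; simp
  have hM0 : 0 ≤ M := (norm_nonneg _).trans (hM 0 (by simp) le_rfl)
  have h1 : ‖s t‖ ≤ ‖fun i : Fin (r + 1) => s (t - (i : ℕ))‖ := by
    simpa using norm_le_pi_norm (fun i : Fin (r + 1) => s (t - (i : ℕ))) 0
  rw [hhist] at h1
  refine h1.trans ((ContinuousLinearMap.le_opNorm _ _).trans ?_)
  refine mul_le_mul (hb t) ?_ (norm_nonneg _) (by positivity)
  refine (pi_norm_le_iff_of_nonneg hM0).2 fun i => hM _ ?_ ?_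
  · have := i.2; omega
  · omega

end Delay

/-! ### Complexification of real matrices and vectors -/

section Complexify

variable {ι κ l : Type*}

/-- A real matrix regarded as a complex one. -/
abbrev cx (M : Matrix ι κ ℝ) : Matrix ι κ ℂ := M.map (algebraMap ℝ ℂ)

theorem cx_mul [Fintype κ] (M : Matrix ι κ ℝ) (M' : Matrix κ l ℝ) : cx (M * M') = cx M * cx M' :=
  Matrix.map_mul

theorem cx_add (M M' : Matrix ι κ ℝ) : cx (M + M') = cx M + cx M' :=
  Matrix.map_add _ (map_add _) _ _

theorem cx_sub (M M' : Matrix ι κ ℝ) : cx (M - M') = cx M - cx M' :=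
  Matrix.map_sub _ (map_sub _) _ _

theorem cx_neg (M : Matrix ι κ ℝ) : cx (-M) = -cx M := by
  ext; simp

theorem cx_smul (c : ℝ) (M : Matrix ι κ ℝ) : cx (c • M) = (c : ℂ) • cx M := by
  ext; simp

theorem cx_one [DecidableEq ι] : cx (1 : Matrix ι ι ℝ) = 1 :=
  Matrix.map_one _ (map_zero _) (map_one _)

theorem cx_zero : cx (0 : Matrix ι κ ℝ) = 0 :=
  Matrix.map_zero _ (map_zero _)

theorem cx_pow [Fintype ι] [DecidableEq ι] (M : Matrix ι ι ℝ) (k : ℕ) : cx (M ^ k) = cx M ^ k :=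
  Matrix.map_pow _ _ _

theorem cx_transpose (M : Matrix ι κ ℝ) : cx Mᵀ = (cx M)ᵀ := rfl

theorem cx_conjTranspose (M : Matrix ι κ ℝ) : (cx M)ᴴ = cx Mᵀ := by
  ext; simp [cx]

theorem cx_injective : Function.Injective (cx : Matrix ι κ ℝ → Matrix ι κ ℂ) :=
  Matrix.map_injective (algebraMap ℝ ℂ).injective

/-- A real vector regarded as a complex one. -/
abbrev cvec (x : ι → ℝ) : ι → ℂ := fun i => (x i : ℂ)

theorem cx_mulVec_cvec [Fintype κ] (M : Matrix ι κ ℝ) (x : κ → ℝ) :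
    cx M *ᵥ cvec x = cvec (M *ᵥ x) := by
  ext; simp [Matrix.mulVec, dotProduct, cvec]

theorem norm_cvec [Fintype ι] (x : ι → ℝ) : ‖cvec x‖ = ‖x‖ := by
  simp only [Pi.norm_def, cvec]
  congr 2; funext i; ext; simp

/-- The real and imaginary parts of a complex quadratic form with real symmetric matrix. -/
theorem star_dotProduct_cx_mulVec [Fintype ι] {M : Matrix ι ι ℝ} (hM : Mᵀ = M) (x : ι → ℂ) :
    star x ⬝ᵥ (cx M *ᵥ x) =
      (((fun i => (x i).re) ⬝ᵥ (M *ᵥ fun i => (x i).re) +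
        (fun i => (x i).im) ⬝ᵥ (M *ᵥ fun i => (x i).im) : ℝ) : ℂ) := by
  have hx : x = cvec (fun i => (x i).re) + Complex.I • cvec (fun i => (x i).im) := by
    funext i
    simp [mul_comm Complex.I]
  set a : ι → ℝ := fun i => (x i).re
  set b : ι → ℝ := fun i => (x i).im
  have hs : star x = cvec a - Complex.I • cvec b := by
    funext i
    apply Complex.ext <;> simp [a, b]
  have hc : ∀ a b : ι → ℝ, cvec a ⬝ᵥ cvec b = ((a ⬝ᵥ b : ℝ) : ℂ) := fun a b => by
    simp [dotProduct]
  have hsymm : a ⬝ᵥ (M *ᵥ b) = b ⬝ᵥ (M *ᵥ a) := by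
    rw [Matrix.dotProduct_mulVec, ← Matrix.mulVec_transpose, hM, dotProduct_comm]
  rw [hs, hx, Matrix.mulVec_add, Matrix.mulVec_smul, cx_mulVec_cvec, cx_mulVec_cvec]
  simp only [sub_dotProduct, dotProduct_add, smul_dotProduct, dotProduct_smul, hc, hsymm,
    smul_eq_mul]
  push_cast
  linear_combination (-(b ⬝ᵥ (M *ᵥ b) : ℝ) : ℂ) * Complex.I_mul_I

theorem isSymm_of_isHermitian {M : Matrix ι ι ℝ} (hM : M.IsHermitian) : Mᵀ = M := by
  have h : M.IsSymm := by simpa using hM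
  exact h

open scoped ComplexOrder

theorem posDef_cx [Fintype ι] {M : Matrix ι ι ℝ} (hM : M.PosDef) : (cx M).PosDef := by
  have ht : Mᵀ = M := isSymm_of_isHermitian hM.1
  refine .of_dotProduct_mulVec_pos ?_ fun x hx => ?_
  · rw [Matrix.IsHermitian, cx_conjTranspose, ht]
  · rw [star_dotProduct_cx_mulVec ht]
    have h := hM.posSemidef.dotProduct_mulVec_nonneg
    have h' := fun x hx => hM.dotProduct_mulVec_pos (x := x) hx
    simp only [star_trivial] at h h'
    by_cases hre : (fun i => (x i).re) = 0
    · have him : (fun i => (x i).im) ≠ 0 := fun him => hx (funext fun i =>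
        Complex.ext (congrFun hre i) (congrFun him i))
      exact_mod_cast add_pos_of_nonneg_of_pos (h _) (h' _ him)
    · exact_mod_cast add_pos_of_pos_of_nonneg (h' _ hre) (h _)

end Complexify

/-! ### Eigenvalues and eigenvectors -/

section Eigen

variable {ι : Type*} [Fintype ι] [DecidableEq ι]

theorem mem_spectrum_iff_exists_mulVec {M : Matrix ι ι ℂ} {μ : ℂ} :
    μ ∈ spectrum ℂ M ↔ ∃ v ≠ 0, M *ᵥ v = μ • v := by
  rw [spectrum.mem_iff, Matrix.isUnit_iff_isUnit_det, isUnit_iff_ne_zero, not_not,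
    ← Matrix.exists_mulVec_eq_zero_iff]
  refine exists_congr fun v => and_congr_right fun _ => ?_
  rw [Matrix.sub_mulVec, sub_eq_zero, Algebra.algebraMap_eq_smul_one, Matrix.smul_mulVec,
    Matrix.one_mulVec, eq_comm]

theorem mem_spectrum_transpose {M : Matrix ι ι ℂ} {μ : ℂ} :
    μ ∈ spectrum ℂ Mᵀ ↔ μ ∈ spectrum ℂ M := by
  have : algebraMap ℂ (Matrix ι ι ℂ) μ - Mᵀ = (algebraMap ℂ (Matrix ι ι ℂ) μ - M)ᵀ := by
    simp [Algebra.algebraMap_eq_smul_one]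
  rw [spectrum.mem_iff, spectrum.mem_iff, this, Matrix.isUnit_iff_isUnit_det, Matrix.det_transpose,
    ← Matrix.isUnit_iff_isUnit_det]

theorem mem_spectrum_iff_exists_transpose_mulVec {M : Matrix ι ι ℂ} {μ : ℂ} :
    μ ∈ spectrum ℂ M ↔ ∃ v ≠ 0, Mᵀ *ᵥ v = μ • v := by
  rw [← mem_spectrum_transpose, mem_spectrum_iff_exists_mulVec]

theorem mem_spectrum_iff_isRoot_charpoly {M : Matrix ι ι ℂ} {μ : ℂ} :
    μ ∈ spectrum ℂ M ↔ M.charpoly.IsRoot μ :=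
  Matrix.mem_spectrum_iff_isRoot_charpoly

/-- A nonzero subspace stable under a complex matrix contains an eigenvector. -/
theorem exists_eigenvector_mem {V : Type*} [AddCommGroup V] [Module ℂ V] [FiniteDimensional ℂ V]
    (T : V →ₗ[ℂ] V) (p : Submodule ℂ V) (hp : p ≠ ⊥) (hT : ∀ v ∈ p, T v ∈ p) :
    ∃ v ∈ p, v ≠ 0 ∧ ∃ μ : ℂ, T v = μ • v := by
  have : Nontrivial p := Submodule.nontrivial_iff_ne_bot.2 hp
  obtain ⟨μ, hμ⟩ := Module.End.exists_eigenvalue (T.restrict hT)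
  obtain ⟨v, hv⟩ := hμ.exists_hasEigenvector
  refine ⟨v, v.2, fun h => hv.2 (Subtype.ext h), μ, ?_⟩
  exact congrArg Subtype.val hv.apply_eq_smul

end Eigen

/-! ### Positive semidefinite matrices expanded by a matrix of spectral radius at most one -/

section Expansion

variable {ι κ : Type*} [Fintype ι] [DecidableEq ι] [Fintype κ]

/-- A positive semidefinite matrix has a symmetric square root, with a pseudo-inverse of the latter
and the orthogonal projection onto the kernel. -/
theorem exists_sqrt_pinv {X : Matrix ι ι ℝ} (hX : X.PosSemidef) :
    ∃ Z Y Q : Matrix ι ι ℝ, Zᵀ = Z ∧ Yᵀ = Y ∧ Qᵀ = Q ∧ X = Z * Z ∧ Z * Y = 1 - Q ∧ Y * Z = 1 - Q ∧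
      Z * Q = 0 ∧ Q * Z = 0 ∧ Y * Q = 0 ∧ Q * Y = 0 ∧ Q * Q = Q := by
  set U : Matrix ι ι ℝ := (hX.1.eigenvectorUnitary : Matrix ι ι ℝ)
  have hU : Uᵀ * U = 1 := by
    have := Unitary.coe_star_mul_self hX.1.eigenvectorUnitary
    rwa [Matrix.star_eq_conjTranspose, Matrix.conjTranspose_eq_transpose_of_trivial] at this
  have hU' : U * Uᵀ = 1 := mul_eq_one_comm.1 hU
  set φ : (ι → ℝ) → Matrix ι ι ℝ := fun f => U * Matrix.diagonal f * Uᵀ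
  have hmul : ∀ f g, φ f * φ g = φ (f * g) := by
    intro f g
    calc φ f * φ g = U * Matrix.diagonal f * (Uᵀ * U) * Matrix.diagonal g * Uᵀ := by
          simp only [φ, Matrix.mul_assoc]
      _ = φ (f * g) := by
          rw [hU, Matrix.mul_one, Matrix.mul_assoc U, Matrix.diagonal_mul_diagonal]
          rfl
  have htr : ∀ f, (φ f)ᵀ = φ f := by
    intro f
    simp [φ, Matrix.transpose_mul, Matrix.mul_assoc]
  have hone : φ 1 = 1 := by
    have : Matrix.diagonal (1 : ι → ℝ) = 1 := Matrix.diagonal_one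
    simp only [φ, this, Matrix.mul_one, hU']
  have hzero : φ 0 = 0 := by
    have : Matrix.diagonal (0 : ι → ℝ) = 0 := Matrix.diagonal_zero
    simp only [φ, this, Matrix.mul_zero, Matrix.zero_mul]
  have hsub : ∀ f g, φ f - φ g = φ (f - g) := by
    intro f g
    have : Matrix.diagonal (f - g) = Matrix.diagonal f - Matrix.diagonal g :=
      (Matrix.diagonal_sub f g).symm
    simp only [φ, this, Matrix.mul_sub, Matrix.sub_mul]
  set d : ι → ℝ := hX.1.eigenvalues
  have hd : ∀ i, 0 ≤ d i := hX.eigenvalues_nonneg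
  have hXφ : X = φ d := by
    have h := hX.1.spectral_theorem
    rw [Unitary.conjStarAlgAut_apply] at h
    exact h
  -- The convention `0⁻¹ = 0` makes the second matrix the pseudo-inverse: it vanishes on the kernel.
  refine ⟨φ fun i => √(d i), φ fun i => (√(d i))⁻¹, φ fun i => if d i = 0 then 1 else 0,
    htr _, htr _, htr _, ?_, ?_, ?_, ?_, ?_, ?_, ?_, ?_⟩ <;>
  simp only [hmul] <;> first | rw [← hone, hsub] | rw [← hzero] | skip
  · rw [hXφ]; congr 1; funext i; simp [Real.mul_self_sqrt (hd i)]
  all_goals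
    congr 1; funext i
    by_cases h : d i = 0
    · simp [h]
    · have : √(d i) ≠ 0 := by rwa [Ne, Real.sqrt_eq_zero (hd i)]
      simp [h, this]

theorem norm_det_le_one {R : Matrix ι ι ℂ} (h : ∀ μ ∈ spectrum ℂ R, ‖μ‖ ≤ 1) : ‖R.det‖ ≤ 1 := by
  rw [Matrix.det_eq_prod_roots_charpoly]
  have hroots : ∀ μ ∈ R.charpoly.roots, ‖μ‖ ≤ 1 := fun μ hμ =>
    h μ (mem_spectrum_iff_isRoot_charpoly.2 (Polynomial.isRoot_of_mem_roots hμ))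
  generalize R.charpoly.roots = s at hroots
  induction s using Multiset.induction_on with
  | empty => simp
  | cons a s ih =>
    rw [Multiset.prod_cons, norm_mul]
    exact mul_le_one₀ (hroots a (Multiset.mem_cons_self a s)) (norm_nonneg _)
      (ih fun μ hμ => hroots μ (Multiset.mem_cons_of_mem hμ))

/-- The determinant is the product of the factors 1 + λ over the eigenvalues λ ≥ 0 of `D`, obtained
by evaluating the characteristic polynomial at -1. A product at most one leaves no room for a
positive λ. -/
theorem eq_zero_of_det_one_add_le_one {D : Matrix ι ι ℝ} (hD : D.PosSemidef)
    (hdet : (1 + D).det ≤ 1) : D = 0 := by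
  have hd : ∀ i, 0 ≤ hD.1.eigenvalues i := hD.eigenvalues_nonneg
  have hprod : (1 + D).det = ∏ i, (1 + hD.1.eigenvalues i) := by
    have h := hD.1.charpoly_eq
    have h2 := Matrix.eval_charpoly D (-1)
    rw [h, Polynomial.eval_prod] at h2
    have h3 : Matrix.scalar ι (-1 : ℝ) - D = -(1 + D) := by
      ext i j
      simp [Matrix.one_apply, Matrix.diagonal_apply]
      split_ifs <;> ring
    rw [h3, Matrix.det_neg] at h2
    have h4 : ∏ i, Polynomial.eval (-1) (Polynomial.X - Polynomial.C (hD.1.eigenvalues i : ℝ)) =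
        (-1) ^ Fintype.card ι * ∏ i, (1 + hD.1.eigenvalues i) := by
      rw [← Finset.card_univ, ← Finset.prod_const, ← Finset.prod_mul_distrib]
      refine Finset.prod_congr rfl fun i _ => ?_
      simp; ring
    have h5 : ((-1 : ℝ) ^ Fintype.card ι) ≠ 0 := by positivity
    simp only [RCLike.ofReal_real_eq_id, id] at h2
    rw [h4] at h2
    exact (mul_left_cancel₀ h5 h2).symm
  have hz : ∀ i, hD.1.eigenvalues i = 0 := by
    intro i
    rw [hprod, ← Finset.mul_prod_erase _ _ (Finset.mem_univ i)] at hdet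
    have h1 : 1 ≤ ∏ j ∈ Finset.univ.erase i, (1 + hD.1.eigenvalues j) :=
      Finset.prod_induction _ (fun x => 1 ≤ x) (fun a b ha hb => one_le_mul_of_one_le_of_one_le ha hb)
        le_rfl fun j _ => by linarith [hd j]
    nlinarith [hd i]
  rw [← hD.trace_eq_zero_iff, hD.1.trace_eq_sum_eigenvalues]
  simp [hz]

/-- The Hautus test for stabilizability in discrete time. -/
def Hautus (A : Matrix ι ι ℝ) (B : Matrix ι κ ℝ) : Prop :=
  ∀ (μ : ℂ) (ξ : ι → ℂ), 1 ≤ ‖μ‖ → (cx A)ᵀ *ᵥ ξ = μ • ξ → (cx B)ᵀ *ᵥ ξ = 0 → ξ = 0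

-- The form `X` does not decrease under `A`, while the eigenvalues of `A` forbid volume growth; so
-- `A` preserves `X` and `Y = 0`. The trace bound then gives BᵀXB = 0, and a nonzero `X` would
-- provide an eigenvector of Aᵀ of modulus one annihilated by Bᵀ.
open scoped ComplexOrder in
theorem eq_zero_of_expansion {A X Y : Matrix ι ι ℝ} {B : Matrix ι κ ℝ} (hX : X.PosSemidef)
    (hY : Y.PosSemidef) (hXY : Aᵀ * X * A = X + Y) (hspec : ∀ μ ∈ spectrum ℂ (cx A), ‖μ‖ ≤ 1)
    (hB : Hautus A B) {t : ℝ} (htr : (Bᵀ * X * B).trace ≤ t * Y.trace) : X = 0 := by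
  obtain ⟨Z, Zi, Q, hZt, hZit, hQt, hXZ, hZZi, hZiZ, hZQ, hQZ, hZiQ, hQZi, hQQ⟩ :=
    exists_sqrt_pinv hX
  have hXQ : X * Q = 0 := by rw [hXZ, Matrix.mul_assoc, hZQ, Matrix.mul_zero]
  -- the kernel of `X` is stable under `A`
  have hker : ∀ x, (X * A) *ᵥ x = 0 → X *ᵥ x = 0 := by
    intro x hx
    have h1 : x ⬝ᵥ ((X + Y) *ᵥ x) = 0 := by
      rw [← hXY, Matrix.mul_assoc, ← Matrix.mulVec_mulVec, hx, Matrix.mulVec_zero,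
        dotProduct_zero]
    rw [Matrix.add_mulVec, dotProduct_add] at h1
    have h2 := hX.dotProduct_mulVec_nonneg x
    have h3 := hY.dotProduct_mulVec_nonneg x
    have h4 := hX.dotProduct_mulVec_zero_iff x
    simp only [star_trivial] at h2 h3 h4
    exact h4.1 (by linarith)
  -- The inclusion just proved is opposite to invariance of the kernel; the rank bound on `X * A`
  -- upgrades it to an equality.
  have hkereq : LinearMap.ker (X * A).mulVecLin = LinearMap.ker X.mulVecLin := by
    refine Submodule.eq_of_le_of_finrank_le (fun x hx => ?_) ?_
    · rw [LinearMap.mem_ker, Matrix.mulVecLin_apply] at hx ⊢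
      exact hker x hx
    · have h1 := LinearMap.finrank_range_add_finrank_ker (X * A).mulVecLin
      have h2 := LinearMap.finrank_range_add_finrank_ker X.mulVecLin
      have h3 : (X * A).rank ≤ X.rank := Matrix.rank_mul_le_left X A
      simp only [Matrix.rank] at h3
      omega
  have hXAQ : X * A * Q = 0 := by
    refine Matrix.ext_of_mulVec_single fun i => ?_
    rw [← Matrix.mulVec_mulVec, Matrix.zero_mulVec]
    have : Q *ᵥ Pi.single i 1 ∈ LinearMap.ker X.mulVecLin := by
      rw [LinearMap.mem_ker, Matrix.mulVecLin_apply, Matrix.mulVec_mulVec, hXQ, Matrix.zero_mulVec]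
    rw [← hkereq] at this
    exact this
  have hZAQ : Z * A * Q = 0 := by
    have h1 : Zi * (Z * (Z * A * Q)) = 0 := by
      have : Z * (Z * A * Q) = X * A * Q := by rw [hXZ]; simp only [Matrix.mul_assoc]
      rw [this, hXAQ, Matrix.mul_zero]
    rw [← Matrix.mul_assoc, hZiZ, Matrix.sub_mul, Matrix.one_mul, Matrix.mul_assoc Z,
      ← Matrix.mul_assoc Q, hQZ, Matrix.zero_mul, sub_zero, ← Matrix.mul_assoc] at h1
    exact h1
  have hQAZ : Q * Aᵀ * Z = 0 := by
    have := congrArg Matrix.transpose hZAQ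
    simpa [Matrix.transpose_mul, hQt, hZt, Matrix.mul_assoc] using this
  have hYQ : Y * Q = 0 := by
    have : Y = Aᵀ * X * A - X := by rw [hXY]; abel
    rw [this, Matrix.sub_mul, hXQ, Matrix.mul_assoc, Matrix.mul_assoc, ← Matrix.mul_assoc X, hXAQ,
      Matrix.mul_zero, sub_zero]
  have hYt : Yᵀ = Y := isSymm_of_isHermitian hY.1
  have hQY : Q * Y = 0 := by
    have := congrArg Matrix.transpose hYQ
    simpa [Matrix.transpose_mul, hQt, hYt] using this
  -- `A` acts on the range of `X` as the expansive matrix `R`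
  set R : Matrix ι ι ℝ := Z * A * Zi + Q with hR
  have hRt : Rᵀ = Zi * Aᵀ * Z + Q := by
    simp [hR, Matrix.transpose_mul, hQt, hZt, hZit, Matrix.mul_assoc]
  have hRQ : Rᵀ * Q = Q := by
    rw [hRt, Matrix.add_mul, Matrix.mul_assoc _ Z, hZQ, Matrix.mul_zero, zero_add, hQQ]
  have hQR : Q * Rᵀ = Q := by
    rw [hRt, Matrix.mul_add, Matrix.mul_assoc Zi, ← Matrix.mul_assoc, hQZi, Matrix.zero_mul,
      zero_add, hQQ]
  have hZR : Z * Rᵀ = Aᵀ * Z := by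
    rw [hRt, Matrix.mul_add, hZQ, add_zero, Matrix.mul_assoc Zi, ← Matrix.mul_assoc, hZZi,
      Matrix.sub_mul, Matrix.one_mul, ← Matrix.mul_assoc, hQAZ, sub_zero]
  have hRR : Rᵀ * R = 1 + Zi * Y * Zi := by
    have e1 : Zi * Aᵀ * Z * (Z * A * Zi) = Zi * (Aᵀ * X * A) * Zi := by
      rw [hXZ]; simp only [Matrix.mul_assoc]
    have e2 : Zi * Aᵀ * Z * Q = 0 := by rw [Matrix.mul_assoc, hZQ, Matrix.mul_zero]
    have e3 : Q * (Z * A * Zi) = 0 := by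
      rw [Matrix.mul_assoc, ← Matrix.mul_assoc, hQZ, Matrix.zero_mul]
    have e4 : Zi * X * Zi = 1 - Q := by
      calc Zi * X * Zi = (Zi * Z) * (Z * Zi) := by rw [hXZ]; simp only [Matrix.mul_assoc]
        _ = 1 - Q := by
          rw [hZiZ, hZZi, Matrix.sub_mul, Matrix.one_mul, Matrix.mul_sub, hQQ, Matrix.mul_one,
            sub_self, sub_zero]
    rw [hRt, hR, Matrix.add_mul, Matrix.mul_add, Matrix.mul_add, e1, e2, e3, hQQ, hXY,
      Matrix.mul_add, Matrix.add_mul, e4]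
    abel
  have hDpos : (Zi * Y * Zi).PosSemidef := by
    have := hY.conjTranspose_mul_mul_same Zi
    rwa [Matrix.conjTranspose_eq_transpose_of_trivial, hZit] at this
  -- An eigenvector η of Rᵀ either satisfies Zη = 0, and then Rᵀη = Qη = η, or is carried by Z to an
  -- eigenvector of Aᵀ with the same eigenvalue.
  have hdetR : |R.det| ≤ 1 := by
    have h1 : ‖(cx Rᵀ).det‖ ≤ 1 := by
      refine norm_det_le_one fun μ hμ => ?_
      obtain ⟨η, hη0, hη⟩ := mem_spectrum_iff_exists_mulVec.1 hμ
      by_cases hZη : cx Z *ᵥ η = 0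
      · have h2 : cx Rᵀ *ᵥ η = cx Q *ᵥ η := by
          rw [hRt, cx_add, cx_mul, Matrix.add_mulVec, ← Matrix.mulVec_mulVec, hZη,
            Matrix.mulVec_zero, zero_add]
        have h3 : cx Q *ᵥ η = η := by
          have : cx (Zi * Z) *ᵥ η = 0 := by
            rw [cx_mul, ← Matrix.mulVec_mulVec, hZη, Matrix.mulVec_zero]
          rw [hZiZ, cx_sub, cx_one, Matrix.sub_mulVec, Matrix.one_mulVec, sub_eq_zero] at this
          exact this.symm
        rw [h2, h3] at hη
        have h4 : (μ - 1) • η = 0 := by rw [sub_smul, one_smul, ← hη, sub_self]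
        rcases smul_eq_zero.1 h4 with h5 | h5
        · rw [sub_eq_zero.1 h5, norm_one]
        · exact absurd h5 hη0
      · refine hspec μ (mem_spectrum_iff_exists_transpose_mulVec.2 ⟨_, hZη, ?_⟩)
        rw [← cx_transpose, Matrix.mulVec_mulVec, ← cx_mul, ← hZR, cx_mul, ← Matrix.mulVec_mulVec, hη,
          Matrix.mulVec_smul]
    have h2 : (cx Rᵀ).det = ((Rᵀ.det : ℝ) : ℂ) := (RingHom.map_det (algebraMap ℝ ℂ) Rᵀ).symm
    rw [h2, Complex.norm_real, Matrix.det_transpose] at h1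
    exact h1
  -- The determinant of RᵀR is at most one, although RᵀR is the identity plus a positive
  -- semidefinite matrix.
  have hD : Zi * Y * Zi = 0 := by
    refine eq_zero_of_det_one_add_le_one hDpos ?_
    rw [← hRR, Matrix.det_mul, Matrix.det_transpose, ← sq, ← sq_abs]
    exact pow_le_one₀ (abs_nonneg _) hdetR
  have hY0 : Y = 0 := by
    have h1 : Z * (Zi * Y * Zi) * Z = Y := by
      calc Z * (Zi * Y * Zi) * Z = (Z * Zi) * Y * (Zi * Z) := by simp only [Matrix.mul_assoc]
        _ = Y := by
          rw [hZZi, hZiZ, Matrix.sub_mul, Matrix.one_mul, hQY, sub_zero, Matrix.mul_sub, hYQ,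
            Matrix.mul_one, sub_zero]
    rw [← h1, hD, Matrix.mul_zero, Matrix.zero_mul]
  have hRR1 : R * Rᵀ = 1 := by
    rw [hD, add_zero] at hRR
    exact mul_eq_one_comm.1 hRR
  -- With `Y = 0` the trace hypothesis bounds the trace of the Gram matrix of `Z * B` by zero.
  have hZB : Z * B = 0 := by
    rw [← Matrix.trace_conjTranspose_mul_self_eq_zero_iff,
      Matrix.conjTranspose_eq_transpose_of_trivial]
    have h1 : (Z * B)ᵀ * (Z * B) = Bᵀ * X * B := by
      rw [hXZ, Matrix.transpose_mul, hZt]; simp only [Matrix.mul_assoc]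
    have h2 := (Matrix.posSemidef_conjTranspose_mul_self (Z * B)).trace_nonneg
    rw [Matrix.conjTranspose_eq_transpose_of_trivial, h1] at h2
    rw [hY0, Matrix.trace_zero, mul_zero] at htr
    rw [h1]
    exact le_antisymm htr h2
  by_contra hX0
  have hrange : LinearMap.range (cx Z).mulVecLin ≠ ⊥ := by
    intro hbot
    refine hX0 ?_
    have : cx Z = 0 := by
      refine Matrix.ext_of_mulVec_single fun i => ?_
      have h1 : (cx Z).mulVecLin (Pi.single i 1) ∈ LinearMap.range (cx Z).mulVecLin :=
        LinearMap.mem_range_self _ _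
      rw [hbot, Submodule.mem_bot] at h1
      rw [Matrix.zero_mulVec]
      exact h1
    have hZ0 : Z = 0 := cx_injective (this.trans cx_zero.symm)
    rw [hXZ, hZ0, Matrix.zero_mul]
  obtain ⟨ξ, ⟨η, rfl⟩, hξ0, μ, hμ⟩ := exists_eigenvector_mem (cx Aᵀ).mulVecLin _ hrange (by
    rintro _ ⟨η, rfl⟩
    refine ⟨cx Rᵀ *ᵥ η, ?_⟩
    simp only [Matrix.mulVecLin_apply, Matrix.mulVec_mulVec, ← cx_mul, hZR])
  simp only [Matrix.mulVecLin_apply] at hξ0 hμ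
  -- Removing the kernel component of `η` leaves `Z η` unchanged and yields a genuine eigenvector of
  -- the orthogonal matrix Rᵀ, so that `μ` has modulus one.
  set η' : ι → ℂ := cx (1 - Q) *ᵥ η with hη'
  have hη'0 : η' ≠ 0 := by
    intro h0
    refine hξ0 ?_
    have h1 : cx Z *ᵥ η' = cx Z *ᵥ η := by
      rw [hη', Matrix.mulVec_mulVec, ← cx_mul, Matrix.mul_sub, hZQ, Matrix.mul_one, sub_zero]
    rw [← h1, h0, Matrix.mulVec_zero]
  have hRη : cx Rᵀ *ᵥ η' = μ • η' := by
    have h1 : cx Zi *ᵥ (cx Aᵀ *ᵥ (cx Z *ᵥ η)) = μ • (cx Zi *ᵥ (cx Z *ᵥ η)) := by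
      rw [hμ, Matrix.mulVec_smul]
    simp only [Matrix.mulVec_mulVec, ← cx_mul, ← hZR, hZiZ] at h1
    rw [← Matrix.mul_assoc, hZiZ] at h1
    rw [hη', Matrix.mulVec_mulVec, ← cx_mul, Matrix.mul_sub, Matrix.mul_one, hRQ, ← h1,
      Matrix.sub_mul, Matrix.one_mul, hQR]
  have hμ1 : 1 ≤ ‖μ‖ := by
    have h1 : star (cx Rᵀ *ᵥ η') ⬝ᵥ (cx Rᵀ *ᵥ η') = star η' ⬝ᵥ η' := by
      rw [Matrix.star_mulVec, ← Matrix.dotProduct_mulVec, Matrix.mulVec_mulVec, cx_conjTranspose,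
        Matrix.transpose_transpose, ← cx_mul, hRR1, cx_one, Matrix.one_mulVec]
    rw [hRη, star_smul, smul_dotProduct, dotProduct_smul, smul_smul, smul_eq_mul] at h1
    have h2 : star η' ⬝ᵥ η' ≠ 0 := by rwa [Ne, dotProduct_star_self_eq_zero]
    have h3 : star μ * μ = 1 := mul_right_cancel₀ h2 (h1.trans (one_mul _).symm)
    have h4 := congrArg norm h3
    rw [norm_mul, norm_star, norm_one] at h4
    nlinarith [norm_nonneg μ]
  refine hξ0 (hB μ _ hμ1 hμ ?_)
  rw [← cx_transpose, Matrix.mulVec_mulVec, ← cx_mul]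
  have : Bᵀ * Z = 0 := by
    have := congrArg Matrix.transpose hZB
    simpa [Matrix.transpose_mul, hZt] using this
  rw [this, cx_zero, Matrix.zero_mulVec]

end Expansion

/-! ### A Lyapunov-type matrix inequality with large solutions -/

section Inequality

variable {ι κ : Type*} [Fintype ι] [Fintype κ]

theorem dotProduct_mulVec_comm {R : Type*} [CommSemiring R] (M : Matrix ι κ R) (x : ι → R)
    (y : κ → R) : x ⬝ᵥ (M *ᵥ y) = (Mᵀ *ᵥ x) ⬝ᵥ y := by
  rw [Matrix.dotProduct_mulVec, Matrix.mulVec_transpose]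

/-- The real matrices, not necessarily symmetric, whose quadratic form is positive. -/
def quadPos (ι : Type*) [Fintype ι] : Set (Matrix ι ι ℝ) :=
  {M | ∀ x : ι → ℝ, x ≠ 0 → 0 < x ⬝ᵥ (M *ᵥ x)}

/-- Positivity need only be tested on the compact unit sphere. Dropping symmetry makes the cone open
in the space of all matrices, as the separation theorem requires. -/
theorem isOpen_quadPos : IsOpen (quadPos ι) := by
  refine isOpen_iff_mem_nhds.2 fun M hM => ?_
  have hK : IsCompact (Metric.sphere (0 : ι → ℝ) 1) := isCompact_sphere _ _
  have hc : Continuous fun z : Matrix ι ι ℝ × (ι → ℝ) => z.2 ⬝ᵥ (z.1 *ᵥ z.2) := by fun_prop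
  have hev : ∀ᶠ M' in 𝓝 M, ∀ x ∈ Metric.sphere (0 : ι → ℝ) 1, 0 < x ⬝ᵥ (M' *ᵥ x) := by
    refine hK.eventually_forall_of_forall_eventually fun x hx => ?_
    refine hc.continuousAt.eventually (lt_mem_nhds ?_)
    refine hM x fun h => ?_
    simp [h] at hx
  filter_upwards [hev] with M' hM' x hx
  have hn : 0 < ‖x‖ := norm_pos_iff.2 hx
  have h1 := hM' (‖x‖⁻¹ • x) (by simp [norm_smul, hn.ne'])
  rw [Matrix.mulVec_smul, smul_dotProduct, dotProduct_smul, smul_smul, smul_eq_mul] at h1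
  exact pos_of_mul_pos_right h1 (by positivity)

theorem add_mem_quadPos {M M' : Matrix ι ι ℝ} (h : ∀ x, 0 ≤ x ⬝ᵥ (M *ᵥ x)) (h' : M' ∈ quadPos ι) :
    M + M' ∈ quadPos ι := by
  intro x hx
  rw [Matrix.add_mulVec, dotProduct_add]
  exact add_pos_of_nonneg_of_pos (h x) (h' x hx)

theorem smul_mem_quadPos {M : Matrix ι ι ℝ} (h : M ∈ quadPos ι) {c : ℝ} (hc : 0 < c) :
    c • M ∈ quadPos ι := by
  intro x hx
  rw [Matrix.smul_mulVec, dotProduct_smul]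
  exact mul_pos hc (h x hx)

theorem nonneg_of_mem_quadPos {M : Matrix ι ι ℝ} (h : M ∈ quadPos ι) (x : ι → ℝ) :
    0 ≤ x ⬝ᵥ (M *ᵥ x) := by
  by_cases hx : x = 0
  · simp [hx]
  · exact (h x hx).le

theorem convex_quadPos : Convex ℝ (quadPos ι) := by
  intro M hM M' hM' s t hs ht hst
  rcases hs.eq_or_lt with rfl | hs
  · rw [zero_add] at hst
    simpa [hst] using hM'
  · rcases ht.eq_or_lt with rfl | ht
    · rw [add_zero] at hst
      simpa [hst] using hM
    · exact add_mem_quadPos (nonneg_of_mem_quadPos (smul_mem_quadPos hM hs)) (smul_mem_quadPos hM' ht)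

theorem posDef_of_mem_quadPos {M : Matrix ι ι ℝ} (h : M ∈ quadPos ι) :
    ((1 / 2 : ℝ) • (M + Mᵀ)).PosDef := by
  refine .of_dotProduct_mulVec_pos ?_ fun x hx => ?_
  · rw [Matrix.IsHermitian, Matrix.conjTranspose_eq_transpose_of_trivial]
    simp [add_comm]
  · have h1 : x ⬝ᵥ (Mᵀ *ᵥ x) = x ⬝ᵥ (M *ᵥ x) := by
      rw [dotProduct_mulVec_comm, Matrix.transpose_transpose, dotProduct_comm]
    rw [star_trivial, Matrix.smul_mulVec, dotProduct_smul, Matrix.add_mulVec, dotProduct_add, h1]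
    have := h x hx
    simp only [smul_eq_mul]
    linarith

variable [DecidableEq ι]

theorem one_mem_quadPos : (1 : Matrix ι ι ℝ) ∈ quadPos ι := by
  intro x hx
  rw [Matrix.one_mulVec]
  have := (Matrix.PosDef.one (n := ι) (R := ℝ)).dotProduct_mulVec_pos hx
  simpa using this

/-- A linear functional on matrices is given, on symmetric matrices, by the trace pairing with a
symmetric matrix. -/
theorem exists_symm_trace_repr (g : Matrix ι ι ℝ →ₗ[ℝ] ℝ) :
    ∃ X : Matrix ι ι ℝ, Xᵀ = X ∧ ∀ M, Mᵀ = M → g M = (X * M).trace := by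
  refine ⟨Matrix.of fun i j => (g (Matrix.single i j 1) + g (Matrix.single j i 1)) / 2, ?_, ?_⟩
  · ext i j; simp [add_comm]
  · intro M hM
    have hsymm : ∀ i j, M j i = M i j := fun i j => congrFun (congrFun hM i) j
    have h1 : g M = ∑ i, ∑ j, M i j * g (Matrix.single i j 1) := by
      conv_lhs => rw [Matrix.matrix_eq_sum_single M]
      simp only [map_sum]
      refine Finset.sum_congr rfl fun i _ => Finset.sum_congr rfl fun j _ => ?_
      have : Matrix.single i j (M i j) = M i j • Matrix.single i j (1 : ℝ) := by simp
      rw [this, map_smul, smul_eq_mul]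
    have h2 : g M = ∑ i, ∑ j, M i j * g (Matrix.single j i 1) := by
      rw [h1, Finset.sum_comm]
      simp only [hsymm]
    have h3 : ((Matrix.of fun i j => (g (Matrix.single i j 1) + g (Matrix.single j i 1)) / 2) *
        M).trace = (∑ i, ∑ j, M i j * g (Matrix.single i j 1) +
          ∑ i, ∑ j, M i j * g (Matrix.single j i 1)) / 2 := by
      simp only [Matrix.trace, Matrix.diag, Matrix.mul_apply, Matrix.of_apply, hsymm,
        ← Finset.sum_add_distrib, Finset.sum_div]
      exact Finset.sum_congr rfl fun i _ => Finset.sum_congr rfl fun j _ => by ring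
    rw [h3, ← h1, ← h2]; ring

/-- Passes a sign condition from the open cone to rank-one matrices on its boundary. -/
theorem nonpos_of_forall_add_mul_nonpos {a b : ℝ} (h : ∀ ε > 0, a + ε * b ≤ 0) : a ≤ 0 := by
  by_contra! ha
  have h1 := h (a / (2 * (|b| + 1))) (by positivity)
  have h2 : a / (2 * (|b| + 1)) * b ≥ -(a / 2) := by
    have : a / (2 * (|b| + 1)) * (|b| + 1) = a / 2 := by field_simp
    have h3 : 0 < a / (2 * (|b| + 1)) := by positivity
    nlinarith [neg_abs_le b]
  linarith

/-- A theorem of the alternative. Infeasibility separates the open cone `s ×ˢ s` from an affine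
image. Scaling in the cone makes the separating value nonnegative and `f` nonpositive on the cone; a
functional bounded below on an affine space is constant along its directions. -/
theorem exists_dual_certificate {E : Type*} [AddCommGroup E] [Module ℝ E] [TopologicalSpace E]
    [IsTopologicalAddGroup E] [ContinuousSMul ℝ E] {s : Set E} (hso : IsOpen s) (hsc : Convex ℝ s)
    (hcone : ∀ c : ℝ, 0 < c → ∀ x ∈ s, c • x ∈ s) {e : E} (he : e ∈ s) (L : E →ₗ[ℝ] E) (C T : E)
    (h : ¬ ∃ W, L W + C ∈ s ∧ W - T ∈ s) :
    ∃ f : StrongDual ℝ (E × E), (∀ x ∈ s, ∀ y ∈ s, f (x, y) ≤ 0) ∧ (∀ W, f (L W, W) = 0) ∧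
      0 ≤ f (C, -T) ∧ f (e, e) < f (C, -T) := by
  have hdisj : Disjoint (s ×ˢ s) (Set.range fun W : E => (L W + C, W - T)) := by
    rw [Set.disjoint_left]
    rintro _ ⟨h1, h2⟩ ⟨W, rfl⟩
    exact h ⟨W, h1, h2⟩
  have hsplit : ∀ W, (L W + C, W - T) = (L W, W) + (C, -T) := fun W => by
    simp [sub_eq_add_neg]
  have hconv : Convex ℝ (Set.range fun W : E => (L W + C, W - T)) := by
    rintro _ ⟨W, rfl⟩ _ ⟨W', rfl⟩ a b _ _ hab
    refine ⟨a • W + b • W', ?_⟩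
    obtain rfl : b = 1 - a := by linarith
    ext1
    · simp only [Prod.smul_mk, Prod.mk_add_mk, map_add, map_smul]
      module
    · simp only [Prod.smul_mk, Prod.mk_add_mk]
      module
  obtain ⟨f, u, hf1, hf2⟩ := geometric_hahn_banach_open (hsc.prod hsc) (hso.prod hso) hconv hdisj
  have hee : f (e, e) < u := hf1 _ ⟨he, he⟩
  have hu : 0 ≤ u := by
    by_contra! hu
    have hlt : f (e, e) < 0 := hee.trans hu
    -- This factor rescales `f (e, e)` to `u / 2`, which exceeds the negative number `u`.
    have hpos : 0 < u / (2 * f (e, e)) := div_pos_of_neg_of_neg hu (by linarith)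
    have h2 := hf1 ((u / (2 * f (e, e))) • (e, e)) ⟨hcone _ hpos _ he, hcone _ hpos _ he⟩
    rw [map_smul, smul_eq_mul] at h2
    have h3 : u / (2 * f (e, e)) * f (e, e) = u / 2 := by
      have := hlt.ne
      field_simp
    rw [h3] at h2
    linarith
  have hc0 : u ≤ f (C, -T) := by simpa using hf2 _ ⟨0, rfl⟩
  refine ⟨f, fun x hx y hy => ?_, fun W => ?_, hu.trans hc0, hee.trans_le hc0⟩
  · by_contra! hpos
    -- The rescaled point has value `u + f (x, y)`, which exceeds `u`.
    have hs : 0 < u / f (x, y) + 1 := by positivity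
    have h2 := hf1 ((u / f (x, y) + 1) • (x, y)) ⟨hcone _ hs _ hx, hcone _ hs _ hy⟩
    rw [map_smul, smul_eq_mul, add_mul, div_mul_cancel₀ _ hpos.ne'] at h2
    linarith
  · have h1 : ∀ a : ℝ, u ≤ a * f (L W, W) + f (C, -T) := by
      intro a
      have h2 := hf2 _ ⟨a • W, rfl⟩
      have h3 : (L (a • W), a • W) = a • (L W, W) := by simp
      simp only [hsplit] at h2
      rwa [h3, map_add, map_smul, smul_eq_mul] at h2
    by_contra hne
    -- With this coefficient the lower bound reads `u ≤ u - 1`.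
    have h2 := h1 ((u - f (C, -T) - 1) / f (L W, W))
    rw [div_mul_cancel₀ _ hne] at h2
    linarith

/-- The inequalities are linear in `W`, so failure has a dual certificate: positive semidefinite
`X`, `Y` with AᵀXA = X + Y and tr(BᵀXB) ≤ t tr Y. `eq_zero_of_expansion` makes both vanish, against
the strict inequality in the certificate. -/
theorem exists_large_lyapunov {A : Matrix ι ι ℝ} {B : Matrix ι κ ℝ}
    (hspec : ∀ μ ∈ spectrum ℂ (cx A), ‖μ‖ ≤ 1) (hB : Hautus A B) (t : ℝ) :
    ∃ W : Matrix ι ι ℝ, (W - t • 1).PosDef ∧ (W + B * Bᵀ - A * W * Aᵀ).PosDef := by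
  by_contra hcon
  let L : Matrix ι ι ℝ →ₗ[ℝ] Matrix ι ι ℝ :=
    LinearMap.id - (LinearMap.mulRight ℝ Aᵀ).comp (LinearMap.mulLeft ℝ A)
  have hL : ∀ W, L W = W - A * W * Aᵀ := fun W => rfl
  obtain ⟨f, hneg, hlin, hc0, h11⟩ := exists_dual_certificate isOpen_quadPos convex_quadPos
    (fun c hc x hx => smul_mem_quadPos hx hc) one_mem_quadPos L (B * Bᵀ) (t • 1) (by
      rintro ⟨W, h1, h2⟩
      -- Both constraints are compatible with transposition, so the symmetric part of a solution is
      -- a solution.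
      refine hcon ⟨(1 / 2 : ℝ) • (W + Wᵀ), ?_, ?_⟩
      · convert posDef_of_mem_quadPos h2 using 1
        rw [Matrix.transpose_sub, Matrix.transpose_smul, Matrix.transpose_one]
        module
      · convert posDef_of_mem_quadPos h1 using 1
        rw [hL, Matrix.transpose_add, Matrix.transpose_sub, Matrix.transpose_mul,
          Matrix.transpose_mul, Matrix.transpose_mul, Matrix.transpose_transpose,
          Matrix.transpose_transpose, Matrix.mul_smul, Matrix.smul_mul, Matrix.mul_add,
          Matrix.add_mul, Matrix.mul_assoc A Wᵀ]
        module)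
  obtain ⟨X, hXt, hX⟩ := exists_symm_trace_repr
    (-(f : (Matrix ι ι ℝ × Matrix ι ι ℝ) →ₗ[ℝ] ℝ).comp (LinearMap.inl ℝ (Matrix ι ι ℝ) (Matrix ι ι ℝ)))
  obtain ⟨Y, hYt, hY⟩ := exists_symm_trace_repr
    (-(f : (Matrix ι ι ℝ × Matrix ι ι ℝ) →ₗ[ℝ] ℝ).comp (LinearMap.inr ℝ (Matrix ι ι ℝ) (Matrix ι ι ℝ)))
  have hf : ∀ M M' : Matrix ι ι ℝ, Mᵀ = M → M'ᵀ = M' → f (M, M') = -((X * M).trace + (Y * M').trace) := by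
    intro M M' hM hM'
    have h1 : (M, M') = (M, 0) + (0, M') := by simp
    rw [← hX M hM, ← hY M' hM', h1, map_add]
    simp; ring
  have hone : ∀ x : ι → ℝ, 0 ≤ x ⬝ᵥ ((0 : Matrix ι ι ℝ) *ᵥ x) := by simp
  have hrank1 : ∀ x y : ι → ℝ, 0 ≤ y ⬝ᵥ (Matrix.vecMulVec x x *ᵥ y) := by
    intro x y
    rw [Matrix.vecMulVec_mulVec, dotProduct_smul, dotProduct_comm x y]
    simpa using mul_self_nonneg (y ⬝ᵥ x)
  have hsymm : ∀ x : ι → ℝ, (Matrix.vecMulVec x x)ᵀ = Matrix.vecMulVec x x := fun x =>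
    Matrix.transpose_vecMulVec x x
  have htr : ∀ (M : Matrix ι ι ℝ) (x : ι → ℝ), (M * Matrix.vecMulVec x x).trace = x ⬝ᵥ (M *ᵥ x) := by
    intro M x
    rw [Matrix.mul_vecMulVec, Matrix.trace_vecMulVec, dotProduct_comm]
  have hXpos : X.PosSemidef := by
    refine .of_dotProduct_mulVec_nonneg
      (by rw [Matrix.IsHermitian, Matrix.conjTranspose_eq_transpose_of_trivial, hXt]) fun x => ?_
    have h1 : f (Matrix.vecMulVec x x, 0) ≤ 0 := by
      refine nonpos_of_forall_add_mul_nonpos (b := f (1, 1)) fun ε hε => ?_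
      have := hneg _ (add_mem_quadPos (hrank1 x) (smul_mem_quadPos one_mem_quadPos hε)) _
        (add_mem_quadPos hone (smul_mem_quadPos one_mem_quadPos hε))
      rwa [← Prod.mk_add_mk, map_add, ← Prod.smul_mk, map_smul, smul_eq_mul] at this
    rw [hf _ _ (hsymm x) Matrix.transpose_zero, htr, Matrix.mul_zero, Matrix.trace_zero] at h1
    rw [star_trivial]; linarith
  have hYpos : Y.PosSemidef := by
    refine .of_dotProduct_mulVec_nonneg
      (by rw [Matrix.IsHermitian, Matrix.conjTranspose_eq_transpose_of_trivial, hYt]) fun x => ?_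
    have h1 : f (0, Matrix.vecMulVec x x) ≤ 0 := by
      refine nonpos_of_forall_add_mul_nonpos (b := f (1, 1)) fun ε hε => ?_
      have := hneg _ (add_mem_quadPos hone (smul_mem_quadPos one_mem_quadPos hε)) _
        (add_mem_quadPos (hrank1 x) (smul_mem_quadPos one_mem_quadPos hε))
      rwa [← Prod.mk_add_mk, map_add, ← Prod.smul_mk, map_smul, smul_eq_mul] at this
    rw [hf _ _ Matrix.transpose_zero (hsymm x), htr, Matrix.mul_zero, Matrix.trace_zero] at h1
    rw [star_trivial]; linarith
  have hXY : Aᵀ * X * A = X + Y := by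
    -- On symmetric `W`, `f (L W, W)` is the negative of the trace pairing of `W` with `D`; testing
    -- with `W = D` gives tr(DᵀD) = 0.
    set D := X - Aᵀ * X * A + Y with hD
    have hDt : Dᵀ = D := by
      simp [hD, Matrix.transpose_mul, hXt, hYt, Matrix.mul_assoc]
    have h1 := hlin D
    rw [hL] at h1
    have hsD : (D - A * D * Aᵀ)ᵀ = D - A * D * Aᵀ := by
      simp [Matrix.transpose_mul, hDt, Matrix.mul_assoc]
    rw [hf _ _ hsD hDt] at h1
    have h2 : (X * (A * D * Aᵀ)).trace = (Aᵀ * X * A * D).trace := by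
      rw [← Matrix.mul_assoc, Matrix.trace_mul_comm]
      simp only [Matrix.mul_assoc]
    have h3 : (Dᴴ * D).trace = 0 := by
      rw [Matrix.conjTranspose_eq_transpose_of_trivial, hDt]
      conv_lhs => enter [1, 1]; rw [hD]
      rw [Matrix.add_mul, Matrix.sub_mul, Matrix.trace_add, Matrix.trace_sub, ← h2,
        ← Matrix.trace_sub, ← Matrix.mul_sub]
      linarith
    rw [Matrix.trace_conjTranspose_mul_self_eq_zero_iff] at h3
    rw [hD] at h3
    rw [← sub_eq_zero, ← neg_eq_zero, ← h3]
    abel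
  have hBsymm : (B * Bᵀ)ᵀ = B * Bᵀ := by simp
  have hfc0 : f (B * Bᵀ, -(t • (1 : Matrix ι ι ℝ))) = -((Bᵀ * X * B).trace - t * Y.trace) := by
    rw [hf _ _ hBsymm (by simp), ← Matrix.mul_assoc, Matrix.trace_mul_comm, ← Matrix.mul_assoc]
    simp
    ring
  have hX0 : X = 0 := eq_zero_of_expansion hXpos hYpos hXY hspec hB (t := t) (by
    rw [hfc0] at hc0; linarith)
  have hY0 : Y = 0 := by
    rw [hX0, Matrix.mul_zero, Matrix.zero_mul, zero_add] at hXY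
    exact hXY.symm
  rw [hfc0, hf _ _ Matrix.transpose_one Matrix.transpose_one, hX0, hY0] at h11
  simp at h11

/-- The discrete algebraic Riccati inequality has arbitrarily small positive definite solutions. -/
theorem exists_small_riccati {A : Matrix ι ι ℝ} {B : Matrix ι κ ℝ}
    (hspec : ∀ μ ∈ spectrum ℂ (cx A), ‖μ‖ ≤ 1) (hB : Hautus A B) {ε : ℝ} (hε : 0 < ε) :
    ∃ P : Matrix ι ι ℝ, P.PosDef ∧ (∀ i j, |P i j| ≤ ε) ∧
      (P - Aᵀ * P * A + (Bᵀ * P * A)ᵀ * (Bᵀ * P * A)).PosDef := by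
  obtain ⟨W, hW1, hW2⟩ := exists_large_lyapunov hspec hB ε⁻¹
  have hW : W.PosDef := by
    have := hW1.add (Matrix.PosDef.one.smul (inv_pos.2 hε))
    rwa [sub_add_cancel] at this
  have hdet : IsUnit W.det := (Matrix.isUnit_iff_isUnit_det _).1 hW.isUnit
  set P := W⁻¹ with hPdef
  have hP : P.PosDef := hW.inv
  have hPt : Pᵀ = P := isSymm_of_isHermitian hP.1
  have hWP : ∀ x, W *ᵥ (P *ᵥ x) = x := fun x => by
    rw [Matrix.mulVec_mulVec, Matrix.mul_nonsing_inv _ hdet, Matrix.one_mulVec]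
  have hPW : ∀ x, P *ᵥ (W *ᵥ x) = x := fun x => by
    rw [Matrix.mulVec_mulVec, Matrix.nonsing_inv_mul _ hdet, Matrix.one_mulVec]
  refine ⟨P, hP, ?_, ?_⟩
  · have hcol : ∀ j, (P *ᵥ Pi.single j 1) ⬝ᵥ (P *ᵥ Pi.single j 1) ≤ ε * P j j := by
      intro j
      have h1 := hW1.posSemidef.dotProduct_mulVec_nonneg (P *ᵥ Pi.single j 1)
      rw [star_trivial, Matrix.sub_mulVec, hWP, dotProduct_sub, Matrix.smul_mulVec,
        Matrix.one_mulVec, dotProduct_smul, smul_eq_mul] at h1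
      have h2 : (P *ᵥ Pi.single j 1) ⬝ᵥ Pi.single j 1 = P j j := by simp
      rw [h2] at h1
      have h3 : ε⁻¹ * ((P *ᵥ Pi.single j 1) ⬝ᵥ (P *ᵥ Pi.single j 1)) ≤ P j j := by linarith
      rwa [inv_mul_le_iff₀ hε] at h3
    -- The diagonal case `i = j` gives `P j j ≤ ε`, which turns this estimate into a bound for all
    -- entries.
    have hent : ∀ i j, P i j ^ 2 ≤ ε * P j j := by
      intro i j
      refine le_trans ?_ (hcol j)
      have : (P *ᵥ Pi.single j 1) ⬝ᵥ (P *ᵥ Pi.single j 1) = ∑ k, P k j ^ 2 := by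
        simp [dotProduct, sq]
      rw [this]
      exact Finset.single_le_sum (f := fun k => P k j ^ 2) (fun _ _ => sq_nonneg _)
        (Finset.mem_univ i)
    intro i j
    have h1 : P j j ≤ ε := by
      by_contra! hlt
      have := hent j j
      nlinarith
    refine abs_le_of_sq_le_sq ?_ hε.le
    nlinarith [hent i j]
  · refine .of_dotProduct_mulVec_pos ?_ fun x hx => ?_
    · rw [Matrix.IsHermitian, Matrix.conjTranspose_eq_transpose_of_trivial]
      simp [Matrix.transpose_mul, hPt, Matrix.mul_assoc]
    · set y := P *ᵥ (A *ᵥ x) with hy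
      have e1 : x ⬝ᵥ ((Aᵀ * P * A) *ᵥ x) = y ⬝ᵥ (A *ᵥ x) := by
        rw [Matrix.mul_assoc, ← Matrix.mulVec_mulVec, dotProduct_mulVec_comm, Matrix.transpose_transpose,
          ← Matrix.mulVec_mulVec, dotProduct_comm]
      have e2 : x ⬝ᵥ (((Bᵀ * P * A)ᵀ * (Bᵀ * P * A)) *ᵥ x) = (Bᵀ *ᵥ y) ⬝ᵥ (Bᵀ *ᵥ y) := by
        have : (Bᵀ * P * A) *ᵥ x = Bᵀ *ᵥ y := by
          rw [hy, Matrix.mulVec_mulVec, Matrix.mulVec_mulVec, Matrix.mul_assoc]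
        rw [← Matrix.mulVec_mulVec, dotProduct_mulVec_comm, Matrix.transpose_transpose, this]
      rw [star_trivial, Matrix.add_mulVec, Matrix.sub_mulVec, dotProduct_add, dotProduct_sub, e1, e2]
      have hxP := hP.dotProduct_mulVec_pos hx
      rw [star_trivial] at hxP
      by_cases hy0 : y = 0
      · simpa [hy0] using hxP
      · have h1 := hW2.dotProduct_mulVec_pos hy0
        rw [star_trivial, Matrix.sub_mulVec, Matrix.add_mulVec, dotProduct_sub, dotProduct_add,
          hy, hWP, ← hy, ← Matrix.mulVec_mulVec, dotProduct_mulVec_comm B, ← Matrix.mulVec_mulVec,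
          ← Matrix.mulVec_mulVec, dotProduct_mulVec_comm A y (W *ᵥ _)] at h1
        -- Completion of the square: this nonnegative quantity, added to the Lyapunov inequality for
        -- `W` tested at y = PAx, gives the Riccati inequality.
        have h2 := hP.posSemidef.dotProduct_mulVec_nonneg (x - W *ᵥ (Aᵀ *ᵥ y))
        rw [star_trivial, Matrix.mulVec_sub, hPW, dotProduct_sub, sub_dotProduct, sub_dotProduct,
          dotProduct_comm (W *ᵥ _) (P *ᵥ x), ← hPt, ← dotProduct_mulVec_comm, hPt, hPW] at h2
        have h3 : x ⬝ᵥ (Aᵀ *ᵥ y) = y ⬝ᵥ (A *ᵥ x) := by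
          rw [dotProduct_mulVec_comm, Matrix.transpose_transpose, dotProduct_comm]
        have h4 : (W *ᵥ (Aᵀ *ᵥ y)) ⬝ᵥ (Aᵀ *ᵥ y) = (Aᵀ *ᵥ y) ⬝ᵥ (W *ᵥ (Aᵀ *ᵥ y)) :=
          dotProduct_comm _ _
        rw [h3, h4] at h2
        linarith

end Inequality

/-! ### Low-gain feedback through a delayed input channel -/

section LowGain

variable {ι κ : Type*} [Fintype ι] [Fintype κ]

theorem exists_norm_mulVec_le (M : Matrix ι κ ℂ) : ∃ c : ℝ, 0 ≤ c ∧ ∀ v, ‖M *ᵥ v‖ ≤ c * ‖v‖ :=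
  ⟨‖LinearMap.toContinuousLinearMap M.mulVecLin‖, norm_nonneg _,
    (LinearMap.toContinuousLinearMap M.mulVecLin).le_opNorm⟩

theorem norm_mulVec_le_of_entries {M : Matrix ι κ ℂ} {ε : ℝ} (hε : 0 ≤ ε)
    (h : ∀ i j, ‖M i j‖ ≤ ε) (v : κ → ℂ) : ‖M *ᵥ v‖ ≤ Fintype.card κ * ε * ‖v‖ := by
  refine (pi_norm_le_iff_of_nonneg (by positivity)).2 fun i => ?_
  refine (norm_sum_le _ _).trans ?_
  calc ∑ j, ‖M i j * v j‖ ≤ ∑ _j : κ, ε * ‖v‖ := by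
        refine Finset.sum_le_sum fun j _ => ?_
        rw [norm_mul]
        exact mul_le_mul (h i j) (norm_le_pi_norm v j) (norm_nonneg _) hε
    _ = Fintype.card κ * ε * ‖v‖ := by simp [mul_assoc]

theorem norm_star_dotProduct_le (u v : κ → ℂ) : ‖star u ⬝ᵥ v‖ ≤ Fintype.card κ * (‖u‖ * ‖v‖) := by
  refine (norm_sum_le _ _).trans ?_
  calc ∑ j, ‖star u j * v j‖ ≤ ∑ _j : κ, ‖u‖ * ‖v‖ := by
        refine Finset.sum_le_sum fun j _ => ?_
        rw [norm_mul, Pi.star_apply, norm_star]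
        exact mul_le_mul (norm_le_pi_norm u j) (norm_le_pi_norm v j) (norm_nonneg _) (norm_nonneg _)
    _ = Fintype.card κ * (‖u‖ * ‖v‖) := by simp

theorem star_dotProduct_self_re (u : κ → ℂ) : (star u ⬝ᵥ u).re = ∑ j, ‖u j‖ ^ 2 := by
  simp [dotProduct, Complex.sq_norm, Complex.normSq_apply]

theorem sq_norm_le_star_dotProduct_self_re (u : κ → ℂ) : ‖u‖ ^ 2 ≤ (star u ⬝ᵥ u).re := by
  rw [star_dotProduct_self_re]
  have h0 : 0 ≤ ∑ j, ‖u j‖ ^ 2 := Finset.sum_nonneg fun _ _ => sq_nonneg _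
  have h1 : ‖u‖ ≤ √(∑ j, ‖u j‖ ^ 2) := by
    refine (pi_norm_le_iff_of_nonneg (Real.sqrt_nonneg _)).2 fun i => Real.le_sqrt_of_sq_le ?_
    exact Finset.single_le_sum (f := fun j => ‖u j‖ ^ 2) (fun _ _ => sq_nonneg _)
      (Finset.mem_univ i)
  calc ‖u‖ ^ 2 ≤ √(∑ j, ‖u j‖ ^ 2) ^ 2 := by gcongr
    _ = _ := Real.sq_sqrt h0

theorem star_dotProduct_self_im (u : κ → ℂ) : (star u ⬝ᵥ u).im = 0 := by
  simp [dotProduct, mul_comm]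

theorem star_dotProduct_comm (u v : κ → ℂ) : star u ⬝ᵥ v = star (star v ⬝ᵥ u) := by
  simp [dotProduct, mul_comm]

theorem star_dotProduct_cx (M : Matrix ι κ ℝ) (y : ι → ℂ) (w : κ → ℂ) :
    star y ⬝ᵥ (cx M *ᵥ w) = star (cx Mᵀ *ᵥ y) ⬝ᵥ w := by
  rw [Matrix.star_mulVec, cx_conjTranspose, Matrix.transpose_transpose, Matrix.dotProduct_mulVec]

open scoped ComplexOrder in
/-- The energy balance of a mode `z` under a perturbed Riccati feedback. -/
theorem norm_lt_one_of_riccati {A P : Matrix ι ι ℝ} {B : Matrix ι κ ℝ} (hP : P.PosDef)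
    (hric : (P - Aᵀ * P * A + (Bᵀ * P * A)ᵀ * (Bᵀ * P * A)).PosDef) {a b : ℝ} (ha : 0 < a)
    {z μ : ℂ} (hre : a ≤ μ.re) (hμ : ‖μ‖ ≤ b) {x : ι → ℂ} (hx0 : x ≠ 0) {u g : κ → ℂ}
    (hx : z • x = cx A *ᵥ x + μ • (cx B *ᵥ u))
    (hu : cx (Bᵀ * P * A) *ᵥ x = -(a • u) - g) {c₁ c₂ c₃ : ℝ}
    (h₁ : ‖star u ⬝ᵥ g‖ ≤ c₁ * ‖u‖ ^ 2) (h₂ : (star g ⬝ᵥ g).re ≤ c₂ * ‖u‖ ^ 2)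
    (h₃ : ‖star u ⬝ᵥ (cx (Bᵀ * P * B) *ᵥ u)‖ ≤ c₃ * ‖u‖ ^ 2)
    (hc : 2 * (a + b) * c₁ + c₂ + b ^ 2 * c₃ ≤ a ^ 2) : ‖z‖ < 1 := by
  have hPt : Pᵀ = P := isSymm_of_isHermitian hP.1
  set f := cx (Bᵀ * P * A) *ᵥ x with hf
  have hff : (star f ⬝ᵥ f).re = a ^ 2 * (star u ⬝ᵥ u).re + 2 * a * (star u ⬝ᵥ g).re +
      (star g ⬝ᵥ g).re := by
    have h1 : star f ⬝ᵥ f = a ^ 2 * (star u ⬝ᵥ u) + a * (star u ⬝ᵥ g) + a * star (star u ⬝ᵥ g) +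
        star g ⬝ᵥ g := by
      rw [hu, ← star_dotProduct_comm g u]
      simp only [star_sub, star_neg, star_smul, sub_dotProduct, dotProduct_sub, neg_dotProduct,
        dotProduct_neg, smul_dotProduct, dotProduct_smul, star_trivial, Complex.real_smul]
      ring
    rw [h1]
    simp [← Complex.ofReal_pow]
    ring
  have hpos : 0 < (star x ⬝ᵥ (cx P *ᵥ x)).re - (star (cx A *ᵥ x) ⬝ᵥ (cx P *ᵥ (cx A *ᵥ x))).re +
      (star f ⬝ᵥ f).re := by
    have h1 := (posDef_cx hric).re_dotProduct_pos hx0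
    rw [cx_add, cx_sub, cx_mul, cx_mul, cx_mul _ (Bᵀ * P * A), Matrix.add_mulVec, Matrix.sub_mulVec,
      ← Matrix.mulVec_mulVec, ← Matrix.mulVec_mulVec, ← Matrix.mulVec_mulVec, ← hf, dotProduct_add,
      dotProduct_sub, star_dotProduct_cx Aᵀ, star_dotProduct_cx (Bᵀ * P * A)ᵀ,
      Matrix.transpose_transpose, Matrix.transpose_transpose, ← hf] at h1
    simpa using h1
  have hπ : 0 < (star x ⬝ᵥ (cx P *ᵥ x)).re := (posDef_cx hP).re_dotProduct_pos hx0
  have hbal : ‖z‖ ^ 2 * (star x ⬝ᵥ (cx P *ᵥ x)).re =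
      (star (cx A *ᵥ x) ⬝ᵥ (cx P *ᵥ (cx A *ᵥ x))).re +
      2 * (star μ * (star u ⬝ᵥ f)).re + ‖μ‖ ^ 2 * (star u ⬝ᵥ (cx (Bᵀ * P * B) *ᵥ u)).re := by
    have h1 : star (z • x) ⬝ᵥ (cx P *ᵥ (z • x)) = ((‖z‖ ^ 2 : ℝ) : ℂ) * (star x ⬝ᵥ (cx P *ᵥ x)) := by
      rw [Matrix.mulVec_smul, star_smul, smul_dotProduct, dotProduct_smul, smul_smul, smul_eq_mul,
        Complex.star_def, Complex.conj_mul']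
      push_cast; rfl
    have h2 : star (cx B *ᵥ u) ⬝ᵥ (cx P *ᵥ (cx A *ᵥ x)) = star u ⬝ᵥ f := by
      rw [hf, cx_mul, cx_mul, ← Matrix.mulVec_mulVec, ← Matrix.mulVec_mulVec, star_dotProduct_cx Bᵀ,
        Matrix.transpose_transpose]
    have h3 : star (cx A *ᵥ x) ⬝ᵥ (cx P *ᵥ (cx B *ᵥ u)) = star (star u ⬝ᵥ f) := by
      rw [← h2, star_dotProduct_cx, hPt, star_dotProduct_comm]
    have h4 : star (cx B *ᵥ u) ⬝ᵥ (cx P *ᵥ (cx B *ᵥ u)) = star u ⬝ᵥ (cx (Bᵀ * P * B) *ᵥ u) := by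
      rw [cx_mul, cx_mul, ← Matrix.mulVec_mulVec, ← Matrix.mulVec_mulVec, star_dotProduct_cx Bᵀ,
        Matrix.transpose_transpose]
    have h5 : star (z • x) ⬝ᵥ (cx P *ᵥ (z • x)) =
        star (cx A *ᵥ x) ⬝ᵥ (cx P *ᵥ (cx A *ᵥ x)) + star (star μ * (star u ⬝ᵥ f)) +
        star μ * (star u ⬝ᵥ f) + ((‖μ‖ ^ 2 : ℝ) : ℂ) * (star u ⬝ᵥ (cx (Bᵀ * P * B) *ᵥ u)) := by
      have h6 : ((‖μ‖ ^ 2 : ℝ) : ℂ) = star μ * μ := by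
        rw [Complex.star_def, Complex.conj_mul']
        push_cast; rfl
      rw [hx, Matrix.mulVec_add, Matrix.mulVec_smul, star_add, star_smul, add_dotProduct,
        dotProduct_add, dotProduct_add, smul_dotProduct, smul_dotProduct, dotProduct_smul,
        dotProduct_smul, h2, h3, h4, h6, star_mul, star_star]
      simp only [smul_eq_mul]
      ring
    have h7 := congrArg Complex.re (h1.symm.trans h5)
    rw [Complex.re_ofReal_mul, Complex.add_re, Complex.add_re, Complex.add_re,
      Complex.re_ofReal_mul, Complex.star_def, Complex.conj_re] at h7
    rw [h7, ← Complex.star_def]; ring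
  have huf : (star μ * (star u ⬝ᵥ f)).re =
      -(a * μ.re * (star u ⬝ᵥ u).re) - (star μ * (star u ⬝ᵥ g)).re := by
    have h1 : star u ⬝ᵥ f = -(a * (star u ⬝ᵥ u)) - star u ⬝ᵥ g := by
      rw [hu, dotProduct_sub, dotProduct_neg, dotProduct_smul, Complex.real_smul]
    have h2 := star_dotProduct_self_im u
    rw [h1, mul_sub, Complex.sub_re]
    simp [h2]
    ring
  -- The Riccati inequality costs a²|u|², whereas the feedback term contributes -2a Re μ |u|² ≤
  -- -2a²|u|². The surplus a²|u|² absorbs the terms in `g` (with factors 2a and 2b in front of `c₁`,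
  -- from |f|² and from the cross term) and the quadratic term in BᵀPB.
  by_contra! hz
  have hz2 : 1 ≤ ‖z‖ ^ 2 := one_le_pow₀ hz
  have hb : 0 ≤ b := (norm_nonneg _).trans hμ
  have hN := sq_norm_le_star_dotProduct_self_re u
  have hN0 : 0 ≤ ‖u‖ ^ 2 := sq_nonneg _
  have k1 : (star u ⬝ᵥ g).re ≤ c₁ * ‖u‖ ^ 2 := (Complex.re_le_norm _).trans h₁
  have k2 : -(star μ * (star u ⬝ᵥ g)).re ≤ b * (c₁ * ‖u‖ ^ 2) := by
    refine (neg_le_abs _).trans ((Complex.abs_re_le_norm _).trans ?_)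
    rw [norm_mul, norm_star]
    exact mul_le_mul hμ h₁ (norm_nonneg _) hb
  have k3 : ‖μ‖ ^ 2 * (star u ⬝ᵥ (cx (Bᵀ * P * B) *ᵥ u)).re ≤ b ^ 2 * (c₃ * ‖u‖ ^ 2) := by
    have hμ2 : ‖μ‖ ^ 2 ≤ b ^ 2 := by gcongr
    calc _ ≤ ‖μ‖ ^ 2 * ‖star u ⬝ᵥ (cx (Bᵀ * P * B) *ᵥ u)‖ := by
          gcongr; exact Complex.re_le_norm _
      _ ≤ _ := mul_le_mul hμ2 h₃ (norm_nonneg _) (by positivity)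
  have k4 : a * a * (star u ⬝ᵥ u).re ≤ a * μ.re * (star u ⬝ᵥ u).re := by
    have : 0 ≤ (star u ⬝ᵥ u).re := hN0.trans hN
    gcongr
  have k5 : (star x ⬝ᵥ (cx P *ᵥ x)).re ≤ ‖z‖ ^ 2 * (star x ⬝ᵥ (cx P *ᵥ x)).re :=
    le_mul_of_one_le_left hπ.le hz2
  have k6 : (2 * (a + b) * c₁ + c₂ + b ^ 2 * c₃) * ‖u‖ ^ 2 ≤ a ^ 2 * ‖u‖ ^ 2 :=
    mul_le_mul_of_nonneg_right hc hN0
  have k7 : a ^ 2 * ‖u‖ ^ 2 ≤ a ^ 2 * (star u ⬝ᵥ u).re := by gcongr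
  have k8 : a * (star u ⬝ᵥ g).re ≤ a * (c₁ * ‖u‖ ^ 2) := by gcongr
  rw [hbal, huf] at k5
  rw [hff] at hpos
  nlinarith

variable [DecidableEq ι]

/-- Along a mode `z` of modulus at least one, `z⁻ʳ Aʳ x` predicts `x` up to a multiple of the
input `u`. -/
theorem exists_predictor_bound (A : Matrix ι ι ℂ) (B : Matrix ι κ ℂ) {b : ℝ} (hb : 0 ≤ b) (r : ℕ) :
    ∃ D : ℝ, 0 ≤ D ∧ ∀ (z μ : ℂ) (x : ι → ℂ) (u : κ → ℂ), 1 ≤ ‖z‖ → ‖μ‖ ≤ b →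
      z • x = A *ᵥ x + μ • (B *ᵥ u) → ‖z⁻¹ ^ r • ((A ^ r) *ᵥ x) - x‖ ≤ D * ‖u‖ := by
  obtain ⟨cA, hcA, hA⟩ := exists_norm_mulVec_le A
  obtain ⟨cB, hcB, hB⟩ := exists_norm_mulVec_le B
  induction r with
  | zero => exact ⟨0, le_rfl, by simp⟩
  | succ r ih =>
    obtain ⟨D, hD, h⟩ := ih
    refine ⟨cA * D + b * cB, by positivity, fun z μ x u hz hμ hx => ?_⟩
    have hz0 : z ≠ 0 := norm_pos_iff.1 (zero_lt_one.trans_le hz)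
    have hzi : ‖z⁻¹‖ ≤ 1 := by rw [norm_inv]; exact inv_le_one_of_one_le₀ hz
    set d := z⁻¹ ^ r • ((A ^ r) *ᵥ x) - x with hd
    have e : z⁻¹ ^ (r + 1) • ((A ^ (r + 1)) *ᵥ x) - x = z⁻¹ • (A *ᵥ d - μ • (B *ᵥ u)) := by
      have h1 : A *ᵥ d = z⁻¹ ^ r • ((A ^ (r + 1)) *ᵥ x) - A *ᵥ x := by
        rw [hd, Matrix.mulVec_sub, Matrix.mulVec_smul, Matrix.mulVec_mulVec, pow_succ' A]
      have h2 : μ • (B *ᵥ u) = z • x - A *ᵥ x := by rw [hx]; abel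
      rw [h1, h2, sub_sub_sub_cancel_right, smul_sub, smul_smul, smul_smul, inv_mul_cancel₀ hz0,
        one_smul, pow_succ']
    rw [e, norm_smul]
    calc ‖z⁻¹‖ * ‖A *ᵥ d - μ • (B *ᵥ u)‖ ≤ 1 * (cA * (D * ‖u‖) + b * (cB * ‖u‖)) := by
          refine mul_le_mul hzi ((norm_sub_le _ _).trans (add_le_add ?_ ?_)) (norm_nonneg _) one_pos.le
          · exact (hA d).trans (mul_le_mul_of_nonneg_left (h z μ x u hz hμ hx) hcA)
          · rw [norm_smul]
            exact mul_le_mul hμ (hB u) (norm_nonneg _) hb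
      _ = (cA * D + b * cB) * ‖u‖ := by ring

/-- Low-gain stabilization: one real feedback gain moves all modes of
`x⁺ = A x + μ B K x(· - r)` into the open unit disk, for all `μ` in a bounded set of complex numbers
with real parts bounded away from zero. -/
theorem exists_lowGain {A : Matrix ι ι ℝ} {B : Matrix ι κ ℝ}
    (hspec : ∀ μ ∈ spectrum ℂ (cx A), ‖μ‖ ≤ 1) (hB : Hautus A B) {a b : ℝ} (ha : 0 < a) (r : ℕ) :
    ∃ K : Matrix κ ι ℝ, ∀ μ : ℂ, a ≤ μ.re → ‖μ‖ ≤ b → ∀ z : ℂ, 1 ≤ ‖z‖ → ∀ x : ι → ℂ,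
      z ^ (r + 1) • x = z ^ r • (cx A *ᵥ x) + μ • (cx (B * K) *ᵥ x) → x = 0 := by
  rcases lt_or_ge b 0 with hb | hb
  · exact ⟨0, fun μ _ hμ => absurd (norm_nonneg μ) (by linarith)⟩
  obtain ⟨D, hD, hpred⟩ := exists_predictor_bound (cx A) (cx B) hb r
  obtain ⟨cA, hcA, hA⟩ := exists_norm_mulVec_le (cx A)
  obtain ⟨cB, hcB, hBn⟩ := exists_norm_mulVec_le (cx B)
  obtain ⟨cT, hcT, hT⟩ := exists_norm_mulVec_le (cx Bᵀ)
  set n : ℝ := (Fintype.card ι : ℝ)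
  set m : ℝ := (Fintype.card κ : ℝ)
  have hn : 0 ≤ n := Nat.cast_nonneg _
  have hm : 0 ≤ m := Nat.cast_nonneg _
  set g₀ : ℝ := cT * (n * (cA * D)) with hg₀
  have hg₀' : 0 ≤ g₀ := by positivity
  -- With `P` of size `ε`, the error constants `c₁`, `c₂`, `c₃` are proportional to `ε` (using ε² ≤
  -- ε), and `ε * tot` is their total in the energy balance. None of the constants in `tot` depends
  -- on `P`.
  set tot : ℝ := 2 * (a + b) * (m * g₀) + m * g₀ ^ 2 + b ^ 2 * (m * (cT * (n * cB))) with htot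
  have htot0 : 0 ≤ tot := by positivity
  obtain ⟨ε, hε, hε1, hεt⟩ : ∃ ε : ℝ, 0 < ε ∧ ε ≤ 1 ∧ ε * tot ≤ a ^ 2 := by
    refine ⟨min 1 (a ^ 2 / (tot + 1)), by positivity, min_le_left _ _, ?_⟩
    calc min 1 (a ^ 2 / (tot + 1)) * tot ≤ a ^ 2 / (tot + 1) * (tot + 1) := by
          refine mul_le_mul (min_le_right _ _) (by linarith) htot0 (by positivity)
      _ = a ^ 2 := div_mul_cancel₀ _ (by positivity)
  obtain ⟨P, hP, hPε, hric⟩ := exists_small_riccati hspec hB hε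
  have hPn : ∀ v, ‖cx P *ᵥ v‖ ≤ n * ε * ‖v‖ :=
    norm_mulVec_le_of_entries hε.le fun i j => by simpa using hPε i j
  -- The Riccati feedback acts on the predicted state. Along a mode the delay contributes z⁻ʳ, and
  -- z⁻ʳAʳx = x + d with `d` bounded by a multiple of `u` independent of `ε`.
  refine ⟨(-a⁻¹) • (Bᵀ * P * A * A ^ r), fun μ hre hμ z hz x hx => ?_⟩
  by_contra hx0
  have hz0 : z ≠ 0 := norm_pos_iff.1 (zero_lt_one.trans_le hz)
  set u : κ → ℂ := z⁻¹ ^ r • (cx ((-a⁻¹) • (Bᵀ * P * A * A ^ r)) *ᵥ x) with hu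
  have hzr : z⁻¹ ^ r * z ^ r = 1 := by rw [← mul_pow, inv_mul_cancel₀ hz0, one_pow]
  have hzx : z • x = cx A *ᵥ x + μ • (cx B *ᵥ u) := by
    have h1 := congrArg (fun y => z⁻¹ ^ r • y) hx
    simp only [smul_add, smul_smul, pow_succ, ← mul_assoc, hzr, one_mul, one_smul] at h1
    rw [h1, hu, Matrix.mulVec_smul, Matrix.mulVec_mulVec, ← cx_mul, smul_smul, mul_comm μ]
  set d := z⁻¹ ^ r • ((cx A ^ r) *ᵥ x) - x with hd
  have hdn : ‖d‖ ≤ D * ‖u‖ := hpred z μ x u hz hμ hzx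
  set g : κ → ℂ := cx (Bᵀ * P * A) *ᵥ d with hg
  have hf : cx (Bᵀ * P * A) *ᵥ x = -(a • u) - g := by
    have h1 : u = (-(a : ℂ)⁻¹) • (cx (Bᵀ * P * A) *ᵥ (x + d)) := by
      rw [hu, cx_smul, cx_mul _ (A ^ r), cx_pow, hd, add_sub_cancel, Matrix.smul_mulVec,
        Matrix.mulVec_smul, ← Matrix.mulVec_mulVec, smul_comm]
      push_cast
      rfl
    have h2 : a • u = -(cx (Bᵀ * P * A) *ᵥ x + g) := by
      rw [h1, Matrix.mulVec_add, ← Complex.coe_smul, smul_smul, mul_neg,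
        mul_inv_cancel₀ (by exact_mod_cast ha.ne'), neg_one_smul]
    rw [h2]; abel
  have hgn : ‖g‖ ≤ ε * g₀ * ‖u‖ := by
    rw [hg, cx_mul, cx_mul, ← Matrix.mulVec_mulVec, ← Matrix.mulVec_mulVec]
    calc _ ≤ cT * (n * ε * (cA * (D * ‖u‖))) := by
          refine (hT _).trans (mul_le_mul_of_nonneg_left ((hPn _).trans ?_) hcT)
          refine mul_le_mul_of_nonneg_left ((hA _).trans ?_) (by positivity)
          exact mul_le_mul_of_nonneg_left hdn hcA
      _ = ε * g₀ * ‖u‖ := by rw [hg₀]; ring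
  refine absurd (norm_lt_one_of_riccati hP hric ha hre hμ hx0 hzx hf
    (c₁ := ε * (m * g₀)) (c₂ := ε * (m * g₀ ^ 2)) (c₃ := ε * (m * (cT * (n * cB)))) ?_ ?_ ?_ ?_)
    (not_lt.2 hz)
  · refine (norm_star_dotProduct_le u g).trans ?_
    calc m * (‖u‖ * ‖g‖) ≤ m * (‖u‖ * (ε * g₀ * ‖u‖)) := by gcongr
      _ = _ := by ring
  · refine (Complex.re_le_norm _).trans ((norm_star_dotProduct_le g g).trans ?_)
    calc m * (‖g‖ * ‖g‖) ≤ m * ((ε * g₀ * ‖u‖) * (ε * g₀ * ‖u‖)) := by gcongr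
      _ = ε * (ε * (m * g₀ ^ 2) * ‖u‖ ^ 2) := by ring
      _ ≤ 1 * (ε * (m * g₀ ^ 2) * ‖u‖ ^ 2) := by gcongr
      _ = _ := one_mul _
  · refine (norm_star_dotProduct_le u _).trans ?_
    have h1 : ‖cx (Bᵀ * P * B) *ᵥ u‖ ≤ cT * (n * ε * (cB * ‖u‖)) := by
      rw [cx_mul, cx_mul, ← Matrix.mulVec_mulVec, ← Matrix.mulVec_mulVec]
      refine (hT _).trans (mul_le_mul_of_nonneg_left ((hPn _).trans ?_) hcT)
      exact mul_le_mul_of_nonneg_left (hBn _) (by positivity)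
    calc m * (‖u‖ * ‖cx (Bᵀ * P * B) *ᵥ u‖) ≤ m * (‖u‖ * (cT * (n * ε * (cB * ‖u‖)))) := by gcongr
      _ = _ := by ring
  · calc _ = ε * tot := by rw [htot]; ring
      _ ≤ a ^ 2 := hεt

end LowGain

/-! ### Spanning trees and the Laplacian of the followers -/

section Graph

/-- There is a walk of length `n` from `root` to the node. -/
def IsWalkEnd {V : Type*} (G : Digraph V) (root : V) : ℕ → V → Prop
  | 0, i => i = root
  | n + 1, i => ∃ j, IsWalkEnd G root n j ∧ G.Adj j i

/-- A digraph has a directed spanning tree with a given root if and only if all nodes are reachable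
from the root. -/
theorem hasDirectedSpanningTree_iff {V : Type*} (G : Digraph V) (root : V) :
    HasDirectedSpanningTree G root ↔ ∀ i, Relation.ReflTransGen G.Adj root i := by
  classical
  constructor
  · rintro ⟨T, hT⟩ i
    exact Relation.ReflTransGen.mono hT.sub _ _ (hT.reachable i)
  · intro h
    have hwalk : ∀ i, ∃ n, IsWalkEnd G root n i := by
      intro i
      induction h i with
      | refl => exact ⟨0, rfl⟩
      | tail _ hji ih =>
        obtain ⟨n, hn⟩ := ih
        exact ⟨n + 1, _, hn, hji⟩
    -- The parent is the last predecessor on a shortest walk from the root; the strict decrease of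
    -- distance rules out cycles.
    have hpar : ∀ i : V, i ≠ root → ∃ j : V, G.Adj j i ∧ Nat.find (hwalk j) < Nat.find (hwalk i) := by
      intro i hi
      have hspec := Nat.find_spec (hwalk i)
      rcases hn : Nat.find (hwalk i) with _ | n
      · rw [hn] at hspec
        exact absurd hspec hi
      · rw [hn] at hspec
        obtain ⟨j, hj, hji⟩ := hspec
        exact ⟨j, hji, by have := Nat.find_min' (hwalk j) hj; omega⟩
    choose! parent hadj hlt using hpar
    refine ⟨⟨fun j i => i ≠ root ∧ j = parent i⟩, ?_, ?_, ?_, ?_⟩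
    · rintro i j ⟨hj, rfl⟩
      exact hadj j hj
    · rintro j ⟨h0, _⟩
      exact h0 rfl
    · exact fun i hi => ⟨parent i, ⟨hi, rfl⟩, fun j hj => hj.2⟩
    · have key : ∀ n i, Nat.find (hwalk i) ≤ n →
          Relation.ReflTransGen (fun j i => i ≠ root ∧ j = parent i) root i := by
        intro n
        induction n with
        | zero =>
          intro i hi
          by_cases hir : i = root
          · rw [hir]
          · exact absurd (hlt i hir) (by omega)
        | succ n ih =>
          intro i hi
          by_cases hir : i = root
          · rw [hir]
          · have := hlt i hir
            exact (ih (parent i) (by omega)).tail ⟨hir, rfl⟩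
      exact fun i => key _ i le_rfl

variable {N : ℕ}

/-- The Laplacian of the digraph restricted to the followers. -/
def followerLap (a : Matrix (Fin (N + 1)) (Fin (N + 1)) ℝ) : Matrix (Fin N) (Fin N) ℝ :=
  Matrix.diagonal (fun i => ∑ k, a i.succ k) - a.submatrix Fin.succ Fin.succ

/-- Only differences occur, so all vectors may be measured from `s 0`; the term of the leader then
drops out. -/
theorem sum_smul_sub_eq_followerLap {V : Type*} [AddCommGroup V] [Module ℝ V]
    (a : Matrix (Fin (N + 1)) (Fin (N + 1)) ℝ) (s : Fin (N + 1) → V) (i : Fin N) :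
    ∑ j, a i.succ j • (s i.succ - s j) = ∑ j, followerLap a i j • (s j.succ - s 0) := by
  have h1 : ∀ j, a i.succ j • (s i.succ - s j) =
      a i.succ j • (s i.succ - s 0) - a i.succ j • (s j - s 0) := fun j => by
    rw [← smul_sub]; congr 1; abel
  simp only [h1, Finset.sum_sub_distrib, ← Finset.sum_smul, followerLap, Matrix.sub_apply, sub_smul,
    Matrix.diagonal_apply, Matrix.submatrix_apply, ite_smul, zero_smul, Finset.sum_ite_eq,
    Finset.mem_univ, if_true]
  congr 1
  rw [Fin.sum_univ_succ, sub_self, smul_zero, zero_add]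

theorem relSum_eq {k : ℕ} (a : Matrix (Fin (N + 1)) (Fin (N + 1)) ℝ) (s : Fin (N + 1) → Fin k → ℝ)
    (i : Fin N) : relSum a s i = ∑ j, followerLap a i j • (s j.succ - s 0) :=
  sum_smul_sub_eq_followerLap a s i

variable {G : Digraph (Fin (N + 1))} {a : Matrix (Fin (N + 1)) (Fin (N + 1)) ℝ}

/-- A maximum principle. Extend an eigenvector by zero at the leader and multiply the row of a node
of maximal modulus by the conjugate of its entry: every summand has nonnegative real part. If Re μ ≤
0, all in-neighbours also have maximal modulus, and this propagates back along a path to the leader,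
where the entry is zero. -/
theorem re_pos_of_mem_spectrum_followerLap (ha : IsWeightedAdjacency G a)
    (hG : ∀ i, Relation.ReflTransGen G.Adj 0 i) {μ : ℂ} (hμ : μ ∈ spectrum ℂ (cx (followerLap a))) :
    0 < μ.re := by
  obtain ⟨h, h0, hh⟩ := mem_spectrum_iff_exists_mulVec.1 hμ
  obtain ⟨i₁, hi₁⟩ := Function.ne_iff.1 h0
  have : Nonempty (Fin N) := ⟨i₁⟩
  obtain ⟨i₀, hi₀⟩ := Finite.exists_max fun i => ‖h i‖
  set m := ‖h i₀‖ with hm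
  have hm0 : 0 < m := (norm_pos_iff.2 hi₁).trans_le (hi₀ i₁)
  let g : Fin (N + 1) → ℂ := Fin.cons 0 h
  have hg : ∀ k, ‖g k‖ ≤ m := by
    intro k
    refine Fin.cases ?_ (fun i => ?_) k
    · simpa [g] using hm0.le
    · simpa [g] using hi₀ i
  have heq : ∀ i, μ * h i = ∑ k, (a i.succ k : ℂ) * (h i - g k) := by
    intro i
    have h1 := sum_smul_sub_eq_followerLap a g i
    have h2 : (cx (followerLap a) *ᵥ h) i = μ * h i := by rw [hh]; rfl
    rw [← h2]
    simp only [Complex.real_smul, g, Fin.cons_succ, Fin.cons_zero, sub_zero] at h1 ⊢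
    rw [h1]
    simp [Matrix.mulVec, dotProduct]
  by_contra! hre
  have hprop : ∀ i k, ‖h i‖ = m → 0 < a i.succ k → m ≤ ‖g k‖ := by
    intro i k hi hk
    have h1 : μ * (m ^ 2 : ℝ) = ∑ k, (a i.succ k : ℂ) * ((m ^ 2 : ℝ) - star (h i) * g k) := by
      have h2 : star (h i) * h i = (m ^ 2 : ℝ) := by
        rw [Complex.star_def, Complex.conj_mul', hi]; push_cast; rfl
      rw [← h2]
      calc μ * (star (h i) * h i) = star (h i) * (μ * h i) := by ring
        _ = _ := by
          rw [heq, Finset.mul_sum]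
          exact Finset.sum_congr rfl fun k _ => by ring
    have h3 := congrArg Complex.re h1
    rw [Complex.re_mul_ofReal, Complex.re_sum] at h3
    have hterm : ∀ k, a i.succ k * (m ^ 2 - m * ‖g k‖) ≤
        ((a i.succ k : ℂ) * ((m ^ 2 : ℝ) - star (h i) * g k)).re := by
      intro k
      rw [Complex.re_ofReal_mul, Complex.sub_re, Complex.ofReal_re]
      refine mul_le_mul_of_nonneg_left (sub_le_sub_left ?_ _) (ha.nonneg _ _)
      refine (Complex.re_le_norm _).trans ?_
      rw [norm_mul, norm_star, hi]
    have hterm0 : ∀ k, 0 ≤ a i.succ k * (m ^ 2 - m * ‖g k‖) := by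
      intro k
      refine mul_nonneg (ha.nonneg _ _) ?_
      nlinarith [hg k]
    have h4 : a i.succ k * (m ^ 2 - m * ‖g k‖) ≤ 0 := by
      refine (Finset.single_le_sum (f := fun k => a i.succ k * (m ^ 2 - m * ‖g k‖))
        (fun k _ => hterm0 k) (Finset.mem_univ k)).trans ?_
      refine (Finset.sum_le_sum fun k _ => hterm k).trans ?_
      rw [← h3]
      exact mul_nonpos_of_nonpos_of_nonneg hre (sq_nonneg _)
    have h5 : m ^ 2 - m * ‖g k‖ ≤ 0 := nonpos_of_mul_nonpos_right h4 hk
    by_contra! hlt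
    nlinarith
  have hfalse : ∀ k, Relation.ReflTransGen G.Adj 0 k → m ≤ ‖g k‖ → False := by
    intro k hk
    induction hk with
    | refl => intro h; simp [g] at h; linarith
    | @tail j k _ hjk ih =>
      intro hk
      refine Fin.cases (fun h _ => ?_) (fun i hi hji => ?_) k hk hjk
      · simp [g] at h; linarith
      · refine ih (hprop i j (le_antisymm (hi₀ i) ?_) ((ha.pos_iff _ _).2 hji))
        simpa [g] using hi
  exact hfalse i₀.succ (hG _) (by simp [g, hm])

/-- The real parts of the eigenvalues of the Laplacian of the followers are bounded away from zero,
and their moduli are bounded. -/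
theorem exists_bounds_spectrum_followerLap (ha : IsWeightedAdjacency G a)
    (hG : ∀ i, Relation.ReflTransGen G.Adj 0 i) :
    ∃ c b : ℝ, 0 < c ∧ ∀ μ ∈ spectrum ℂ (cx (followerLap a)), c ≤ μ.re ∧ ‖μ‖ ≤ b := by
  have hfin : (spectrum ℂ (cx (followerLap a))).Finite := Matrix.finite_spectrum _
  obtain ⟨b, hb⟩ := hfin.isBounded.exists_norm_le
  rcases (spectrum ℂ (cx (followerLap a))).eq_empty_or_nonempty with he | hne
  · exact ⟨1, 0, one_pos, by simp [he]⟩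
  · obtain ⟨μ₀, hμ₀, hmin⟩ := Set.exists_min_image _ Complex.re hfin hne
    exact ⟨μ₀.re, b, re_pos_of_mem_spectrum_followerLap ha hG hμ₀, fun μ hμ => ⟨hmin μ hμ, hb μ hμ⟩⟩

/-- If some node is not reachable from the leader, then the Laplacian of the followers is singular. -/
theorem exists_vecMul_followerLap_eq_zero (ha : IsWeightedAdjacency G a)
    (hG : ¬ ∀ i, Relation.ReflTransGen G.Adj 0 i) :
    ∃ l : Fin N → ℝ, l ≠ 0 ∧ l ᵥ* followerLap a = 0 := by
  classical
  let U : Fin N → Prop := fun i => ¬ Relation.ReflTransGen G.Adj 0 i.succ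
  obtain ⟨i₀, hi₀⟩ : ∃ i, U i := by
    by_contra! hcon
    refine hG fun i => Fin.cases .refl (fun i => ?_) i
    simpa [U] using hcon i
  have hzero : ∀ i k, U i → Relation.ReflTransGen G.Adj 0 k → a i.succ k = 0 := by
    intro i k hi hk
    by_contra hne
    exact hi (hk.tail ((ha.pos_iff _ _).1 ((ha.nonneg _ _).lt_of_ne' hne)))
  -- The indicator of the unreachable set is annihilated by the rows of unreachable followers only,
  -- so the other rows are replaced by identity rows. A left null vector of `M` is supported on the
  -- unreachable set, where the rows of `M` are those of the Laplacian.
  let M : Matrix (Fin N) (Fin N) ℝ := Matrix.of fun i j =>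
    if U i then followerLap a i j else (1 : Matrix (Fin N) (Fin N) ℝ) i j
  have hM : M *ᵥ (fun j => if U j then 1 else 0) = 0 := by
    funext i
    simp only [Matrix.mulVec, dotProduct, M, Matrix.of_apply, Pi.zero_apply]
    by_cases hi : U i
    · have h1 := sum_smul_sub_eq_followerLap a (Fin.cons 0 fun j => if U j then (1 : ℝ) else 0) i
      simp only [Fin.cons_succ, Fin.cons_zero, sub_zero, smul_eq_mul] at h1
      simp only [hi, if_true]
      rw [← h1]
      refine Finset.sum_eq_zero fun k _ => ?_
      by_cases hk : Relation.ReflTransGen G.Adj 0 k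
      · rw [hzero i k hi hk, zero_mul]
      · refine Fin.cases (fun h => absurd .refl h) (fun j hj => ?_) k hk
        have : U j := hj
        simp [hi, this]
    · refine Finset.sum_eq_zero fun j _ => ?_
      by_cases hj : U j
      · simp [hi, show i ≠ j from fun h => hi (h ▸ hj)]
      · simp [hj]
  obtain ⟨l, hl0, hl⟩ := Matrix.exists_vecMul_eq_zero_iff.2 (Matrix.exists_mulVec_eq_zero_iff.1
    ⟨_, fun h => by simpa [hi₀] using congrFun h i₀, hM⟩)
  have hlap : ∀ i j, U i → ¬ U j → followerLap a i j = 0 := by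
    intro i j hi hj
    have hne : i ≠ j := fun h => hj (h ▸ hi)
    simp [followerLap, hne, hzero i j.succ hi (not_not.1 hj)]
  have hsupp : ∀ j, ¬ U j → l j = 0 := by
    intro j hj
    have h1 := congrFun hl j
    simp only [Matrix.vecMul, dotProduct, Pi.zero_apply] at h1
    rw [Finset.sum_eq_single j] at h1
    · simpa [M, hj] using h1
    · intro i _ hij
      by_cases hi : U i
      · simp [M, hi, hlap i j hi hj]
      · simp [M, hi, hij]
    · simp
  refine ⟨l, hl0, ?_⟩
  rw [← hl]
  funext j
  simp only [Matrix.vecMul, dotProduct]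
  refine Finset.sum_congr rfl fun i _ => ?_
  by_cases hi : U i
  · simp [M, hi]
  · simp [hsupp i hi]

end Graph

/-! ### Internal models -/

section InternalModel

theorem eq_zero_of_transpose_mulVec_eq_zero {K ι κ : Type*} [Field K] [Fintype ι] [Fintype κ]
    {M : Matrix ι κ K} (hM : M.rank = Fintype.card ι) {v : ι → K} (hv : Mᵀ *ᵥ v = 0) : v = 0 := by
  have h1 := LinearMap.finrank_range_add_finrank_ker Mᵀ.mulVecLin
  have h2 : Mᵀ.rank = Fintype.card ι := (Matrix.rank_transpose M).trans hM
  rw [Matrix.rank] at h2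
  rw [h2, Module.finrank_fintype_fun_eq_card, Nat.add_eq_left, Submodule.finrank_eq_zero] at h1
  have : v ∈ LinearMap.ker Mᵀ.mulVecLin := hv
  rwa [h1, Submodule.mem_bot] at this

theorem mulVec_re_im_eq_zero {ι κ : Type*} [Fintype κ] {M : Matrix ι κ ℝ} {v : κ → ℂ}
    (hv : cx M *ᵥ v = 0) : M *ᵥ (fun i => (v i).re) = 0 ∧ M *ᵥ (fun i => (v i).im) = 0 := by
  constructor <;> funext i
  · have := congrArg Complex.re (congrFun hv i)
    simpa [Matrix.mulVec, dotProduct] using this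
  · have := congrArg Complex.im (congrFun hv i)
    simpa [Matrix.mulVec, dotProduct] using this

theorem Stabilizable.hautus {n m : ℕ} {A : Matrix (Fin n) (Fin n) ℝ} {B : Matrix (Fin n) (Fin m) ℝ}
    (h : Stabilizable A B) : Hautus A B := by
  obtain ⟨K, hK⟩ := h
  intro μ ξ hμ hA hB
  by_contra h0
  refine absurd (hK μ (mem_spectrum_iff_exists_transpose_mulVec.2 ⟨ξ, h0, ?_⟩)) (not_lt.2 hμ)
  change (cx (A + B * K))ᵀ *ᵥ ξ = _
  rw [cx_add, cx_mul, Matrix.transpose_add, Matrix.transpose_mul, Matrix.add_mulVec, hA,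
    ← Matrix.mulVec_mulVec, hB, Matrix.mulVec_zero, add_zero]

theorem Detectable.hautus {n p : ℕ} {A : Matrix (Fin n) (Fin n) ℝ} {C : Matrix (Fin p) (Fin n) ℝ}
    (h : Detectable C A) : Hautus Aᵀ Cᵀ := by
  obtain ⟨L, hL⟩ := h
  intro μ ξ hμ hA hC
  rw [← cx_transpose, Matrix.transpose_transpose] at hA hC
  by_contra h0
  refine absurd (hL μ (mem_spectrum_iff_exists_mulVec.2 ⟨ξ, h0, ?_⟩)) (not_lt.2 hμ)
  change cx (A - L * C) *ᵥ ξ = _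
  rw [cx_sub, cx_mul, Matrix.sub_mulVec, hA, ← Matrix.mulVec_mulVec, hC, Matrix.mulVec_zero, sub_zero]

variable {p q d : ℕ}

/-- The Hautus direction of controllability: such a vector annihilates every column of the real
controllability matrix, hence so do its real and imaginary parts. -/
theorem Controllable.eq_zero {β : Matrix (Fin d) (Fin d) ℝ} {σ : Matrix (Fin d) (Fin 1) ℝ}
    (h : Controllable β σ) {μ : ℂ} {ξ : Fin d → ℂ} (hβ : (cx β)ᵀ *ᵥ ξ = μ • ξ)
    (hσ : (cx σ)ᵀ *ᵥ ξ = 0) : ξ = 0 := by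
  have hrank : (controllabilityMatrix β σ).rank = Fintype.card (Fin d) := by
    rw [Fintype.card_fin]; exact h
  have hpow : ∀ k : ℕ, (cx β)ᵀ ^ k *ᵥ ξ = μ ^ k • ξ := by
    intro k
    induction k with
    | zero => simp
    | succ k ih => rw [pow_succ', ← Matrix.mulVec_mulVec, ih, Matrix.mulVec_smul, hβ, smul_smul, pow_succ]
  have hzero : cx (controllabilityMatrix β σ)ᵀ *ᵥ ξ = 0 := by
    funext kj
    have h1 : (cx (β ^ (kj.1 : ℕ) * σ))ᵀ *ᵥ ξ = 0 := by
      rw [cx_mul, cx_pow, Matrix.transpose_mul, ← Matrix.mulVec_mulVec, Matrix.transpose_pow, hpow,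
        Matrix.mulVec_smul, hσ, smul_zero]
    exact congrFun h1 kj.2
  obtain ⟨h1, h2⟩ := mulVec_re_im_eq_zero hzero
  funext i
  exact Complex.ext (congrFun (eq_zero_of_transpose_mulVec_eq_zero hrank h1) i)
    (congrFun (eq_zero_of_transpose_mulVec_eq_zero hrank h2) i)

/-- A functional dual to the last column of the controllability matrix of a single-input pair. -/
theorem Controllable.exists_dual {β : Matrix (Fin d) (Fin d) ℝ} {σ : Matrix (Fin d) (Fin 1) ℝ}
    (h : Controllable β σ) :
    ∃ φ : Fin d → ℝ, ∀ k < d, φ ⬝ᵥ (β ^ k *ᵥ σ.col 0) = if k + 1 = d then 1 else 0 := by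
  have hrank : (controllabilityMatrix β σ).rank = Fintype.card (Fin d) := by
    rw [Fintype.card_fin]; exact h
  have hinj : Function.Injective (controllabilityMatrix β σ)ᵀ.mulVecLin :=
    (injective_iff_map_eq_zero _).2 fun v hv => eq_zero_of_transpose_mulVec_eq_zero hrank hv
  have hsurj := (LinearMap.injective_iff_surjective_of_finrank_eq_finrank (by simp)).1 hinj
  obtain ⟨φ, hφ⟩ := hsurj fun kj => if (kj.1 : ℕ) + 1 = d then 1 else 0
  refine ⟨φ, fun k hk => ?_⟩
  rw [← congrFun hφ (⟨k, hk⟩, 0), dotProduct_comm]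
  rfl

open Polynomial in
/-- If the characteristic polynomial of `β`, in the forward shift, annihilates the state of a
controllable single-input internal model asymptotically, then the input of the model vanishes
asymptotically. -/
theorem Controllable.tendsto_zero {β : Matrix (Fin d) (Fin d) ℝ} {σ : Matrix (Fin d) (Fin 1) ℝ}
    (h : Controllable β σ) (hd : 0 < d) {z : ℕ → Fin d → ℝ} {e : ℕ → ℝ}
    (hz : ∀ t, z (t + 1) = β *ᵥ z t + e t • σ.col 0)
    (hlim : Filter.Tendsto (fun t => ∑ k ∈ Finset.range (d + 1), β.charpoly.coeff k • z (t + k))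
      Filter.atTop (𝓝 0)) :
    Filter.Tendsto e Filter.atTop (𝓝 0) := by
  obtain ⟨φ, hφ⟩ := h.exists_dual
  have hsol : ∀ t k, z (t + k) = β ^ k *ᵥ z t +
      ∑ j ∈ Finset.range k, e (t + j) • (β ^ (k - 1 - j) *ᵥ σ.col 0) := by
    intro t k
    induction k with
    | zero => simp
    | succ k ih =>
      rw [← add_assoc, hz, ih, Matrix.mulVec_add, Matrix.mulVec_mulVec, ← pow_succ', add_assoc,
        Finset.sum_range_succ, Matrix.mulVec_sum]
      congr 2
      · refine Finset.sum_congr rfl fun j hj => ?_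
        have : k + 1 - 1 - j = (k - 1 - j) + 1 := by
          have := Finset.mem_range.1 hj; omega
        rw [Matrix.mulVec_smul, Matrix.mulVec_mulVec, this, pow_succ']
      · simp
  have hcoeff : β.charpoly.coeff d = 1 := by
    have h1 := β.charpoly_monic.coeff_natDegree
    rwa [Matrix.charpoly_natDegree_eq_dim, Fintype.card_fin] at h1
  have hch : ∀ v, ∑ k ∈ Finset.range (d + 1), β.charpoly.coeff k • (β ^ k *ᵥ v) = 0 := by
    intro v
    have h1 := Matrix.aeval_self_charpoly β
    rw [Polynomial.aeval_eq_sum_range, Matrix.charpoly_natDegree_eq_dim, Fintype.card_fin] at h1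
    have h2 := congrArg (fun M => M *ᵥ v) h1
    simpa only [Matrix.sum_mulVec, Matrix.smul_mulVec, Matrix.zero_mulVec] using h2
  -- The input is recovered exactly. Cayley-Hamilton removes the contribution of `z t`, and `φ`
  -- detects only β^(d-1)σ, which occurs just for `k = d`, `j = 0`, with leading coefficient one.
  have he : ∀ t, φ ⬝ᵥ (∑ k ∈ Finset.range (d + 1), β.charpoly.coeff k • z (t + k)) = e t := by
    intro t
    have h1 : ∑ k ∈ Finset.range (d + 1), β.charpoly.coeff k • z (t + k) =
        ∑ k ∈ Finset.range (d + 1), β.charpoly.coeff k •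
          ∑ j ∈ Finset.range k, e (t + j) • (β ^ (k - 1 - j) *ᵥ σ.col 0) := by
      simp only [hsol t, smul_add, Finset.sum_add_distrib, hch, zero_add]
    have h2 : ∀ k ≤ d, φ ⬝ᵥ (∑ j ∈ Finset.range k, e (t + j) • (β ^ (k - 1 - j) *ᵥ σ.col 0)) =
        if k = d then e t else 0 := by
      intro k hk
      rw [dotProduct_sum]
      have h3 : ∀ j ∈ Finset.range k, φ ⬝ᵥ (e (t + j) • (β ^ (k - 1 - j) *ᵥ σ.col 0)) =
          if k = d ∧ j = 0 then e t else 0 := by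
        intro j hj
        have hj' := Finset.mem_range.1 hj
        rw [dotProduct_smul, hφ _ (by omega), smul_eq_mul]
        by_cases hc : k = d ∧ j = 0
        · rw [if_pos (by omega), if_pos hc, hc.2, add_zero, mul_one]
        · rw [if_neg (by omega), if_neg hc, mul_zero]
      rw [Finset.sum_congr rfl h3]
      by_cases hkd : k = d
      · have : 0 < k := by omega
        simp [hkd, hd]
      · simp [hkd]
    rw [h1, dotProduct_sum, Finset.sum_range_succ, Finset.sum_eq_zero, zero_add, dotProduct_smul,
      h2 d le_rfl, if_pos rfl, hcoeff, one_smul]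
    intro k hk
    have hk' := Finset.mem_range.1 hk
    rw [dotProduct_smul, h2 k hk'.le, if_neg hk'.ne, smul_zero]
  have hcont : Continuous fun v : Fin d → ℝ => φ ⬝ᵥ v := by fun_prop
  have h4 := (hcont.tendsto 0).comp hlim
  rw [dotProduct_zero] at h4
  exact h4.congr he

/-! ### Blockwise action of the p-fold Kronecker copies. -/

section Copies

variable {β : Matrix (Fin d) (Fin d) ℝ} {σ : Matrix (Fin d) (Fin 1) ℝ}

theorem kronecker_one_mulVec_apply {R : Type*} [CommSemiring R] (β : Matrix (Fin d) (Fin d) R)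
    (z : Fin p × Fin d → R) (k : Fin p) (l : Fin d) :
    (((1 : Matrix (Fin p) (Fin p) R) ⊗ₖ β) *ᵥ z) (k, l) = (β *ᵥ fun l => z (k, l)) l := by
  simp [Matrix.mulVec, dotProduct, Fintype.sum_prod_type, Matrix.kroneckerMap_apply,
    Matrix.one_apply]

theorem kronecker_one_col_mulVec_apply {R : Type*} [CommSemiring R] (σ : Matrix (Fin d) (Fin 1) R)
    (e : Fin p → R) (k : Fin p) (l : Fin d) :
    ((((1 : Matrix (Fin p) (Fin p) R) ⊗ₖ σ).submatrix id fun k => (k, 0)) *ᵥ e) (k, l) =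
      e k * σ l 0 := by
  simp [Matrix.mulVec, dotProduct, Matrix.kroneckerMap_apply, Matrix.one_apply, mul_comm]

theorem kronecker_one_col_transpose_mulVec_apply {R : Type*} [CommSemiring R]
    (σ : Matrix (Fin d) (Fin 1) R) (z : Fin p × Fin d → R) (k : Fin p) :
    ((((1 : Matrix (Fin p) (Fin p) R) ⊗ₖ σ).submatrix id fun k => (k, 0))ᵀ *ᵥ z) k =
      (σᵀ *ᵥ fun l => z (k, l)) 0 := by
  simp [Matrix.mulVec, dotProduct, Matrix.kroneckerMap_apply, Matrix.one_apply,
    Fintype.sum_prod_type]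

theorem cx_kronecker_one : cx ((1 : Matrix (Fin p) (Fin p) ℝ) ⊗ₖ β) = 1 ⊗ₖ cx β := by
  ext ⟨k, l⟩ ⟨k', l'⟩
  by_cases h : k = k' <;> simp [Matrix.kroneckerMap_apply, h]

theorem cx_kronecker_one_col :
    cx (((1 : Matrix (Fin p) (Fin p) ℝ) ⊗ₖ σ).submatrix id fun k => (k, 0)) =
      (((1 : Matrix (Fin p) (Fin p) ℂ) ⊗ₖ cx σ).submatrix id fun k => (k, 0)) := by
  ext ⟨k, l⟩ k'
  by_cases h : k = k' <;> simp [Matrix.kroneckerMap_apply, h]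

end Copies

variable {S : Matrix (Fin q) (Fin q) ℝ} {G₁ : Matrix (Fin p × Fin d) (Fin p × Fin d) ℝ}
  {G₂ : Matrix (Fin p × Fin d) (Fin p) ℝ}

theorem mem_eigs_of_mem_spectrum {β : Matrix (Fin d) (Fin d) ℝ} (hβ : β.charpoly = minpoly ℝ S)
    {μ : ℂ} (hμ : μ ∈ spectrum ℂ (cx β)) : μ ∈ eigs S := by
  rw [mem_spectrum_iff_isRoot_charpoly, Matrix.charpoly_map, hβ] at hμ
  refine mem_spectrum_iff_isRoot_charpoly.2 ?_
  rw [Matrix.charpoly_map]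
  exact hμ.dvd (Polynomial.map_dvd _ (Matrix.minpoly_dvd_charpoly S))

theorem pos_of_charpoly_eq_minpoly {β : Matrix (Fin d) (Fin d) ℝ} (hq : 0 < q)
    (hβ : β.charpoly = minpoly ℝ S) : 0 < d := by
  have : Nonempty (Fin q) := ⟨⟨0, hq⟩⟩
  have h1 := minpoly.natDegree_pos (Matrix.isIntegral S)
  rwa [← hβ, Matrix.charpoly_natDegree_eq_dim, Fintype.card_fin] at h1

theorem IsMinimalPCopyInternalModel.mem_eigs (hG : IsMinimalPCopyInternalModel S G₁ G₂) {μ : ℂ}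
    {ζ : Fin p × Fin d → ℂ} (hζ : (cx G₁)ᵀ *ᵥ ζ = μ • ζ) (h0 : ζ ≠ 0) : μ ∈ eigs S := by
  obtain ⟨β, σ, hβ, _, rfl, _⟩ := hG
  obtain ⟨⟨k, l⟩, hkl⟩ := Function.ne_iff.1 h0
  refine mem_eigs_of_mem_spectrum hβ (mem_spectrum_iff_exists_transpose_mulVec.2
    ⟨fun l => ζ (k, l), fun h => hkl (congrFun h l), ?_⟩)
  funext l
  have h1 := congrFun hζ (k, l)
  rwa [cx_kronecker_one, ← Matrix.kroneckerMap_transpose, Matrix.transpose_one,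
    kronecker_one_mulVec_apply] at h1

theorem IsMinimalPCopyInternalModel.eq_zero (hG : IsMinimalPCopyInternalModel S G₁ G₂) {μ : ℂ}
    {ζ : Fin p × Fin d → ℂ} (hζ : (cx G₁)ᵀ *ᵥ ζ = μ • ζ) (h0 : (cx G₂)ᵀ *ᵥ ζ = 0) : ζ = 0 := by
  obtain ⟨β, σ, hβ, hc, rfl, rfl⟩ := hG
  funext ⟨k, l⟩
  refine congrFun (hc.eq_zero (μ := μ) (ξ := fun l => ζ (k, l)) ?_ ?_) l
  · funext l
    have h1 := congrFun hζ (k, l)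
    rwa [cx_kronecker_one, ← Matrix.kroneckerMap_transpose, Matrix.transpose_one,
      kronecker_one_mulVec_apply] at h1
  · funext j
    have h1 := congrFun h0 k
    rw [cx_kronecker_one_col, kronecker_one_col_transpose_mulVec_apply] at h1
    rwa [Subsingleton.elim j 0]

/-- The internal model has a mode of modulus one. -/
theorem IsMinimalPCopyInternalModel.exists_mode (hG : IsMinimalPCopyInternalModel S G₁ G₂)
    (hp : 0 < p) (hq : 0 < q) :
    ∃ μ ∈ eigs S, ∃ ζ : Fin p × Fin d → ℂ, ζ ≠ 0 ∧ (cx G₁)ᵀ *ᵥ ζ = μ • ζ := by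
  obtain ⟨β, σ, hβ, hc, rfl, rfl⟩ := hG
  have hd := pos_of_charpoly_eq_minpoly hq hβ
  have : Nonempty (Fin d) := ⟨⟨0, hd⟩⟩
  obtain ⟨μ, hμ⟩ := spectrum.nonempty_of_isAlgClosed_of_finiteDimensional ℂ (cx β)
  obtain ⟨ξ, hξ0, hξ⟩ := mem_spectrum_iff_exists_transpose_mulVec.1 hμ
  obtain ⟨l, hl⟩ := Function.ne_iff.1 hξ0
  refine ⟨μ, mem_eigs_of_mem_spectrum hβ hμ, fun kl => ξ kl.2,
    fun h => hl (congrFun h (⟨0, hp⟩, l)), ?_⟩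
  funext ⟨k, l⟩
  rw [cx_kronecker_one, ← Matrix.kroneckerMap_transpose, Matrix.transpose_one,
    kronecker_one_mulVec_apply]
  exact congrFun hξ l

/-- If the minimal polynomial of `S`, in the forward shift, annihilates the state of the internal
model asymptotically, then the input of the internal model vanishes asymptotically. -/
theorem IsMinimalPCopyInternalModel.tendsto_zero (hG : IsMinimalPCopyInternalModel S G₁ G₂)
    (hq : 0 < q) {z : ℕ → Fin p × Fin d → ℝ} {e : ℕ → Fin p → ℝ}
    (hz : ∀ t, z (t + 1) = G₁ *ᵥ z t + G₂ *ᵥ e t)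
    (hlim : Filter.Tendsto (fun t => ∑ k ∈ Finset.range ((minpoly ℝ S).natDegree + 1),
      (minpoly ℝ S).coeff k • z (t + k)) Filter.atTop (𝓝 0)) :
    Filter.Tendsto e Filter.atTop (𝓝 0) := by
  obtain ⟨β, σ, hβ, hc, rfl, rfl⟩ := hG
  rw [← hβ, Matrix.charpoly_natDegree_eq_dim, Fintype.card_fin] at hlim
  refine tendsto_pi_nhds.2 fun k => hc.tendsto_zero (pos_of_charpoly_eq_minpoly hq hβ)
    (z := fun t l => z t (k, l)) (e := fun t => e t k) (fun t => ?_) ?_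
  · funext l
    rw [hz, Pi.add_apply, kronecker_one_mulVec_apply, kronecker_one_col_mulVec_apply]
    rfl
  · refine tendsto_pi_nhds.2 fun l => ?_
    have h1 := tendsto_pi_nhds.1 hlim (k, l)
    simpa [Finset.sum_apply] using h1

variable {n m : ℕ} {A : Matrix (Fin n) (Fin n) ℝ} {B : Matrix (Fin n) (Fin m) ℝ}
  {C : Matrix (Fin p) (Fin n) ℝ}

/-- The plant augmented by the internal model: state matrix. -/
abbrev augA (A : Matrix (Fin n) (Fin n) ℝ) (C : Matrix (Fin p) (Fin n) ℝ)
    (G₁ : Matrix (Fin p × Fin d) (Fin p × Fin d) ℝ) (G₂ : Matrix (Fin p × Fin d) (Fin p) ℝ) :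
    Matrix (Fin n ⊕ Fin p × Fin d) (Fin n ⊕ Fin p × Fin d) ℝ :=
  Matrix.fromBlocks A 0 (G₂ * C) G₁

/-- The plant augmented by the internal model: input matrix. -/
abbrev augB (p d : ℕ) (B : Matrix (Fin n) (Fin m) ℝ) : Matrix (Fin n ⊕ Fin p × Fin d) (Fin m) ℝ :=
  Matrix.fromRows B 0

theorem augA_transpose_mulVec {μ : ℂ} {ξ : Fin n ⊕ Fin p × Fin d → ℂ}
    (h : (cx (augA A C G₁ G₂))ᵀ *ᵥ ξ = μ • ξ) :
    (cx A)ᵀ *ᵥ (ξ ∘ Sum.inl) + (cx C)ᵀ *ᵥ ((cx G₂)ᵀ *ᵥ (ξ ∘ Sum.inr)) = μ • (ξ ∘ Sum.inl) ∧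
      (cx G₁)ᵀ *ᵥ (ξ ∘ Sum.inr) = μ • (ξ ∘ Sum.inr) := by
  rw [cx, Matrix.fromBlocks_map, Matrix.fromBlocks_transpose, Matrix.fromBlocks_mulVec] at h
  constructor
  · funext i
    have h1 := congrFun h (Sum.inl i)
    rw [Sum.elim_inl] at h1
    rw [Matrix.mulVec_mulVec, ← Matrix.transpose_mul, ← cx_mul]
    exact h1
  · funext i
    have h1 := congrFun h (Sum.inr i)
    rw [Sum.elim_inr, Matrix.map_zero _ (map_zero _), Matrix.transpose_zero, Matrix.zero_mulVec,
      zero_add] at h1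
    exact h1

/-- If the internal-model part ζ of a left eigenvector is nonzero, then `μ` is an eigenvalue of `S`,
and the plant part together with G₂ᵀζ is a left null vector of the matrix in the transmission zero
condition. Hence G₂ᵀζ = 0, and controllability gives ζ = 0. What remains is the Hautus test of the
plant. -/
theorem hautus_aug (hAB : Hautus A B) (hzero : TransmissionZeroCondition A B C S)
    (hG : IsMinimalPCopyInternalModel S G₁ G₂) : Hautus (augA A C G₁ G₂) (augB p d B) := by
  intro μ ξ hμ hA hB
  obtain ⟨h1, h2⟩ := augA_transpose_mulVec hA
  have hB' : (cx B)ᵀ *ᵥ (ξ ∘ Sum.inl) = 0 := by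
    have h3 : cx (augB p d B) = Matrix.fromRows (cx B) 0 := by
      ext (i | i) j <;> simp
    rw [h3, Matrix.transpose_fromRows, Matrix.fromCols_mulVec, Matrix.transpose_zero,
      Matrix.zero_mulVec, add_zero] at hB
    exact hB
  have hinr : ξ ∘ Sum.inr = 0 := by
    by_contra h0
    have h3 := eq_zero_of_transpose_mulVec_eq_zero
      (v := Sum.elim (ξ ∘ Sum.inl) ((cx G₂)ᵀ *ᵥ (ξ ∘ Sum.inr)))
      ((hzero μ (hG.mem_eigs h2 h0)).trans (by simp)) (by
        rw [Matrix.fromBlocks_transpose, Matrix.fromBlocks_mulVec, Sum.elim_comp_inl,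
          Sum.elim_comp_inr, Matrix.transpose_sub, Matrix.sub_mulVec, Matrix.transpose_smul,
          Matrix.transpose_one, Matrix.smul_mulVec, Matrix.one_mulVec, Matrix.transpose_zero,
          Matrix.zero_mulVec, add_zero, hB', ← h1, sub_add_eq_add_sub, sub_self]
        funext i
        rcases i with i | i <;> rfl)
    refine h0 (hG.eq_zero h2 ?_)
    rw [← Sum.elim_comp_inr (ξ ∘ Sum.inl) ((cx G₂)ᵀ *ᵥ (ξ ∘ Sum.inr)), h3]
    rfl
  have hinl : ξ ∘ Sum.inl = 0 := by
    rw [hinr, Matrix.mulVec_zero, Matrix.mulVec_zero, add_zero] at h1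
    exact hAB μ _ hμ h1 hB'
  funext i
  rcases i with i | i
  · exact congrFun hinl i
  · exact congrFun hinr i

theorem norm_le_one_of_mem_spectrum_aug (hA : ∀ μ ∈ eigs A, ‖μ‖ ≤ 1) (hS : ∀ μ ∈ eigs S, ‖μ‖ = 1)
    (hG : IsMinimalPCopyInternalModel S G₁ G₂) {μ : ℂ}
    (hμ : μ ∈ spectrum ℂ (cx (augA A C G₁ G₂))) : ‖μ‖ ≤ 1 := by
  obtain ⟨ξ, hξ0, hξ⟩ := mem_spectrum_iff_exists_transpose_mulVec.1 hμ
  obtain ⟨h1, h2⟩ := augA_transpose_mulVec hξ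
  by_cases hinr : ξ ∘ Sum.inr = 0
  · rw [hinr, Matrix.mulVec_zero, Matrix.mulVec_zero, add_zero] at h1
    refine hA μ (mem_spectrum_iff_exists_transpose_mulVec.2 ⟨_, fun hinl => hξ0 ?_, h1⟩)
    funext i
    rcases i with i | i
    · exact congrFun hinl i
    · exact congrFun hinr i
  · exact (hS μ (hG.mem_eigs h2 hinr)).le

end InternalModel

/-! ### The closed loop as a linear system with one delay -/

section ClosedLoop

variable {N n m p q d : ℕ}

/-- The action of a real `N × N` matrix on families of `N` complex vectors. -/
def mix (H : Matrix (Fin N) (Fin N) ℝ) (V : Type*) [AddCommGroup V] [Module ℂ V] :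
    (Fin N → V) →ₗ[ℂ] (Fin N → V) :=
  LinearMap.pi fun i => ∑ j, (H i j : ℂ) • LinearMap.proj j

theorem mix_apply (H : Matrix (Fin N) (Fin N) ℝ) {V : Type*} [AddCommGroup V] [Module ℂ V]
    (s : Fin N → V) (i : Fin N) : mix H V s i = ∑ j, (H i j : ℂ) • s j := by
  simp [mix]

theorem mix_map (H : Matrix (Fin N) (Fin N) ℝ) {V V' : Type*} [AddCommGroup V] [Module ℂ V]
    [AddCommGroup V'] [Module ℂ V'] (f : V →ₗ[ℂ] V') (s : Fin N → V) (i : Fin N) :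
    mix H V' (fun j => f (s j)) i = f (mix H V s i) := by
  simp [mix_apply]

theorem mix_mulVec (H : Matrix (Fin N) (Fin N) ℝ) {ι κ : Type*} [Fintype ι] [Fintype κ]
    (M : Matrix ι κ ℂ) (s : Fin N → κ → ℂ) (i : Fin N) :
    mix H (ι → ℂ) (fun j => M *ᵥ s j) i = M *ᵥ mix H (κ → ℂ) s i :=
  mix_map H M.mulVecLin s i

theorem mix_cvec (H : Matrix (Fin N) (Fin N) ℝ) {ι : Type*} (s : Fin N → ι → ℝ) (i : Fin N) :
    mix H (ι → ℂ) (fun j => cvec (s j)) i = cvec (∑ j, H i j • s j) := by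
  funext k
  simp [mix_apply, cvec]

theorem mem_spectrum_of_mix_eq {H : Matrix (Fin N) (Fin N) ℝ} {ι : Type*} {Y : Fin N → ι → ℂ}
    (hY : Y ≠ 0) {μ : ℂ} (h : mix H (ι → ℂ) Y = μ • Y) : μ ∈ spectrum ℂ (cx H) := by
  obtain ⟨i, hi⟩ := Function.ne_iff.1 hY
  obtain ⟨k, hk⟩ := Function.ne_iff.1 hi
  refine mem_spectrum_iff_exists_mulVec.2 ⟨fun j => Y j k, fun h0 => hk (congrFun h0 i), ?_⟩
  funext j
  have h1 := congrFun (congrFun h j) k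
  simpa [mix_apply, Matrix.mulVec, dotProduct] using h1

/-- A coupled family of mode equations decouples over the eigenvalues of the coupling matrix. -/
theorem eq_zero_of_coupled_modes {H : Matrix (Fin N) (Fin N) ℝ} {ι : Type*} [Fintype ι]
    {M₀ M₁ : Matrix ι ι ℂ} {c : ℂ}
    (h : ∀ μ ∈ spectrum ℂ (cx H), ∀ y, c • y = M₀ *ᵥ y + μ • (M₁ *ᵥ y) → y = 0)
    {Y : Fin N → ι → ℂ} (hY : ∀ i, c • Y i = M₀ *ᵥ Y i + M₁ *ᵥ mix H (ι → ℂ) Y i) : Y = 0 := by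
  -- The coupling acts on the node index and the mode matrices on the vector index, so the solution
  -- space is stable under coupling. An eigenvector of the coupling inside it solves a decoupled
  -- equation; `H` need not be diagonalizable.
  let p : Submodule ℂ (Fin N → ι → ℂ) :=
    { carrier := {Y | ∀ i, c • Y i = M₀ *ᵥ Y i + M₁ *ᵥ mix H (ι → ℂ) Y i}
      add_mem' := fun {Y Z} hY hZ i => by
        rw [map_add, Pi.add_apply, Pi.add_apply, smul_add, hY i, hZ i, Matrix.mulVec_add,
          Matrix.mulVec_add]
        abel
      zero_mem' := fun i => by simp
      smul_mem' := fun b Y hY i => by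
        rw [map_smul, Pi.smul_apply, Pi.smul_apply, smul_comm, hY i, Matrix.mulVec_smul,
          Matrix.mulVec_smul, smul_add] }
  by_contra h0
  obtain ⟨Z, hZ, hZ0, μ, hμ⟩ := exists_eigenvector_mem (mix H (ι → ℂ)) p
    (fun hbot => h0 ((Submodule.mem_bot ℂ).1 (hbot ▸ (show Y ∈ p from hY)))) (by
      intro Z hZ i
      have h1 : mix H (ι → ℂ) (fun j => c • Z j) i = mix H (ι → ℂ)
          (fun j => M₀ *ᵥ Z j + M₁ *ᵥ mix H (ι → ℂ) Z j) i := by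
        rw [show (fun j => c • Z j) = fun j => M₀ *ᵥ Z j + M₁ *ᵥ mix H (ι → ℂ) Z j from funext hZ]
      have h2 : (fun j => M₀ *ᵥ Z j + M₁ *ᵥ mix H (ι → ℂ) Z j) =
          (fun j => M₀ *ᵥ Z j) + fun j => M₁ *ᵥ mix H (ι → ℂ) Z j := rfl
      rw [h2, map_add, Pi.add_apply, mix_mulVec, mix_mulVec] at h1
      rw [← h1, show (fun j => c • Z j) = c • Z from rfl, map_smul]
      rfl)
  refine hZ0 (funext fun i => h μ (mem_spectrum_of_mix_eq hZ0 hμ) _ ?_)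
  have h1 := hZ i
  rwa [hμ, Pi.smul_apply, Matrix.mulVec_smul] at h1

/-- Complex states of the closed loop: the states of the followers, of their internal models and of
their observers. -/
abbrev ClosedLoopState (N n p d : ℕ) : Type :=
  (Fin N → Fin n → ℂ) × (Fin N → Fin p × Fin d → ℂ) × (Fin N → Fin n → ℂ)

variable (P : Plant n m p q) (a : Matrix (Fin (N + 1)) (Fin (N + 1)) ℝ) (κ : Controller n m p d)
  (w : Uncertainty N n m p q)

/-- The undelayed part of the closed-loop dynamics. -/
def loopDirect : ClosedLoopState N n p d →ₗ[ℂ] ClosedLoopState N n p d where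
  toFun s :=
    (fun i => cx (Abar P w i) *ᵥ s.1 i,
     fun i => cx κ.G₁ *ᵥ s.2.1 i +
       cx κ.G₂ *ᵥ mix (followerLap a) _ (fun j => cx (Cbar P w j) *ᵥ s.1 j) i,
     fun i => cx P.A *ᵥ s.2.2 i - cx (κ.L * P.C) *ᵥ mix (followerLap a) _ s.2.2 i +
       cx κ.L *ᵥ mix (followerLap a) _ (fun j => cx (Cbar P w j) *ᵥ s.1 j) i)
  map_add' s s' := by
    have h : (fun j => cx (Cbar P w j) *ᵥ s.1 j + cx (Cbar P w j) *ᵥ s'.1 j) =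
      (fun j => cx (Cbar P w j) *ᵥ s.1 j) + fun j => cx (Cbar P w j) *ᵥ s'.1 j := rfl
    ext1
    · funext i
      simp only [Prod.fst_add, Pi.add_apply, Matrix.mulVec_add]
    ext1 <;> funext i <;>
    simp only [Prod.fst_add, Prod.snd_add, Pi.add_apply, Matrix.mulVec_add, map_add, h] <;> abel
  map_smul' c s := by
    have h : (fun j => c • (cx (Cbar P w j) *ᵥ s.1 j)) =
      c • (fun j => cx (Cbar P w j) *ᵥ s.1 j) := rfl
    ext1
    · funext i
      simp only [Prod.smul_fst, Pi.smul_apply, Matrix.mulVec_smul, RingHom.id_apply]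
    ext1 <;> funext i <;>
    simp only [Prod.smul_fst, Prod.smul_snd, Pi.smul_apply, Matrix.mulVec_smul, map_smul, h,
      RingHom.id_apply, smul_add, smul_sub]

/-- The feedback law, as a function of the delayed state. -/
def loopControl (s : ClosedLoopState N n p d) (i : Fin N) : Fin m → ℂ :=
  cx κ.K₁ *ᵥ s.2.1 i + cx κ.K₂ *ᵥ mix (followerLap a) _ s.2.2 i

/-- The delayed part of the closed-loop dynamics. -/
def loopDelayed : ClosedLoopState N n p d →ₗ[ℂ] ClosedLoopState N n p d where
  toFun s :=
    (fun i => cx (Bbar P w i) *ᵥ loopControl a κ s i, 0, fun i => cx P.B *ᵥ loopControl a κ s i)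
  map_add' s s' := by
    ext1
    · funext i
      simp only [loopControl, Prod.fst_add, Prod.snd_add, Pi.add_apply, Matrix.mulVec_add, map_add]
      abel
    ext1
    · simp
    · funext i
      simp only [loopControl, Prod.fst_add, Prod.snd_add, Pi.add_apply, Matrix.mulVec_add, map_add]
      abel
  map_smul' c s := by
    ext1
    · funext i
      simp only [loopControl, Prod.smul_fst, Prod.smul_snd, Pi.smul_apply, Matrix.mulVec_smul,
        map_smul, RingHom.id_apply, smul_add, Matrix.mulVec_add]
    ext1
    · simp
    · funext i
      simp only [loopControl, Prod.smul_snd, Pi.smul_apply, Matrix.mulVec_smul, Prod.smul_fst,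
        map_smul, RingHom.id_apply, smul_add, Matrix.mulVec_add]

/-- The action of the exosystem on the closed loop. -/
def loopForcing : (Fin q → ℂ) →ₗ[ℂ] ClosedLoopState N n p d where
  toFun v :=
    (fun i => cx (Ebar P w i) *ᵥ v,
     fun i => cx κ.G₂ *ᵥ mix (followerLap a) _ (fun _ => cx P.F *ᵥ v) i,
     fun i => cx κ.L *ᵥ mix (followerLap a) _ (fun _ => cx P.F *ᵥ v) i)
  map_add' v v' := by
    have h : (fun _ : Fin N => cx P.F *ᵥ v + cx P.F *ᵥ v') =
      (fun _ => cx P.F *ᵥ v) + fun _ => cx P.F *ᵥ v' := rfl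
    simp only [Matrix.mulVec_add, h, map_add, Pi.add_apply]
    rfl
  map_smul' c v := by
    have h : (fun _ : Fin N => c • (cx P.F *ᵥ v)) = c • (fun _ => cx P.F *ᵥ v) := rfl
    simp only [Matrix.mulVec_smul, h, map_smul, Pi.smul_apply]
    rfl

/-- The complex state given by real states of the closed loop. -/
def toState (x : Fin N → Fin n → ℝ) (z : Fin N → Fin p × Fin d → ℝ) (ξ : Fin N → Fin n → ℝ) :
    ClosedLoopState N n p d :=
  (fun i => cvec (x i), fun i => cvec (z i), fun i => cvec (ξ i))

theorem norm_cvec_family {ι : Type*} [Fintype ι] (x : Fin N → ι → ℝ) :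
    ‖fun i => cvec (x i)‖ = ‖x‖ := by
  rw [Pi.norm_def, Pi.norm_def]
  congr 2
  funext i
  exact NNReal.eq (norm_cvec (x i))

theorem norm_toState_le_iff {x : Fin N → Fin n → ℝ} {z : Fin N → Fin p × Fin d → ℝ}
    {ξ : Fin N → Fin n → ℝ} {M : ℝ} : ‖toState x z ξ‖ ≤ M ↔ ‖x‖ ≤ M ∧ ‖z‖ ≤ M ∧ ‖ξ‖ ≤ M := by
  rw [toState, Prod.norm_mk, Prod.norm_mk, norm_cvec_family, norm_cvec_family, norm_cvec_family,
    max_le_iff, max_le_iff]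

theorem regulatedOutput_eq (v : Fin q → ℝ) (x : Fin N → Fin n → ℝ) (i : Fin N) :
    regulatedOutput P w v x i = Cbar P w i *ᵥ x i + P.F *ᵥ v := by
  simp [regulatedOutput, nodeOutput]

theorem virtualOutput_eq (v : Fin q → ℝ) (x : Fin N → Fin n → ℝ) (i : Fin N) :
    virtualOutput P a w v x i = ∑ j, followerLap a i j • regulatedOutput P w v x j :=
  relSum_eq a _ i

theorem relObserver_eq (ξ : Fin N → Fin n → ℝ) (i : Fin N) :
    relObserver a ξ i = ∑ j, followerLap a i j • ξ j := by
  rw [relObserver, relSum_eq]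
  simp

theorem cvec_relObserver (ξ : Fin N → Fin n → ℝ) (i : Fin N) :
    cvec (relObserver a ξ i) = mix (followerLap a) _ (fun j => cvec (ξ j)) i := by
  rw [relObserver_eq, mix_cvec]

theorem cvec_add {ι : Type*} (x y : ι → ℝ) : cvec (x + y) = cvec x + cvec y := by
  funext i; simp [cvec]

theorem cvec_sub {ι : Type*} (x y : ι → ℝ) : cvec (x - y) = cvec x - cvec y := by
  funext i; simp [cvec]

theorem cvec_virtualOutput (v : Fin q → ℝ) (x : Fin N → Fin n → ℝ) (i : Fin N) :
    cvec (virtualOutput P a w v x i) =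
      mix (followerLap a) _ (fun j => cx (Cbar P w j) *ᵥ cvec (x j)) i +
        mix (followerLap a) _ (fun _ => cx P.F *ᵥ cvec v) i := by
  have h : (fun j => cvec (regulatedOutput P w v x j)) =
      (fun j => cx (Cbar P w j) *ᵥ cvec (x j)) + fun _ => cx P.F *ᵥ cvec v := by
    funext j
    rw [regulatedOutput_eq, cvec_add, ← cx_mulVec_cvec, ← cx_mulVec_cvec]
    rfl
  rw [virtualOutput_eq, ← mix_cvec, h, map_add, Pi.add_apply]

variable {P a κ w}

theorem IsTrajectory.toState_succ {v : ℤ → Fin q → ℝ} {x : ℤ → Fin N → Fin n → ℝ}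
    {z : ℤ → Fin N → Fin p × Fin d → ℝ} {ξ : ℤ → Fin N → Fin n → ℝ}
    (h : IsTrajectory P a κ w v x z ξ) (t : ℤ) (ht : 0 ≤ t) :
    toState (x (t + 1)) (z (t + 1)) (ξ (t + 1)) =
      loopDirect P a κ w (toState (x t) (z t) (ξ t)) +
        loopDelayed P a κ w (toState (x (t - (P.rcon + P.rcom : ℕ)))
          (z (t - (P.rcon + P.rcom : ℕ))) (ξ (t - (P.rcon + P.rcom : ℕ)))) +
        loopForcing P a κ w (cvec (v t)) := by
  have hctl : ∀ i, cvec (control P a κ z ξ (t - P.rcon) i) =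
      loopControl a κ (toState (x (t - (P.rcon + P.rcom : ℕ)))
          (z (t - (P.rcon + P.rcom : ℕ))) (ξ (t - (P.rcon + P.rcom : ℕ)))) i := by
    intro i
    have e : t - (P.rcon : ℤ) - P.rcom = t - (P.rcon + P.rcom : ℕ) := by push_cast; ring
    rw [control, e, cvec_add, ← cx_mulVec_cvec, ← cx_mulVec_cvec, cvec_relObserver]
    rfl
  ext1
  · funext i
    change cvec (x (t + 1) i) = cx (Abar P w i) *ᵥ cvec (x t i) + _ + cx (Ebar P w i) *ᵥ cvec (v t)
    rw [h.plant t ht i, cvec_add, cvec_add, ← cx_mulVec_cvec, ← cx_mulVec_cvec, ← cx_mulVec_cvec,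
      hctl]
    rfl
  ext1
  · funext i
    change cvec (z (t + 1) i) = cx κ.G₁ *ᵥ cvec (z t i) + _ + 0 + _
    rw [h.internalModel t ht i, cvec_add, ← cx_mulVec_cvec, ← cx_mulVec_cvec, cvec_virtualOutput,
      Matrix.mulVec_add, add_zero, add_assoc]
    rfl
  · funext i
    change cvec (ξ (t + 1) i) = cx P.A *ᵥ cvec (ξ t i) - _ + _ + _ + _
    rw [h.observer t ht i, cvec_add, cvec_sub, cvec_add, ← cx_mulVec_cvec, ← cx_mulVec_cvec,
      ← cx_mulVec_cvec, ← cx_mulVec_cvec, cvec_virtualOutput, Matrix.mulVec_add, cvec_relObserver,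
      hctl]
    have e : ∀ α β γ δ ε : Fin n → ℂ, α + β - γ + (δ + ε) = α - γ + δ + β + ε :=
      fun α β γ δ ε => by abel
    rw [e]
    rfl

variable (P a κ w)

/-- The closed loop has no mode of modulus at least one. -/
def LoopStable : Prop :=
  DelayStable (P.rcon + P.rcom) (LinearMap.toContinuousLinearMap (loopDirect P a κ w))
    (LinearMap.toContinuousLinearMap (loopDelayed P a κ w))

variable {P a κ w}

theorem continuous_cx_mulVec {X ι l : Type*} [TopologicalSpace X] [Fintype l]
    {M : X → Matrix ι l ℝ} (hM : Continuous M) {v : X → l → ℂ} (hv : Continuous v) :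
    Continuous fun x => cx (M x) *ᵥ v x :=
  (hM.matrix_map Complex.continuous_ofReal).matrix_mulVec hv

theorem LoopStable.eventually (h : LoopStable P a κ (0 : Uncertainty N n m p q)) :
    ∀ᶠ w in 𝓝 (0 : Uncertainty N n m p q), LoopStable P a κ w := by
  have hmix : ∀ {k : ℕ}, Continuous (mix (followerLap a) (Fin k → ℂ)) := fun {k} =>
    (mix (followerLap a) (Fin k → ℂ)).continuous_of_finiteDimensional
  have hA : ∀ i : Fin N, Continuous fun w : Uncertainty N n m p q => Abar P w i := fun i => by
    unfold Abar; fun_prop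
  have hB : ∀ i : Fin N, Continuous fun w : Uncertainty N n m p q => Bbar P w i := fun i => by
    unfold Bbar; fun_prop
  have hC : ∀ i : Fin N, Continuous fun w : Uncertainty N n m p q => Cbar P w i := fun i => by
    unfold Cbar; fun_prop
  have hCs : ∀ (s : ClosedLoopState N n p d) (i : Fin N),
      Continuous fun w : Uncertainty N n m p q =>
        mix (followerLap a) (Fin p → ℂ) (fun j => cx (Cbar P w j) *ᵥ s.1 j) i := fun s i =>
    (continuous_apply i).comp (hmix.comp
      (continuous_pi fun j => continuous_cx_mulVec (hC j) continuous_const))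
  refine DelayStable.eventually ?_ ?_ h
  · refine continuous_clm_apply.2 fun s => ?_
    refine (continuous_pi fun i => ?_).prodMk ((continuous_pi fun i => ?_).prodMk
      (continuous_pi fun i => ?_))
    · exact continuous_cx_mulVec (hA i) continuous_const
    · exact continuous_const.add (continuous_cx_mulVec continuous_const (hCs s i))
    · exact continuous_const.add (continuous_cx_mulVec continuous_const (hCs s i))
  · refine continuous_clm_apply.2 fun s => ?_
    refine (continuous_pi fun i => ?_).prodMk (continuous_const.prodMk continuous_const)
    exact continuous_cx_mulVec (hB i) continuous_const

theorem LoopStable.nominalExponentiallyStable (h : LoopStable P a κ (0 : Uncertainty N n m p q)) :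
    NominalExponentiallyStable P a κ := by
  obtain ⟨c, ρ, hc, hρ, hρ1, hdec⟩ := h.exists_decay
  refine ⟨c, ρ, hc, hρ, hρ1, fun x z ξ htraj M hM t => ?_⟩
  refine norm_toState_le_iff.1 (hdec (fun t => toState (x t) (z t) (ξ t)) (fun t ht => ?_) M
    (fun s hs hs0 => norm_toState_le_iff.2 (hM s (by push_cast at hs; linarith) hs0)) t)
  have h1 := htraj.toState_succ t ht
  have h2 : cvec (0 : Fin q → ℝ) = 0 := by funext i; simp
  rw [h2, map_zero, add_zero] at h1
  exact h1

theorem LoopStable.tendsto_zero (h : LoopStable P a κ w) {s : ℤ → ClosedLoopState N n p d}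
    (hs : ∀ t : ℤ, 0 ≤ t → s (t + 1) = loopDirect P a κ w (s t) +
      loopDelayed P a κ w (s (t - (P.rcon + P.rcom : ℕ)))) :
    Filter.Tendsto (fun t : ℕ => s t) Filter.atTop (𝓝 0) := by
  obtain ⟨c, ρ, hc, hρ, hρ1, hdec⟩ := h.exists_decay
  obtain ⟨M, hM⟩ : ∃ M, ∀ t : ℤ, -((P.rcon + P.rcom : ℕ) : ℤ) ≤ t → t ≤ 0 → ‖s t‖ ≤ M := by
    obtain ⟨M, hM⟩ := ((Set.finite_Icc (-((P.rcon + P.rcom : ℕ) : ℤ)) 0).image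
      fun t => ‖s t‖).bddAbove
    exact ⟨M, fun t h1 h2 => hM ⟨t, ⟨h1, h2⟩, rfl⟩⟩
  refine squeeze_zero_norm (hdec s hs M hM) ?_
  have h1 := ((tendsto_pow_atTop_nhds_zero_of_lt_one hρ.le hρ1).const_mul c).mul_const M
  simpa using h1

end ClosedLoop

/-! ### Stabilizing gains -/

/-- Dual to low-gain stabilization with zero delay for (Aᵀ, Cᵀ): a matrix and its transpose have the
same eigenvalues. -/
theorem exists_observerGain {n p : ℕ} {A : Matrix (Fin n) (Fin n) ℝ} {C : Matrix (Fin p) (Fin n) ℝ}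
    (hdet : Detectable C A) (hA : ∀ μ ∈ eigs A, ‖μ‖ ≤ 1) {a b : ℝ} (ha : 0 < a) :
    ∃ L : Matrix (Fin n) (Fin p) ℝ, ∀ μ : ℂ, a ≤ μ.re → ‖μ‖ ≤ b → ∀ z : ℂ, 1 ≤ ‖z‖ →
      ∀ x : Fin n → ℂ, z • x = cx A *ᵥ x + μ • ((-cx (L * C)) *ᵥ x) → x = 0 := by
  obtain ⟨K, hK⟩ := exists_lowGain (A := Aᵀ) (B := Cᵀ)
    (fun μ hμ => hA μ (mem_spectrum_transpose.1 hμ)) hdet.hautus ha (b := b) 0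
  refine ⟨-Kᵀ, fun μ hμa hμb z hz x hx => ?_⟩
  by_contra h0
  have hspec : z ∈ spectrum ℂ (cx A + μ • (-cx (-Kᵀ * C))) :=
    mem_spectrum_iff_exists_mulVec.2 ⟨x, h0, by
      rw [Matrix.add_mulVec, Matrix.smul_mulVec, hx]⟩
  obtain ⟨v, hv0, hv⟩ := mem_spectrum_iff_exists_transpose_mulVec.1 hspec
  refine hv0 (hK μ hμa hμb z hz v ?_)
  have h1 : (cx A + μ • (-cx (-Kᵀ * C)))ᵀ = cx Aᵀ + μ • cx (Cᵀ * K) := by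
    rw [Matrix.neg_mul, cx_neg, neg_neg, Matrix.transpose_add, Matrix.transpose_smul,
      ← cx_transpose, ← cx_transpose, Matrix.transpose_mul, Matrix.transpose_transpose]
  rw [h1, Matrix.add_mulVec, Matrix.smul_mulVec] at hv
  rw [zero_add, pow_one, pow_zero, one_smul, hv]

variable {N n m p q d : ℕ}

theorem mulVec_elim_toCols {n₁ n₂ : Type*} [Fintype n₁] [Fintype n₂] (K : Matrix (Fin m) (n₁ ⊕ n₂) ℝ)
    (x : n₁ → ℂ) (z : n₂ → ℂ) :
    cx K *ᵥ Sum.elim x z = cx K.toCols₁ *ᵥ x + cx K.toCols₂ *ᵥ z := by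
  funext i
  simp [Matrix.mulVec, dotProduct, Fintype.sum_sum_type, Matrix.toCols₁, Matrix.toCols₂]

theorem cx_augA_mulVec_elim (A : Matrix (Fin n) (Fin n) ℝ) (C : Matrix (Fin p) (Fin n) ℝ)
    (G₁ : Matrix (Fin p × Fin d) (Fin p × Fin d) ℝ) (G₂ : Matrix (Fin p × Fin d) (Fin p) ℝ)
    (x : Fin n → ℂ) (z : Fin p × Fin d → ℂ) :
    cx (augA A C G₁ G₂) *ᵥ Sum.elim x z =
      Sum.elim (cx A *ᵥ x) (cx G₁ *ᵥ z + cx G₂ *ᵥ (cx C *ᵥ x)) := by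
  rw [Matrix.mulVec_mulVec, ← cx_mul, cx, augA, Matrix.fromBlocks_map, Matrix.fromBlocks_mulVec]
  congr 1
  · simp [cx]
  · simp [cx, add_comm]

theorem cx_augB_mul_mulVec (B : Matrix (Fin n) (Fin m) ℝ)
    (K : Matrix (Fin m) (Fin n ⊕ Fin p × Fin d) ℝ) (v : Fin n ⊕ Fin p × Fin d → ℂ) :
    cx (augB p d B * K) *ᵥ v = Sum.elim (cx B *ᵥ (cx K *ᵥ v)) 0 := by
  rw [cx_mul, ← Matrix.mulVec_mulVec]
  generalize cx K *ᵥ v = u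
  funext i
  rcases i with i | i <;> simp [augB, Matrix.mulVec, dotProduct]

variable {P : Plant n m p q} {a : Matrix (Fin (N + 1)) (Fin (N + 1)) ℝ}
  {G : Digraph (Fin (N + 1))}
  {G₁ : Matrix (Fin p × Fin d) (Fin p × Fin d) ℝ} {G₂ : Matrix (Fin p × Fin d) (Fin p) ℝ}

/-- The nominal closed loop separates into the observer errors and the plants with the internal
models, coupled over the network. -/
theorem loopStable_of_gains {K : Matrix (Fin m) (Fin n ⊕ Fin p × Fin d) ℝ}
    {L : Matrix (Fin n) (Fin p) ℝ} (hH : 0 ∉ spectrum ℂ (cx (followerLap a)))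
    (hL : ∀ μ ∈ spectrum ℂ (cx (followerLap a)), ∀ z : ℂ, 1 ≤ ‖z‖ → ∀ x : Fin n → ℂ,
      z • x = cx P.A *ᵥ x + μ • ((-cx (L * P.C)) *ᵥ x) → x = 0)
    (hK : ∀ μ ∈ spectrum ℂ (cx (followerLap a)), ∀ z : ℂ, 1 ≤ ‖z‖ → ∀ x,
      z ^ (P.rcon + P.rcom + 1) • x = z ^ (P.rcon + P.rcom) • (cx (augA P.A P.C G₁ G₂) *ᵥ x) +
        μ • (cx (augB p d P.B * K) *ᵥ x) → x = 0) :
    LoopStable P a ⟨G₁, G₂, K.toCols₂, K.toCols₁, L⟩ (0 : Uncertainty N n m p q) := by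
  set H := followerLap a with hHdef
  rintro z hz ⟨x, y, ξ⟩ hs
  set r := P.rcon + P.rcom
  have hz0 : z ≠ 0 := fun h => by norm_num [h] at hz
  have hA : ∀ i : Fin N, Abar P (0 : Uncertainty N n m p q) i = P.A := fun i => add_zero _
  have hB : ∀ i : Fin N, Bbar P (0 : Uncertainty N n m p q) i = P.B := fun i => add_zero _
  have hC : ∀ i : Fin N, Cbar P (0 : Uncertainty N n m p q) i = P.C := fun i => add_zero _
  let u : Fin N → Fin m → ℂ := fun i =>
    cx K.toCols₂ *ᵥ y i + cx K.toCols₁ *ᵥ mix H (Fin n → ℂ) ξ i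
  have hx : ∀ i, z ^ (r + 1) • x i = z ^ r • (cx P.A *ᵥ x i) + cx P.B *ᵥ u i := fun i => by
    have h1 := congrFun (congrArg Prod.fst hs) i
    change _ = z ^ r • (cx (Abar P 0 i) *ᵥ x i) + cx (Bbar P 0 i) *ᵥ u i at h1
    rw [hA, hB] at h1
    exact h1
  have hmC : ∀ i, mix H (Fin p → ℂ)
      (fun j => cx (Cbar P (0 : Uncertainty N n m p q) j) *ᵥ x j) i = cx P.C *ᵥ mix H _ x i :=
    fun i => by
      simp only [hC]
      exact mix_mulVec _ _ _ _
  have hy : ∀ i, z ^ (r + 1) • y i =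
      z ^ r • (cx G₁ *ᵥ y i + cx G₂ *ᵥ (cx P.C *ᵥ mix H _ x i)) := fun i => by
    have h1 := congrFun (congrArg (fun s => s.2.1) hs) i
    change _ = z ^ r • (cx G₁ *ᵥ y i + cx G₂ *ᵥ mix H _ _ i) + 0 at h1
    rw [hmC, add_zero] at h1
    exact h1
  have hξ : ∀ i, z ^ (r + 1) • ξ i =
      z ^ r • (cx P.A *ᵥ ξ i - cx (L * P.C) *ᵥ mix H _ ξ i + cx (L * P.C) *ᵥ mix H _ x i) +
        cx P.B *ᵥ u i := fun i => by
    have h1 := congrFun (congrArg (fun s => s.2.2) hs) i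
    change _ = z ^ r • (cx P.A *ᵥ ξ i - cx (L * P.C) *ᵥ mix H _ ξ i + cx L *ᵥ mix H _ _ i) +
      cx P.B *ᵥ u i at h1
    rw [hmC, Matrix.mulVec_mulVec, ← cx_mul] at h1
    exact h1
  -- The delayed input enters plant and observer through the same nominal `B` and cancels in the
  -- difference.
  have hξx : ξ = x := by
    refine sub_eq_zero.1 (eq_zero_of_coupled_modes (H := H) (c := z) (M₀ := cx P.A)
      (M₁ := -cx (L * P.C)) (fun μ hμ v hv => hL μ hμ z hz v hv) fun i => ?_)
    refine smul_right_injective _ (pow_ne_zero r hz0) ?_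
    change z ^ r • z • (ξ i - x i) = z ^ r • (cx P.A *ᵥ (ξ i - x i) + _)
    rw [smul_smul, ← pow_succ, smul_sub, hξ, hx, map_sub, Pi.sub_apply, Matrix.neg_mulVec,
      Matrix.mulVec_sub, Matrix.mulVec_sub]
    simp only [smul_add, smul_sub, smul_neg]
    abel
  subst hξx
  -- The internal models see the plants only through their mixture by `H`. With that mixture as
  -- plant state, every node carries the same augmented plant and the coupling acts on the input
  -- alone.
  have hY : (fun i => Sum.elim (mix H (Fin n → ℂ) ξ i) (y i)) = 0 := by
    refine eq_zero_of_coupled_modes (H := H) (c := z ^ (r + 1))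
      (M₀ := z ^ r • cx (augA P.A P.C G₁ G₂)) (M₁ := cx (augB p d P.B * K))
      (fun μ hμ v hv => hK μ hμ z hz v (by rw [hv, Matrix.smul_mulVec])) fun i => ?_
    rw [← mix_mulVec, Matrix.smul_mulVec, cx_augA_mulVec_elim]
    have hu : ∀ j, cx K *ᵥ Sum.elim (mix H (Fin n → ℂ) ξ j) (y j) = u j := fun j => by
      rw [mulVec_elim_toCols, add_comm]
    simp only [cx_augB_mul_mulVec, hu]
    have hmix : z ^ (r + 1) • mix H (Fin n → ℂ) ξ i =
        z ^ r • (cx P.A *ᵥ mix H _ ξ i) + mix H _ (fun j => cx P.B *ᵥ u j) i := by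
      have h1 : z ^ (r + 1) • ξ = z ^ r • (fun j => cx P.A *ᵥ ξ j) + fun j => cx P.B *ᵥ u j :=
        funext hx
      have h2 := congrFun (congrArg (mix H (Fin n → ℂ)) h1) i
      rwa [map_smul, map_add, map_smul, Pi.add_apply, Pi.smul_apply, Pi.smul_apply, mix_mulVec]
        at h2
    funext k
    rcases k with k | k
    · have h1 := congrFun hmix k
      simpa [mix_apply] using h1
    · have h1 := congrFun (hy i) k
      simpa [mix_apply] using h1
  have hx0 : ξ = 0 := by
    by_contra h0
    refine hH (mem_spectrum_of_mix_eq h0 ?_)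
    rw [zero_smul]
    funext i k
    exact congrFun (congrFun hY i) (Sum.inl k)
  have hy0 : y = 0 := by
    funext i k
    exact congrFun (congrFun hY i) (Sum.inr k)
  rw [hx0, hy0]
  rfl

theorem exists_loopStable (ha : IsWeightedAdjacency G a)
    (hreach : ∀ i, Relation.ReflTransGen G.Adj 0 i)
    (hstab : Stabilizable P.A P.B) (hdet : Detectable P.C P.A)
    (hzero : TransmissionZeroCondition P.A P.B P.C P.S) (hS : ∀ μ ∈ eigs P.S, ‖μ‖ = 1)
    (hA : ∀ μ ∈ eigs P.A, ‖μ‖ ≤ 1) (hG : IsMinimalPCopyInternalModel P.S G₁ G₂) :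
    ∃ (K₁ : Matrix (Fin m) (Fin p × Fin d) ℝ) (K₂ : Matrix (Fin m) (Fin n) ℝ)
      (L : Matrix (Fin n) (Fin p) ℝ),
      LoopStable P a ⟨G₁, G₂, K₁, K₂, L⟩ (0 : Uncertainty N n m p q) := by
  obtain ⟨c, b, hc, hcb⟩ := exists_bounds_spectrum_followerLap ha hreach
  obtain ⟨L, hL⟩ := exists_observerGain hdet hA hc (b := b)
  obtain ⟨K, hK⟩ := exists_lowGain (fun μ hμ => norm_le_one_of_mem_spectrum_aug hA hS hG hμ)
    (hautus_aug hstab.hautus hzero hG) hc (b := b) (P.rcon + P.rcom)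
  refine ⟨K.toCols₂, K.toCols₁, L, loopStable_of_gains ?_
    (fun μ hμ => hL μ (hcb μ hμ).1 (hcb μ hμ).2) fun μ hμ => hK μ (hcb μ hμ).1 (hcb μ hμ).2⟩
  intro h0
  have := (hcb 0 h0).1
  simp only [Complex.zero_re] at this
  linarith

/-! ### Output regulation -/

variable {N n m p q d : ℕ} {P : Plant n m p q} {a : Matrix (Fin (N + 1)) (Fin (N + 1)) ℝ}
  {κ : Controller n m p d} {w : Uncertainty N n m p q} {v : ℤ → Fin q → ℝ}
  {x : ℤ → Fin N → Fin n → ℝ} {z : ℤ → Fin N → Fin p × Fin d → ℝ} {ξ : ℤ → Fin N → Fin n → ℝ}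

theorem IsTrajectory.exosystem_add (h : IsTrajectory P a κ w v x z ξ) {t : ℤ} (ht : 0 ≤ t) (k : ℕ) :
    v (t + k) = (P.S ^ k) *ᵥ v t := by
  induction k with
  | zero => simp
  | succ k ih =>
    have h1 := h.exosystem (t + k) (by positivity)
    rw [ih, Matrix.mulVec_mulVec, ← pow_succ'] at h1
    rw [← h1]
    congr 1
    push_cast
    ring

theorem IsTrajectory.sum_minpoly_coeff_smul_exosystem (h : IsTrajectory P a κ w v x z ξ) {t : ℤ}
    (ht : 0 ≤ t) : ∑ k ∈ Finset.range ((minpoly ℝ P.S).natDegree + 1),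
      (minpoly ℝ P.S).coeff k • v (t + k) = 0 := by
  have h1 := minpoly.aeval ℝ P.S
  rw [Polynomial.aeval_eq_sum_range] at h1
  have h2 := congrArg (fun M => M *ᵥ v t) h1
  simpa only [Matrix.sum_mulVec, Matrix.smul_mulVec, ← h.exosystem_add ht, Matrix.zero_mulVec]
    using h2

theorem cvec_smul {ι : Type*} (c : ℝ) (x : ι → ℝ) : cvec (c • x) = (c : ℂ) • cvec x := by
  funext i; simp [cvec]

theorem cvec_sum {ι σ : Type*} (s : Finset σ) (x : σ → ι → ℝ) :
    cvec (∑ k ∈ s, x k) = ∑ k ∈ s, cvec (x k) := by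
  funext i; simp [cvec]

/-- The minimal polynomial of the exosystem, applied to the shift, annihilates the exogenous signal
and hence turns a closed-loop trajectory into a decaying one. -/
theorem LoopStable.tendsto_sum_minpoly_coeff_smul (hs : LoopStable P a κ w)
    (h : IsTrajectory P a κ w v x z ξ) (i : Fin N) :
    Filter.Tendsto (fun t : ℕ => ∑ k ∈ Finset.range ((minpoly ℝ P.S).natDegree + 1),
      (minpoly ℝ P.S).coeff k • z ((t + k : ℕ) : ℤ) i) Filter.atTop (𝓝 0) := by
  set c := (minpoly ℝ P.S).coeff
  set I := Finset.range ((minpoly ℝ P.S).natDegree + 1)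
  let s : ℤ → ClosedLoopState N n p d := fun t => toState (x t) (z t) (ξ t)
  have hlim : Filter.Tendsto (fun t : ℕ => ∑ k ∈ I, (c k : ℂ) • s (t + k))
      Filter.atTop (𝓝 0) := by
    refine hs.tendsto_zero (s := fun t => ∑ k ∈ I, (c k : ℂ) • s (t + k)) fun t ht => ?_
    have hv : ∑ k ∈ I, (c k : ℂ) • loopForcing P a κ w (cvec (v (t + k))) = 0 := by
      simp only [← map_smul, ← map_sum, ← cvec_smul, ← cvec_sum]
      rw [h.sum_minpoly_coeff_smul_exosystem ht]
      have h0 : cvec (0 : Fin q → ℝ) = 0 := by funext i; simp [cvec]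
      rw [h0, map_zero]
    have h1 : ∀ k : ℕ, s (t + 1 + k) = loopDirect P a κ w (s (t + k)) +
        loopDelayed P a κ w (s (t - (P.rcon + P.rcom : ℕ) + k)) +
        loopForcing P a κ w (cvec (v (t + k))) := fun k => by
      have h2 := h.toState_succ (t + k) (by positivity)
      rw [show t + 1 + k = t + k + 1 by ring,
        show t - (P.rcon + P.rcom : ℕ) + k = t + k - (P.rcon + P.rcom : ℕ) by ring]
      exact h2
    simp only [h1, smul_add, Finset.sum_add_distrib, hv, add_zero, map_sum, map_smul]
  have h1 : Filter.Tendsto (fun t : ℕ => (∑ k ∈ I, (c k : ℂ) • s (t + k)).2.1 i)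
      Filter.atTop (𝓝 0) :=
    (((continuous_apply i).comp (continuous_fst.comp continuous_snd)).tendsto
      (0 : ClosedLoopState N n p d)).comp hlim
  rw [tendsto_zero_iff_norm_tendsto_zero] at h1 ⊢
  refine h1.congr fun t => ?_
  rw [← norm_cvec, cvec_sum]
  congr 1
  rw [Prod.snd_sum, Prod.fst_sum, Finset.sum_apply]
  refine Finset.sum_congr rfl fun k _ => ?_
  rw [cvec_smul]
  push_cast
  rfl

theorem det_followerLap_ne_zero (hH : 0 ∉ spectrum ℂ (cx (followerLap a))) :
    (followerLap a).det ≠ 0 := by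
  intro h0
  obtain ⟨v, hv0, hv⟩ := Matrix.exists_mulVec_eq_zero_iff.2 h0
  refine hH (mem_spectrum_iff_exists_mulVec.2 ⟨cvec v, fun h => hv0 ?_, ?_⟩)
  · rwa [← norm_eq_zero, norm_cvec, norm_eq_zero] at h
  · rw [cx_mulVec_cvec, hv]
    funext i
    simp [cvec]

theorem regulatedOutput_eq_sum_virtualOutput (hH : (followerLap a).det ≠ 0) (v : Fin q → ℝ)
    (x : Fin N → Fin n → ℝ) (i : Fin N) :
    regulatedOutput P w v x i = ∑ j, (followerLap a)⁻¹ i j • virtualOutput P a w v x j := by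
  simp only [virtualOutput_eq, Finset.smul_sum, smul_smul]
  rw [Finset.sum_comm]
  simp only [← Finset.sum_smul, ← Matrix.mul_apply]
  rw [Matrix.nonsing_inv_mul _ (isUnit_iff_ne_zero.2 hH)]
  simp [Matrix.one_apply]

/-- No regulator equations are solved: the uncertainty matters only through stability of the loop,
since the internal model itself is unperturbed. -/
theorem LoopStable.tendsto_regulatedOutput (hs : LoopStable P a κ w)
    (hH : 0 ∉ spectrum ℂ (cx (followerLap a))) (hq : 0 < q)
    (hG : IsMinimalPCopyInternalModel P.S κ.G₁ κ.G₂) (h : IsTrajectory P a κ w v x z ξ)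
    (i : Fin N) :
    Filter.Tendsto (fun t : ℕ => regulatedOutput P w (v t) (x t) i) Filter.atTop (𝓝 0) := by
  have hev : ∀ j, Filter.Tendsto (fun t : ℕ => virtualOutput P a w (v t) (x t) j)
      Filter.atTop (𝓝 0) := fun j =>
    hG.tendsto_zero hq (z := fun t : ℕ => z t j)
      (fun t => by exact_mod_cast h.internalModel t (by positivity) j)
      (hs.tendsto_sum_minpoly_coeff_smul h j)
  simp only [regulatedOutput_eq_sum_virtualOutput (det_followerLap_ne_zero hH)]
  have h1 := tendsto_finsetSum Finset.univ fun j _ => (hev j).const_smul ((followerLap a)⁻¹ i j)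
  simpa using h1

theorem LoopStable.solvesCORP (hs : LoopStable P a κ (0 : Uncertainty N n m p q))
    (hH : 0 ∉ spectrum ℂ (cx (followerLap a))) (hq : 0 < q)
    (hG : IsMinimalPCopyInternalModel P.S κ.G₁ κ.G₂) : SolvesCORP P a κ := by
  refine ⟨hs.nominalExponentiallyStable, ?_⟩
  obtain ⟨W, hW, hWo, h0⟩ := eventually_nhds_iff.1 hs.eventually
  exact ⟨W, hWo, h0, fun w hw v x z ξ h i => (hW w hw).tendsto_regulatedOutput hH hq hG h i⟩

/-! ### Necessity of the spanning tree -/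

variable (P a κ) in
/-- One step of the nominal closed loop without exogenous signal, from the past states
`(x, z, ξ)(t), (x, z, ξ)(t - 1), …`. -/
def nominalStep (h : ℕ → (Fin N → Fin n → ℝ) × (Fin N → Fin p × Fin d → ℝ) × (Fin N → Fin n → ℝ)) :
    (Fin N → Fin n → ℝ) × (Fin N → Fin p × Fin d → ℝ) × (Fin N → Fin n → ℝ) :=
  let u : Fin N → Fin m → ℝ := fun i => κ.K₁ *ᵥ (h (P.rcon + P.rcom)).2.1 i +
    κ.K₂ *ᵥ relObserver a (h (P.rcon + P.rcom)).2.2 i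
  let e : Fin N → Fin p → ℝ := virtualOutput P a (0 : Uncertainty N n m p q) 0 (h 0).1
  (fun i => Abar P (0 : Uncertainty N n m p q) i *ᵥ (h 0).1 i +
      Bbar P (0 : Uncertainty N n m p q) i *ᵥ u i +
      Ebar P (0 : Uncertainty N n m p q) i *ᵥ (0 : Fin q → ℝ),
    fun i => κ.G₁ *ᵥ (h 0).2.1 i + κ.G₂ *ᵥ e i,
    fun i => P.A *ᵥ (h 0).2.2 i + P.B *ᵥ u i - (κ.L * P.C) *ᵥ relObserver a (h 0).2.2 i +
      κ.L *ᵥ e i)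

/-- Delay equations are solvable forward in time. -/
theorem exists_delay_solution {E : Type*} (f : (ℕ → E) → E) (s₀ : E) :
    ∃ s : ℤ → E, (∀ t ≤ 0, s t = s₀) ∧ ∀ t : ℤ, 0 ≤ t → s (t + 1) = f fun k => s (t - k) := by
  -- `hist t k` stands for the value at time `t - k`; the whole infinite past is carried along,
  -- constant before time zero.
  let hist : ℕ → ℕ → E := fun t =>
    Nat.rec (fun _ => s₀) (fun _ h k => Nat.casesOn k (f h) fun k => h k) t
  have hzero : ∀ k, hist 0 k = s₀ := fun k => rfl
  have hsucc : ∀ t k, hist (t + 1) (k + 1) = hist t k := fun t k => rfl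
  have hnew : ∀ t, hist (t + 1) 0 = f (hist t) := fun t => rfl
  have hhist : ∀ t k : ℕ, hist t k = hist ((t : ℤ) - k).toNat 0 := by
    intro t
    induction t with
    | zero => intro k; simp [hzero]
    | succ t ih =>
      intro k
      cases k with
      | zero => simp
      | succ k =>
        rw [hsucc, ih]
        congr 2
        push_cast
        ring
  refine ⟨fun t => hist t.toNat 0, fun t ht => ?_, fun t ht => ?_⟩
  · simp only [Int.toNat_of_nonpos ht, hzero]
  · lift t to ℕ using ht
    change hist ((t : ℤ) + 1).toNat 0 = _
    rw [show ((t : ℤ) + 1).toNat = t + 1 by omega, hnew]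
    congr 1
    funext k
    exact hhist t k

variable (P a κ) in
theorem exists_nominal_trajectory (z₀ : Fin N → Fin p × Fin d → ℝ) :
    ∃ (x : ℤ → Fin N → Fin n → ℝ) (z : ℤ → Fin N → Fin p × Fin d → ℝ) (ξ : ℤ → Fin N → Fin n → ℝ),
      IsTrajectory P a κ (0 : Uncertainty N n m p q) (fun _ => 0) x z ξ ∧
      ∀ t ≤ 0, x t = 0 ∧ z t = z₀ ∧ ξ t = 0 := by
  obtain ⟨s, hs0, hs⟩ := exists_delay_solution (nominalStep P a κ)
    ((0, z₀, 0) : (Fin N → Fin n → ℝ) × (Fin N → Fin p × Fin d → ℝ) × (Fin N → Fin n → ℝ))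
  have hdelay : ∀ t : ℤ, t - (P.rcon : ℤ) - P.rcom = t - (P.rcon + P.rcom : ℕ) := fun t => by
    push_cast; ring
  refine ⟨fun t => (s t).1, fun t => (s t).2.1, fun t => (s t).2.2,
    ⟨fun t _ => by simp, fun t ht i => ?_, fun t ht i => ?_, fun t ht i => ?_⟩,
    fun t ht => by simp [hs0 t ht]⟩
  · simp only [hs t ht, nominalStep, control, hdelay]
    simp
  · simp only [hs t ht, nominalStep]
    simp
  · simp only [hs t ht, nominalStep, control, hdelay]
    simp

/-- A left null vector of the coupling matrix makes a combination of the internal models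
uncontrolled, so that the modes of the internal model persist in the closed loop. -/
theorem not_nominalExponentiallyStable {l : Fin N → ℝ} (hl0 : l ≠ 0)
    (hl : l ᵥ* followerLap a = 0) {μ : ℂ} (hμ : 1 ≤ ‖μ‖) {ζ : Fin p × Fin d → ℂ} (hζ0 : ζ ≠ 0)
    (hζ : (cx κ.G₁)ᵀ *ᵥ ζ = μ • ζ) : ¬ NominalExponentiallyStable P a κ := by
  rintro ⟨c, ρ, hc, hρ, hρ1, hdec⟩
  obtain ⟨i₀, hi₀⟩ := Function.ne_iff.1 hl0
  obtain ⟨k₀, hk₀⟩ := Function.ne_iff.1 hζ0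
  -- The excitation sits at a node and a coordinate where `l` and `ζ` do not vanish, so the observed
  -- mode starts at `ζ k₀ * l i₀ ≠ 0`.
  obtain ⟨x, z, ξ, htraj, hinit⟩ := exists_nominal_trajectory P a κ
    (Pi.single i₀ (Pi.single k₀ 1) : Fin N → Fin p × Fin d → ℝ)
  -- The weights `l` annihilate the columns of the Laplacian, so the weighted virtual outputs cancel
  -- whatever the plant states are.
  have hev : ∀ t, ∑ i, l i • virtualOutput P a (0 : Uncertainty N n m p q) 0 (x t) i = 0 := by
    intro t
    simp only [virtualOutput_eq, Finset.smul_sum, smul_smul]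
    rw [Finset.sum_comm]
    simp only [← Finset.sum_smul]
    refine Finset.sum_eq_zero fun j _ => ?_
    rw [show ∑ i, l i * followerLap a i j = 0 from congrFun hl j, zero_smul]
  have hZ : ∀ t : ℕ, ∑ i, l i • z (t + 1 : ℕ) i = κ.G₁ *ᵥ ∑ i, l i • z t i := by
    intro t
    have h1 : ∀ i, z (t + 1 : ℕ) i = κ.G₁ *ᵥ z t i +
        κ.G₂ *ᵥ virtualOutput P a (0 : Uncertainty N n m p q) 0 (x t) i := fun i => by
      exact_mod_cast htraj.internalModel t (by positivity) i
    simp only [h1, smul_add, Finset.sum_add_distrib, ← Matrix.mulVec_smul, ← Matrix.mulVec_sum, hev,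
      Matrix.mulVec_zero, add_zero]
  have hmode : ∀ t : ℕ, ζ ⬝ᵥ cvec (∑ i, l i • z t i) =
      μ ^ t * (ζ ⬝ᵥ cvec (∑ i, l i • z (0 : ℕ) i)) := by
    intro t
    induction t with
    | zero => simp
    | succ t ih =>
      rw [hZ, ← cx_mulVec_cvec, Matrix.dotProduct_mulVec, ← Matrix.mulVec_transpose, hζ,
        smul_dotProduct, ih, smul_eq_mul, pow_succ']
      ring
  have hM : ∀ s : ℤ, -((P.rcon : ℤ) + P.rcom) ≤ s → s ≤ 0 →
      ‖x s‖ ≤ ‖z 0‖ ∧ ‖z s‖ ≤ ‖z 0‖ ∧ ‖ξ s‖ ≤ ‖z 0‖ := fun s _ hs => by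
    obtain ⟨h1, h2, h3⟩ := hinit s hs
    rw [h1, h2, h3, (hinit 0 le_rfl).2.1]
    simp
  have hlim : Filter.Tendsto (fun t : ℕ => z t) Filter.atTop (𝓝 0) := by
    refine squeeze_zero_norm (fun t => (hdec x z ξ htraj _ hM t).2.1) ?_
    have h1 := ((tendsto_pow_atTop_nhds_zero_of_lt_one hρ.le hρ1).const_mul c).mul_const ‖z 0‖
    simpa using h1
  have hcont : Continuous fun y : Fin N → Fin p × Fin d → ℝ => ζ ⬝ᵥ cvec (∑ i, l i • y i) := by
    unfold cvec dotProduct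
    fun_prop
  have hlim2 := (hcont.tendsto 0).comp hlim
  have h0 : ζ ⬝ᵥ cvec (∑ i, l i • (0 : Fin N → Fin p × Fin d → ℝ) i) = 0 := by
    simp [cvec, dotProduct]
  rw [h0, tendsto_zero_iff_norm_tendsto_zero] at hlim2
  have hlow : ∀ t : ℕ, ‖ζ ⬝ᵥ cvec (∑ i, l i • z (0 : ℕ) i)‖ ≤ ‖ζ ⬝ᵥ cvec (∑ i, l i • z t i)‖ := by
    intro t
    rw [hmode t, norm_mul, norm_pow]
    exact le_mul_of_one_le_left (norm_nonneg _) (one_le_pow₀ hμ)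
  have h1 := ge_of_tendsto' hlim2 hlow
  have h2 : ζ ⬝ᵥ cvec (∑ i, l i • z (0 : ℕ) i) = ζ k₀ * l i₀ := by
    rw [Nat.cast_zero, (hinit 0 le_rfl).2.1]
    have h3 : ∑ i, l i • (Pi.single i₀ (Pi.single k₀ 1) : Fin N → Fin p × Fin d → ℝ) i =
        Pi.single k₀ (l i₀) := by
      rw [Finset.sum_eq_single i₀ (fun i _ hi => by rw [Pi.single_eq_of_ne hi, smul_zero]) (by simp),
        Pi.single_eq_same]
      funext k
      by_cases hk : k = k₀ <;> simp [hk]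
    rw [h3, dotProduct, Finset.sum_eq_single k₀ (fun k _ hk => by simp [cvec, hk]) (by simp)]
    simp [cvec]
  rw [h2, norm_le_zero_iff] at h1
  exact mul_ne_zero hk₀ (Complex.ofReal_ne_zero.2 hi₀) h1

end CoopReg

end

theorem theorem4p2 {N n m p q d : ℕ} (hp : 0 < p) (hq : 0 < q)
    (P : CoopReg.Plant n m p q)
    (G : Digraph (Fin (N + 1))) (a : Matrix (Fin (N + 1)) (Fin (N + 1)) ℝ)
    (ha : CoopReg.IsWeightedAdjacency G a)
    (hstab : CoopReg.Stabilizable P.A P.B)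
    (hdet : CoopReg.Detectable P.C P.A)
    (hzero : CoopReg.TransmissionZeroCondition P.A P.B P.C P.S)
    (hS : ∀ μ ∈ CoopReg.eigs P.S, ‖μ‖ = 1)
    (hA : ∀ μ ∈ CoopReg.eigs P.A, ‖μ‖ ≤ 1)
    (G₁ : Matrix (Fin p × Fin d) (Fin p × Fin d) ℝ) (G₂ : Matrix (Fin p × Fin d) (Fin p) ℝ)
    (hG : CoopReg.IsMinimalPCopyInternalModel P.S G₁ G₂) :
    (∃ (K₁ : Matrix (Fin m) (Fin p × Fin d) ℝ) (K₂ : Matrix (Fin m) (Fin n) ℝ)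
        (L : Matrix (Fin n) (Fin p) ℝ),
        CoopReg.SolvesCORP P a ⟨G₁, G₂, K₁, K₂, L⟩) ↔
      CoopReg.HasDirectedSpanningTree G 0 := by
  rw [CoopReg.hasDirectedSpanningTree_iff]
  constructor
  · rintro ⟨K₁, K₂, L, hstable, -⟩
    by_contra hreach
    obtain ⟨l, hl0, hl⟩ := CoopReg.exists_vecMul_followerLap_eq_zero ha hreach
    obtain ⟨μ, hμ, ζ, hζ0, hζ⟩ := hG.exists_mode hp hq
    exact CoopReg.not_nominalExponentiallyStable (κ := ⟨G₁, G₂, K₁, K₂, L⟩) hl0 hl (hS μ hμ).ge hζ0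
      hζ hstable
  · intro hreach
    obtain ⟨K₁, K₂, L, h⟩ :=
      CoopReg.exists_loopStable (N := N) ha hreach hstab hdet hzero hS hA hG
    refine ⟨K₁, K₂, L, h.solvesCORP (fun h0 => ?_) hq hG⟩
    exact lt_irrefl 0 (CoopReg.re_pos_of_mem_spectrum_followerLap ha hreach h0)
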